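/- Write $v(p)=p/\sqrt{1+|p|^2}$ for $p\in\mathbb R^3$. A classical solution of the Vlasov–Darwin system on $[0,T[$, $T>0$, consists of functions $f:[0,T[\times\mathbb R^3\times\mathbb R^3\to\mathbb R$ and $E_L,E_T,B:[0,T[\times\mathbb R^3\to\mathbb R^3$ such that $f$, $E_L$, $B$ are of class $C^1$, $E_T$ and $\nabla_xE_T$ exist and are continuous, $f(t,\cdot,\cdot)$ has compact support and $E_L(t,x),E_T(t,x),B(t,x)\to 0$ as $|x|\to\infty$ for every $t\in[0,T[$, and $$\partial_tf+v(p)\cdot\nabla_xf+(E_L+E_T+v(p)\times B)\cdot\nabla_pf=0,$$ $$\nabla\times E_L=0,\quad \nabla\cdot E_T=0,\quad \partial_tE_L-\nabla\times B=-j,\quad \nabla\cdot E_L=\rho,\quad \partial_tB+\nabla\times E_T=0,\quad \nabla\cdot B=0,$$ where $\rho(t,x)=\int f(t,x,p)\,dp$ and $j(t,x)=\int f(t,x,p)\,v(p)\,dp$. For $R_0,P_0>0$ let $\mathcal D$ be the set of all $g\in C^2_c(\mathbb R^3\times\mathbb R^3)$ with $g\ge 0$, $\|g\|_\infty\le 1$,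 $\|\nabla g\|_\infty\le 1$ and $\operatorname{supp} g\subset B_{R_0}(0)\times B_{P_0}(0)$, where $B_r(0)$ is the open ball in $\mathbb R^3$. For a function $F$ on $\mathbb R^3$ let $\|F\|_\infty=\sup_x|F(x)|$. The solution is said to satisfy the free streaming condition with parameter $\alpha$ on $[0,a]$, where $a<T$, if for all $t\in[0,a]$ $$\|E_T(t)\|_\infty+\|E_L(t)\|_\infty+\|B(t)\|_\infty\le\alpha(1+t)^{-3/2},$$ $$\|\nabla E_T(t)\|_\infty+\|\nabla E_L(t)\|_\infty+\|\nabla B(t)\|_\infty\le\alpha(1+t)^{-5/2}.$$ **Proposition.** For all $R_0,P_0>0$ there exist constants $\alpha>0$ and $C_2>0$, depending only on $R_0$ and $P_0$, such that for every $T>0$, every classical solution $(f,E_L,E_T,B)$ of the Vlasov–Darwin system on $[0,T[$ with $f(0)\in\mathcal D$, and every $a<T$ such that the solution satisfies the free streaming condition with parameter $\alpha$ on $[0,a]$, one has for all $t\in[1,a]$ $$\|E_T(t)\|_\infty+\|E_L(t)\|_\infty+\|B(t)\|_\infty\le C_2\,t^{-9/5},$$ $$\|\nabla E_T(t)\|_\infty+\|\nabla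 E_L(t)\|_\infty+\|\nabla B(t)\|_\infty\le C_2\,t^{-8/3}.$$ -/

import Mathlib

open MeasureTheory Set Filter Topology
open scoped ENNReal

noncomputable section

namespace VlasovDarwin

/-- Euclidean three-space. -/
abbrev E3 : Type := EuclideanSpace ℝ (Fin 3)

/-- The cross product `u × w` on Euclidean three-space. -/
def cross (u w : E3) : E3 :=
  WithLp.toLp 2 (crossProduct (WithLp.ofLp u) (WithLp.ofLp w))

/-- The partial derivative `∂ᵢ Fⱼ (x)` of a vector field. -/
def partialD (F : E3 → E3) (i j : Fin 3) (x : E3) : ℝ :=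
  (fderiv ℝ F x (EuclideanSpace.single i 1)) j

/-- The divergence `∇ · F`. -/
def divergence (F : E3 → E3) (x : E3) : ℝ :=
  ∑ i : Fin 3, partialD F i i x

/-- The rotation `∇ × F`. -/
def curl (F : E3 → E3) (x : E3) : E3 :=
  !₂[partialD F 1 2 x - partialD F 2 1 x,
     partialD F 2 0 x - partialD F 0 2 x,
     partialD F 0 1 x - partialD F 1 0 x]

/-- The relativistic velocity `v(p) = p / √(1 + |p|²)`. -/
def velocity (p : E3) : E3 :=
  (Real.sqrt (1 + ‖p‖ ^ 2))⁻¹ • p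

/-- The charge density `ρ(t,x) = ∫ f(t,x,p) dp`. -/
def chargeDensity (f : ℝ → E3 → E3 → ℝ) (t : ℝ) (x : E3) : ℝ :=
  ∫ p : E3, f t x p

/-- The current density `j(t,x) = ∫ f(t,x,p) v(p) dp`. -/
def currentDensity (f : ℝ → E3 → E3 → ℝ) (t : ℝ) (x : E3) : E3 :=
  ∫ p : E3, f t x p • velocity p

/-- The force `K(t,x,p) = E_L + E_T + v(p) × B`. -/
def force (EL ET B : ℝ → E3 → E3) (t : ℝ) (x p : E3) : E3 :=
  EL t x + ET t x + cross (velocity p) (B t x)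

/-- `(f, E_L, E_T, B)` is a classical solution of the Vlasov-Darwin system on `[0,T[`.
Time derivatives are derivatives within `[0,T[`, hence one-sided at `t = 0`. -/
structure IsClassicalSolution (T : ℝ) (f : ℝ → E3 → E3 → ℝ) (EL ET B : ℝ → E3 → E3) :
    Prop where
  /-- `f` is of class `C¹` on `[0,T[ × ℝ³ × ℝ³`. -/
  contDiffOn_f : ContDiffOn ℝ 1 (fun z : ℝ × E3 × E3 => f z.1 z.2.1 z.2.2)
    (Ico 0 T ×ˢ (univ : Set (E3 × E3)))
  /-- `f(t)` has compact support. -/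
  compact_f : ∀ t ∈ Ico 0 T, HasCompactSupport (fun z : E3 × E3 => f t z.1 z.2)
  /-- `E_L` is of class `C¹` on `[0,T[ × ℝ³`. -/
  contDiffOn_EL : ContDiffOn ℝ 1 (fun z : ℝ × E3 => EL z.1 z.2) (Ico 0 T ×ˢ (univ : Set E3))
  /-- `B` is of class `C¹` on `[0,T[ × ℝ³`. -/
  contDiffOn_B : ContDiffOn ℝ 1 (fun z : ℝ × E3 => B z.1 z.2) (Ico 0 T ×ˢ (univ : Set E3))
  /-- `E_T` is continuous on `[0,T[ × ℝ³`. -/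
  continuousOn_ET : ContinuousOn (fun z : ℝ × E3 => ET z.1 z.2) (Ico 0 T ×ˢ (univ : Set E3))
  /-- `E_T` is differentiable in `x`. -/
  differentiable_ET : ∀ t ∈ Ico 0 T, Differentiable ℝ (ET t)
  /-- `∇ₓ E_T` is continuous on `[0,T[ × ℝ³`. -/
  continuousOn_fderiv_ET : ContinuousOn (fun z : ℝ × E3 => fderiv ℝ (ET z.1) z.2)
    (Ico 0 T ×ˢ (univ : Set E3))
  /-- `∂ₜ f + v(p) · ∇ₓ f + K · ∇ₚ f = 0`. -/
  vlasov : ∀ t ∈ Ico 0 T, ∀ x p : E3,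
    derivWithin (fun s => f s x p) (Ico 0 T) t
      + inner ℝ (velocity p) (gradient (fun y => f t y p) x)
      + inner ℝ (force EL ET B t x p) (gradient (fun q => f t x q) p) = 0
  /-- `∇ × E_L = 0`. -/
  curl_EL : ∀ t ∈ Ico 0 T, ∀ x : E3, curl (EL t) x = 0
  /-- `∇ · E_T = 0`. -/
  div_ET : ∀ t ∈ Ico 0 T, ∀ x : E3, divergence (ET t) x = 0
  /-- `∂ₜ E_L - ∇ × B = -j`. -/
  ampere : ∀ t ∈ Ico 0 T, ∀ x : E3,
    derivWithin (fun s => EL s x) (Ico 0 T) t - curl (B t) x = -currentDensity f t x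
  /-- `∇ · E_L = ρ`. -/
  gauss : ∀ t ∈ Ico 0 T, ∀ x : E3, divergence (EL t) x = chargeDensity f t x
  /-- `∂ₜ B + ∇ × E_T = 0`. -/
  faraday : ∀ t ∈ Ico 0 T, ∀ x : E3,
    derivWithin (fun s => B s x) (Ico 0 T) t + curl (ET t) x = 0
  /-- `∇ · B = 0`. -/
  div_B : ∀ t ∈ Ico 0 T, ∀ x : E3, divergence (B t) x = 0
  /-- `E_L` vanishes at spatial infinity. -/
  EL_infty : ∀ t ∈ Ico 0 T, Tendsto (EL t) (cocompact E3) (𝓝 0)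
  /-- `E_T` vanishes at spatial infinity. -/
  ET_infty : ∀ t ∈ Ico 0 T, Tendsto (ET t) (cocompact E3) (𝓝 0)
  /-- `B` vanishes at spatial infinity. -/
  B_infty : ∀ t ∈ Ico 0 T, Tendsto (B t) (cocompact E3) (𝓝 0)

/-- The set `𝒟` of initial data: nonnegative `C²` functions `g` on `ℝ³ × ℝ³` with support in
`B_{R₀} × B_{P₀}`, `‖g‖_∞ ≤ 1` and `‖∇g‖_∞ ≤ 1`, where `|∇g|² = |∇ₓ g|² + |∇ₚ g|²`. -/
structure InitialData (R₀ P₀ : ℝ) (g : E3 → E3 → ℝ) : Prop where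
  contDiff : ContDiff ℝ 2 (fun z : E3 × E3 => g z.1 z.2)
  hasCompactSupport : HasCompactSupport (fun z : E3 × E3 => g z.1 z.2)
  nonneg : ∀ x p, 0 ≤ g x p
  le_one : ∀ x p, |g x p| ≤ 1
  gradient_le_one : ∀ x p,
    Real.sqrt (‖gradient (fun y => g y p) x‖ ^ 2 + ‖gradient (fun q => g x q) p‖ ^ 2) ≤ 1
  support : tsupport (fun z : E3 × E3 => g z.1 z.2) ⊆ Metric.ball 0 R₀ ×ˢ Metric.ball 0 P₀

/-- The norm `‖F‖_∞ = sup_x |F(x)|`, with values in `[0,∞]`. -/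
def supNorm {V : Type} [NormedAddCommGroup V] (F : E3 → V) : ℝ≥0∞ :=
  ⨆ x : E3, ‖F x‖ₑ

/-- `‖E_T(t)‖_∞ + ‖E_L(t)‖_∞ + ‖B(t)‖_∞`. -/
def fieldNorm (EL ET B : ℝ → E3 → E3) (t : ℝ) : ℝ≥0∞ :=
  supNorm (ET t) + supNorm (EL t) + supNorm (B t)

/-- `‖∇E_T(t)‖_∞ + ‖∇E_L(t)‖_∞ + ‖∇B(t)‖_∞`, with the operator norm of the Jacobian. -/
def gradFieldNorm (EL ET B : ℝ → E3 → E3) (t : ℝ) : ℝ≥0∞ :=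
  supNorm (fderiv ℝ (ET t)) + supNorm (fderiv ℝ (EL t)) + supNorm (fderiv ℝ (B t))

/-- The free streaming condition with parameter `α` on `[0,a]`. -/
def FreeStreaming (α a : ℝ) (EL ET B : ℝ → E3 → E3) : Prop :=
  ∀ t ∈ Icc 0 a,
    fieldNorm EL ET B t ≤ ENNReal.ofReal (α * (1 + t) ^ (-(3 / 2) : ℝ)) ∧
    gradFieldNorm EL ET B t ≤ ENNReal.ofReal (α * (1 + t) ^ (-(5 / 2) : ℝ))

end VlasovDarwin

end

open MeasureTheory Set Filter Topology
open scoped ENNReal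

noncomputable section

namespace VlasovDarwin

/-! Under the free streaming condition with small `α`, particles move almost freely, and comparing
pairs of characteristics shows that `f` disperses. Two characteristics that meet at `(t, x)` with
momenta `p` and `q` have velocities whose difference has, on average over `[0, t]`, a component of
size at least a multiple of `|p - q|` along `p - q`, because `v` is strongly monotone on bounded
sets. Both start within distance `R₀` of the origin, so `t |p - q|` is bounded
(`ForceBounds.norm_sub_ge_of_pos_eq`), and the momentum support over each `x` has volume `O(t⁻³)`.
Two characteristics with equal momentum at time `t` stay within a fixed multiple of their final
distance (`ForceBounds.norm_sub_le_of_mom_eq`), so `f(t)` is Lipschitz in `x` uniformly in `t`.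
`IsClassicalSolution.densityBounds` collects these facts.

The fields are recovered from the kernel `|y - x|`, whose bilaplacian is `-8π δₓ`. Integration by
parts turns the equations for `E_L` and `B` into integrals of `ρ` and `j` against third derivatives
of the kernel. For `E_T` it leaves the time derivative of integrals of `j` against second
derivatives, and the Vlasov equation (`IsClassicalSolution.hasDerivAt_currentDensity`) converts it
into a transport term with third derivatives and a force term with second derivatives. As the
spatial support lies in `|y| ≤ R₀ + t`, the transport terms are of order `t⁻³ ∫ |y - x|⁻² ~ t⁻²`,
and the force term of order `t^(-3/2) t⁻³ ∫ |y - x|⁻¹ ~ t^(-5/2)`. Both are below `t^(-9/5)`.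

A gradient costs one more derivative, and `|y - x|⁻³` is not integrable at `x`. Near `x` one
derivative is moved onto `f`, where the Lipschitz bound gives `t⁻³`. Away from `x` the kernel is
estimated by `|y - x|^(-8/3)`, which absorbs the logarithm and gives `t^(-8/3)`.

Since the fields are only `C¹` or less, everything is done weakly. The kernel is smoothed at scale
`s`, and subtracting its version at scale `r` gives a compactly supported test function `psiDiff s r
x`. Letting `r → ∞` and then `s → 0` recovers the point values (`abs_le_of_integral_bilap`,
`abs_pd_le_of_integral_bilap`). -/

/-! ### The relativistic velocity -/

/-- The Lorentz factor `√(1 + |p|²)`. -/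
def lorentz (p : E3) : ℝ := Real.sqrt (1 + ‖p‖ ^ 2)

lemma lorentz_sq (p : E3) : lorentz p ^ 2 = 1 + ‖p‖ ^ 2 :=
  Real.sq_sqrt (by positivity)

lemma lorentz_pos (p : E3) : 0 < lorentz p := Real.sqrt_pos.2 (by positivity)

lemma one_le_lorentz (p : E3) : 1 ≤ lorentz p :=
  Real.one_le_sqrt.2 (by nlinarith [sq_nonneg ‖p‖])

lemma velocity_eq (p : E3) : velocity p = (lorentz p)⁻¹ • p := rfl

lemma norm_velocity_le_one (p : E3) : ‖velocity p‖ ≤ 1 := by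
  rw [velocity_eq, norm_smul, Real.norm_of_nonneg (inv_nonneg.2 (lorentz_pos p).le),
    inv_mul_le_iff₀ (lorentz_pos p), mul_one]
  exact Real.le_sqrt_of_sq_le (by linarith)

lemma norm_velocity_sub_le (p q : E3) : ‖velocity p - velocity q‖ ≤ ‖p - q‖ := by
  have hp := lorentz_pos p
  have hq := lorentz_pos q
  have h1p := one_le_lorentz p
  have h1q := one_le_lorentz q
  have key : ‖velocity p - velocity q‖ ^ 2 ≤ ‖p - q‖ ^ 2 := by
    rw [velocity_eq, velocity_eq, norm_sub_sq_real, norm_sub_sq_real, norm_smul, norm_smul,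
      inner_smul_left, inner_smul_right, Real.norm_of_nonneg (inv_nonneg.2 hp.le),
      Real.norm_of_nonneg (inv_nonneg.2 hq.le)]
    simp only [conj_trivial]
    have ep : ‖p‖ ^ 2 = lorentz p ^ 2 - 1 := by rw [lorentz_sq]; ring
    have eq : ‖q‖ ^ 2 = lorentz q ^ 2 - 1 := by rw [lorentz_sq]; ring
    have hs : 0 ≤ ‖p‖ ^ 2 - 2 * inner ℝ p q + ‖q‖ ^ 2 := by
      rw [← norm_sub_sq_real]; positivity
    rw [mul_pow, mul_pow, ep, eq]
    rw [ep, eq] at hs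
    generalize lorentz p = a at *
    generalize lorentz q = b at *
    generalize inner ℝ p q = c at *
    -- With `a`, `b` the Lorentz factors, `|v(p) - v(q)|²` is `|p - q|² / (ab)` minus a nonnegative
    -- multiple of `(a - b)²`. Since `ab ≥ 1`, this is at most `|p - q|²`.
    have e : (a⁻¹ ^ 2 * (a ^ 2 - 1) - 2 * (a⁻¹ * (b⁻¹ * c)) + b⁻¹ ^ 2 * (b ^ 2 - 1))
        = (a * b)⁻¹ * (a ^ 2 - 1 - 2 * c + (b ^ 2 - 1))
          - (a - b) ^ 2 * (a * b)⁻¹ * (1 + (a * b)⁻¹) := by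
      field_simp
      ring
    rw [e]
    have h1 : (a * b)⁻¹ ≤ 1 := inv_le_one_of_one_le₀ (by nlinarith)
    have h2 : 0 ≤ (a - b) ^ 2 * (a * b)⁻¹ * (1 + (a * b)⁻¹) := by positivity
    nlinarith
  exact abs_le_of_sq_le_sq' key (norm_nonneg _) |>.2

/-- The modulus of monotonicity of the velocity on the ball of radius `R`. -/
def monoConst (R : ℝ) : ℝ := (Real.sqrt (1 + R ^ 2))⁻¹ * (1 + R ^ 2)⁻¹

lemma monoConst_pos (R : ℝ) : 0 < monoConst R := by
  unfold monoConst
  have : 0 < Real.sqrt (1 + R ^ 2) := Real.sqrt_pos.2 (by positivity)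
  positivity

/-- The inner product equals the mean of the inverse Lorentz factors times `|p - q|² - (γ(p) -
γ(q))²`. On the ball of radius `R` the factor `γ` has Lipschitz constant `R / √(1 + R²) < 1`, which
leaves the fraction `1 / (1 + R²)` of `|p - q|²`. -/
lemma inner_velocity_sub_ge {R : ℝ} {p q : E3} (hp : ‖p‖ ≤ R) (hq : ‖q‖ ≤ R) :
    monoConst R * ‖p - q‖ ^ 2 ≤ inner ℝ (velocity p - velocity q) (p - q) := by
  have hR : 0 ≤ R := (norm_nonneg _).trans hp
  have hap := lorentz_pos p
  have hbq := lorentz_pos q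
  set G := Real.sqrt (1 + R ^ 2) with hG
  have hGpos : 0 < G := Real.sqrt_pos.2 (by positivity)
  have hGsq : G ^ 2 = 1 + R ^ 2 := Real.sq_sqrt (by positivity)
  have haG : lorentz p ≤ G := Real.sqrt_le_sqrt (by gcongr)
  have hbG : lorentz q ≤ G := Real.sqrt_le_sqrt (by gcongr)
  have ratio : ∀ u : E3, ‖u‖ ≤ R → ‖u‖ * G ≤ R * lorentz u := by
    intro u hu
    refine abs_le_of_sq_le_sq' ?_ (mul_nonneg hR (lorentz_pos u).le) |>.2
    rw [mul_pow, mul_pow, hGsq, lorentz_sq]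
    nlinarith [pow_le_pow_left₀ (norm_nonneg u) hu 2]
  have hdiff : |lorentz p - lorentz q| * G ≤ R * ‖p - q‖ := by
    have e : (lorentz p - lorentz q) * (lorentz p + lorentz q)
        = (‖p‖ - ‖q‖) * (‖p‖ + ‖q‖) := by
      have := lorentz_sq p; have := lorentz_sq q; nlinarith
    have hsum : 0 < lorentz p + lorentz q := by positivity
    have e2 : |lorentz p - lorentz q| * (lorentz p + lorentz q)
        = |‖p‖ - ‖q‖| * (‖p‖ + ‖q‖) := by
      rw [← abs_of_pos hsum, ← abs_mul, e, abs_mul,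
        abs_of_nonneg (add_nonneg (norm_nonneg p) (norm_nonneg q))]
    have h3 : |‖p‖ - ‖q‖| ≤ ‖p - q‖ := abs_norm_sub_norm_le p q
    have h4 : (‖p‖ + ‖q‖) * G ≤ R * (lorentz p + lorentz q) := by
      have := ratio p hp; have := ratio q hq; nlinarith
    refine le_of_mul_le_mul_right ?_ hsum
    calc |lorentz p - lorentz q| * G * (lorentz p + lorentz q)
        = |‖p‖ - ‖q‖| * ((‖p‖ + ‖q‖) * G) := by rw [mul_right_comm, e2]; ring
      _ ≤ ‖p - q‖ * (R * (lorentz p + lorentz q)) :=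
          mul_le_mul h3 h4 (by positivity) (norm_nonneg _)
      _ = _ := by ring
  have hsq : (lorentz p - lorentz q) ^ 2 * G ^ 2 ≤ R ^ 2 * ‖p - q‖ ^ 2 := by
    rw [← mul_pow, ← mul_pow, ← sq_abs, abs_mul, abs_of_pos hGpos]
    exact pow_le_pow_left₀ (by positivity) hdiff 2
  have ident : inner ℝ (velocity p - velocity q) (p - q)
      = ((lorentz p)⁻¹ + (lorentz q)⁻¹) / 2 * (‖p - q‖ ^ 2 - (lorentz p - lorentz q) ^ 2) := by
    rw [velocity_eq, velocity_eq, inner_sub_left, inner_sub_right, inner_sub_right,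
      inner_smul_left, inner_smul_left, inner_smul_left, inner_smul_left,
      real_inner_self_eq_norm_sq, real_inner_self_eq_norm_sq, norm_sub_sq_real,
      real_inner_comm p q]
    have ep : ‖p‖ ^ 2 = lorentz p ^ 2 - 1 := by rw [lorentz_sq]; ring
    have eq : ‖q‖ ^ 2 = lorentz q ^ 2 - 1 := by rw [lorentz_sq]; ring
    simp only [conj_trivial]
    rw [ep, eq]
    field_simp
    ring
  rw [ident]
  have h5 : ‖p - q‖ ^ 2 * (1 + R ^ 2)⁻¹ ≤ ‖p - q‖ ^ 2 - (lorentz p - lorentz q) ^ 2 := by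
    rw [← hGsq, ← div_eq_mul_inv, div_le_iff₀ (by positivity)]
    nlinarith
  have h6 : G⁻¹ ≤ ((lorentz p)⁻¹ + (lorentz q)⁻¹) / 2 := by
    have := inv_anti₀ hap haG; have := inv_anti₀ hbq hbG; linarith
  calc monoConst R * ‖p - q‖ ^ 2 = G⁻¹ * (‖p - q‖ ^ 2 * (1 + R ^ 2)⁻¹) := by
        unfold monoConst; ring
    _ ≤ _ := mul_le_mul h6 h5 (by positivity) (by positivity)

lemma contDiff_velocity {n : WithTop ℕ∞} : ContDiff ℝ n velocity := by
  unfold velocity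
  refine ContDiff.smul (ContDiff.inv (ContDiff.sqrt ?_ fun p => ?_) fun p => ?_) contDiff_id
  · exact contDiff_const.add (contDiff_norm_sq ℝ)
  · positivity
  · exact (Real.sqrt_pos.2 (by positivity)).ne'

lemma norm_fderiv_velocity_le (p : E3) : ‖fderiv ℝ velocity p‖ ≤ 1 := by
  refine norm_fderiv_le_of_lipschitz ℝ (C := 1) ?_
  refine LipschitzWith.of_dist_le_mul fun p q => ?_
  rw [dist_eq_norm, dist_eq_norm, NNReal.coe_one, one_mul]
  exact norm_velocity_sub_le p q

lemma fderiv_velocity_apply (p u : E3) :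
    fderiv ℝ velocity p u
      = (lorentz p)⁻¹ • u - ((lorentz p)⁻¹ ^ 3 * inner ℝ p u) • p := by
  have hpos : (1 + ‖p‖ ^ 2) ≠ 0 := by positivity
  have h1 : HasFDerivAt (fun q : E3 => 1 + ‖q‖ ^ 2) (2 • innerSL ℝ p) p := by
    simpa using (hasStrictFDerivAt_norm_sq p).hasFDerivAt.const_add 1
  have h2 := ((hasDerivAt_inv (lorentz_pos p).ne').comp_hasFDerivAt p (h1.sqrt hpos)).smul
    (hasFDerivAt_id p)
  have h3 : HasFDerivAt velocity _ p := h2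
  rw [h3.fderiv]
  have hl := (lorentz_pos p).ne'
  change ((lorentz p)⁻¹ • u + ((-(lorentz p ^ 2)⁻¹) * (1 / (2 * lorentz p) *
    (2 • inner ℝ p u))) • p) = _
  rw [sub_eq_add_neg, ← neg_smul]
  congr 2
  rw [nsmul_eq_mul]
  field_simp
  norm_num

/-- The velocity is the gradient of the Lorentz factor, so its Jacobian is a Hessian. The symmetry
makes the magnetic force divergence free in `p`. -/
lemma fderiv_velocity_symm (p : E3) (i k : Fin 3) :
    (fderiv ℝ velocity p (EuclideanSpace.single i 1)) k
      = (fderiv ℝ velocity p (EuclideanSpace.single k 1)) i := by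
  rw [fderiv_velocity_apply, fderiv_velocity_apply]
  by_cases h : i = k
  · subst h; rfl
  · simp [EuclideanSpace.inner_single_right, h, Ne.symm h]
    ring

/-! ### The cross product. -/

lemma norm_cross_le (u w : E3) : ‖cross u w‖ ≤ ‖u‖ * ‖w‖ := by
  refine abs_le_of_sq_le_sq' ?_ (by positivity) |>.2
  rw [mul_pow, EuclideanSpace.norm_sq_eq, EuclideanSpace.norm_sq_eq, EuclideanSpace.norm_sq_eq]
  simp only [cross, cross_apply, Fin.sum_univ_three, Real.norm_eq_abs, sq_abs]
  simp
  nlinarith [sq_nonneg (u 0 * w 0 + u 1 * w 1 + u 2 * w 2)]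

/-! ### Partial derivatives of scalar functions -/

/-- Smooth scalar functions on `ℝ³`. -/
abbrev Smooth (g : E3 → ℝ) : Prop := ContDiff ℝ (⊤ : ℕ∞) g

/-- The partial derivative `∂ᵢ g` of a scalar function. -/
def pd (i : Fin 3) (g : E3 → ℝ) : E3 → ℝ :=
  fun x => fderiv ℝ g x (EuclideanSpace.single i 1)

/-- The Laplacian of a scalar function. -/
def lap (g : E3 → ℝ) : E3 → ℝ := fun x => ∑ i, pd i (pd i g) x

lemma Smooth.differentiable {g : E3 → ℝ} (hg : Smooth g) : Differentiable ℝ g :=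
  ContDiff.differentiable hg (by simp)

lemma Smooth.pd {g : E3 → ℝ} (hg : Smooth g) (i : Fin 3) : Smooth (pd i g) :=
  (ContDiff.fderiv_right (m := (⊤ : ℕ∞)) hg (by simp)).clm_apply contDiff_const

lemma Smooth.lap {g : E3 → ℝ} (hg : Smooth g) : Smooth (lap g) :=
  ContDiff.sum fun i _ => (hg.pd i).pd i

lemma pd_comm {g : E3 → ℝ} (hg : Smooth g) (i k : Fin 3) : pd i (pd k g) = pd k (pd i g) := by
  ext x
  have hd : DifferentiableAt ℝ (fderiv ℝ g) x :=
    ((ContDiff.fderiv_right (m := (⊤ : ℕ∞)) hg (by simp)).differentiable (by simp)) x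
  have hs : IsSymmSndFDerivAt ℝ g x :=
    (contDiff_infty.1 hg 2).contDiffAt.isSymmSndFDerivAt (by simp)
  unfold pd
  rw [fderiv_clm_apply hd (differentiableAt_const _), fderiv_clm_apply hd (differentiableAt_const _)]
  simpa using hs _ _

lemma pd_congr {g₁ g₂ : E3 → ℝ} {x : E3} (h : g₁ =ᶠ[𝓝 x] g₂) (i : Fin 3) :
    pd i g₁ x = pd i g₂ x := by
  unfold pd; rw [h.fderiv_eq]

lemma pd_sub {g₁ g₂ : E3 → ℝ} (h₁ : Differentiable ℝ g₁) (h₂ : Differentiable ℝ g₂) (i : Fin 3) :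
    pd i (fun y => g₁ y - g₂ y) = fun y => pd i g₁ y - pd i g₂ y := by
  ext x; unfold pd; rw [fderiv_fun_sub (h₁ x) (h₂ x)]; rfl

lemma pd_sum {ι : Type} (s : Finset ι) {g : ι → E3 → ℝ} (h : ∀ k, Differentiable ℝ (g k))
    (i : Fin 3) : pd i (fun y => ∑ k ∈ s, g k y) = fun y => ∑ k ∈ s, pd i (g k) y := by
  ext x; unfold pd; rw [fderiv_fun_sum fun k _ => h k x]; simp

lemma pd_lap {g : E3 → ℝ} (hg : Smooth g) (i : Fin 3) : pd i (lap g) = lap (pd i g) := by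
  unfold lap
  rw [pd_sum _ fun k => ((hg.pd k).pd k).differentiable]
  ext x
  refine Finset.sum_congr rfl fun k _ => ?_
  rw [pd_comm (hg.pd k), pd_comm hg]

lemma lap_sub {g₁ g₂ : E3 → ℝ} (h₁ : Smooth g₁) (h₂ : Smooth g₂) :
    lap (fun y => g₁ y - g₂ y) = fun y => lap g₁ y - lap g₂ y := by
  ext x
  unfold lap
  rw [← Finset.sum_sub_distrib]
  refine Finset.sum_congr rfl fun k _ => ?_
  rw [pd_sub h₁.differentiable h₂.differentiable,
    pd_sub (h₁.pd k).differentiable (h₂.pd k).differentiable]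

lemma pd_eq_zero_of_eqOn {g : E3 → ℝ} {U : Set E3} (hU : IsOpen U) (h : ∀ x ∈ U, g x = 0)
    (i : Fin 3) : ∀ x ∈ U, pd i g x = 0 := by
  intro x hx
  have : g =ᶠ[𝓝 x] fun _ => 0 := Filter.eventuallyEq_of_mem (hU.mem_nhds hx) h
  rw [pd_congr this]; simp [pd]

lemma hasCompactSupport_pd {g : E3 → ℝ} (hg : HasCompactSupport g) (i : Fin 3) :
    HasCompactSupport (pd i g) :=
  (hg.fderiv (𝕜 := ℝ)).comp_left (g := fun L : E3 →L[ℝ] ℝ => L (EuclideanSpace.single i 1)) rfl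

/-- Test functions: smooth functions with compact support. -/
structure IsTest (g : E3 → ℝ) : Prop where
  smooth : Smooth g
  compact : HasCompactSupport g

lemma IsTest.pd {g : E3 → ℝ} (hg : IsTest g) (i : Fin 3) : IsTest (pd i g) :=
  ⟨hg.smooth.pd i, hasCompactSupport_pd hg.compact i⟩

lemma IsTest.sum {g : Fin 3 → E3 → ℝ} (hg : ∀ i, IsTest (g i)) :
    IsTest (fun y => ∑ i, g i y) := by
  refine ⟨ContDiff.sum fun i _ => (hg i).smooth, ?_⟩
  simp only [Fin.sum_univ_three]
  exact ((hg 0).compact.add (hg 1).compact).add (hg 2).compact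

lemma IsTest.lap {g : E3 → ℝ} (hg : IsTest g) : IsTest (lap g) :=
  IsTest.sum fun i => (hg.pd i).pd i

lemma IsTest.continuous {g : E3 → ℝ} (hg : IsTest g) : Continuous g := ContDiff.continuous hg.smooth

/-! ### Rescaled functions -/

/-- The function `y ↦ c g((y - x) / s)`. -/
def resc (c s : ℝ) (x : E3) (g : E3 → ℝ) : E3 → ℝ := fun y => c * g (s⁻¹ • (y - x))

lemma Smooth.resc {g : E3 → ℝ} (hg : Smooth g) (c s : ℝ) (x : E3) : Smooth (resc c s x g) :=
  contDiff_const.mul (hg.comp ((contDiff_id.sub contDiff_const).const_smul s⁻¹))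

lemma pd_resc {g : E3 → ℝ} (hg : Smooth g) (c s : ℝ) (x : E3) (i : Fin 3) :
    pd i (resc c s x g) = resc (c * s⁻¹) s x (pd i g) := by
  ext y
  have h1 : HasFDerivAt (fun y : E3 => s⁻¹ • (y - x)) (s⁻¹ • ContinuousLinearMap.id ℝ E3) y :=
    ((hasFDerivAt_id y).sub_const x).const_smul s⁻¹
  have h2 := ((hg.differentiable (s⁻¹ • (y - x))).hasFDerivAt.comp y h1).const_mul c
  have h3 : HasFDerivAt (VlasovDarwin.resc c s x g) _ y := h2
  unfold pd
  rw [h3.fderiv]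
  simp [VlasovDarwin.resc]
  ring

lemma lap_resc {g : E3 → ℝ} (hg : Smooth g) (c s : ℝ) (x : E3) :
    lap (resc c s x g) = resc (c * s⁻¹ * s⁻¹) s x (lap g) := by
  ext y
  unfold lap
  simp only [pd_resc hg, pd_resc (hg.pd _)]
  simp [resc, Finset.mul_sum]

/-! ### Functions homogeneous outside the unit ball -/

/-- `g(λ z) = λᵃ g(z)` for `|z| > 1` and `λ ≥ 1`. -/
def Homog (a : ℤ) (g : E3 → ℝ) : Prop :=
  ∀ z : E3, 1 < ‖z‖ → ∀ l : ℝ, 1 ≤ l → g (l • z) = l ^ a * g z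

/-- The scaling identity holds on the open set `|z| > 1`, so it may be differentiated there. -/
lemma Homog.pd {a : ℤ} {g : E3 → ℝ} (hg : Smooth g) (h : Homog a g) (i : Fin 3) :
    Homog (a - 1) (pd i g) := by
  intro z hz l hl
  have hl0 : l ≠ 0 := by positivity
  have hopen : IsOpen {z : E3 | 1 < ‖z‖} := isOpen_lt continuous_const continuous_norm
  have e : (fun y : E3 => g (l • y)) =ᶠ[𝓝 z] fun y => l ^ a * g y :=
    Filter.eventuallyEq_of_mem (hopen.mem_nhds hz) fun y hy => h y hy l hl
  have h1 : HasFDerivAt (fun y : E3 => l • y) (l • ContinuousLinearMap.id ℝ E3) z :=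
    (hasFDerivAt_id z).const_smul l
  have h2 := (hg.differentiable (l • z)).hasFDerivAt.comp z h1
  have h3 := ((hg.differentiable z).hasFDerivAt).const_mul (l ^ a)
  have h4 := (h2.congr_of_eventuallyEq e.symm).unique h3
  have h5 := congrArg (fun L : E3 →L[ℝ] ℝ => L (EuclideanSpace.single i 1)) h4
  simp only [ContinuousLinearMap.comp_apply, _root_.smul_apply,
    ContinuousLinearMap.id_apply, map_smul, smul_eq_mul] at h5
  unfold VlasovDarwin.pd
  rw [zpow_sub_one₀ hl0]
  field_simp
  linarith

/-- Compactness handles `|z| ≤ 2`. A point further out is a dilation, by a factor at least `1`, of a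
point on the sphere of radius `2`, which lies inside the open region where homogeneity is available.
-/
lemma Homog.exists_bound {n : ℕ} {g : E3 → ℝ} (hg : Continuous g) (h : Homog (-(n : ℤ)) g) :
    ∃ C : ℝ, 0 ≤ C ∧ ∀ z, |g z| ≤ C ∧ |g z| * ‖z‖ ^ n ≤ C := by
  obtain ⟨M, hM⟩ := (isCompact_closedBall (0 : E3) 2).exists_bound_of_continuousOn hg.continuousOn
  have hM0 : 0 ≤ M := (norm_nonneg _).trans (hM 0 (by simp))
  refine ⟨M * 2 ^ n, by positivity, fun z => ?_⟩
  have h2n : (1 : ℝ) ≤ 2 ^ n := one_le_pow₀ (by norm_num)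
  by_cases hz : ‖z‖ ≤ 2
  · have := hM z (by simpa using hz)
    rw [Real.norm_eq_abs] at this
    constructor
    · nlinarith
    · exact mul_le_mul this (pow_le_pow_left₀ (norm_nonneg _) hz n) (by positivity) hM0
  · push Not at hz
    have hzpos : 0 < ‖z‖ := by linarith
    set l := ‖z‖ / 2 with hl
    have hl1 : 1 ≤ l := by rw [hl]; linarith
    have hl0 : 0 < l := by linarith
    set u := l⁻¹ • z with hu
    have hun : ‖u‖ = 2 := by
      rw [hu, norm_smul, Real.norm_of_nonneg (by positivity), hl]; field_simp
    have hzu : z = l • u := by rw [hu, smul_smul, mul_inv_cancel₀ hl0.ne', one_smul]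
    have e := h u (by rw [hun]; norm_num) l hl1
    rw [← hzu, zpow_neg, zpow_natCast] at e
    have hgu := hM u (by simp [hun])
    rw [Real.norm_eq_abs] at hgu
    have hln : (1 : ℝ) ≤ l ^ n := one_le_pow₀ hl1
    have hli : (l ^ n)⁻¹ ≤ 1 := inv_le_one_of_one_le₀ hln
    have hz2 : ‖z‖ = l * 2 := by rw [hl]; ring
    rw [e, abs_mul, abs_of_pos (by positivity)]
    constructor
    · calc (l ^ n)⁻¹ * |g u| ≤ 1 * M := mul_le_mul hli hgu (abs_nonneg _) zero_le_one
        _ ≤ M * 2 ^ n := by nlinarith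
    · rw [hz2, mul_pow]
      calc (l ^ n)⁻¹ * |g u| * (l ^ n * 2 ^ n) = |g u| * 2 ^ n := by field_simp
        _ ≤ M * 2 ^ n := by gcongr

/-! ### A smooth function that equals the norm outside the unit ball -/

/-- The Laplacian of `y ↦ η(|y|²)` is `y ↦ (radialLap η)(|y|²)`. -/
def radialLap (η : ℝ → ℝ) : ℝ → ℝ := fun q => 6 * deriv η q + 4 * q * deriv (deriv η) q

lemma contDiff_deriv_top {η : ℝ → ℝ} (hη : ContDiff ℝ (⊤ : ℕ∞) η) :
    ContDiff ℝ (⊤ : ℕ∞) (deriv η) :=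
  ContDiff.iterate_deriv 1 hη

lemma contDiff_radialLap {η : ℝ → ℝ} (hη : ContDiff ℝ (⊤ : ℕ∞) η) :
    ContDiff ℝ (⊤ : ℕ∞) (radialLap η) :=
  (contDiff_const.mul (contDiff_deriv_top hη)).add
    ((contDiff_const.mul contDiff_id).mul (contDiff_deriv_top (contDiff_deriv_top hη)))

lemma pd_radial {η : ℝ → ℝ} (hη : ContDiff ℝ (⊤ : ℕ∞) η) (i : Fin 3) :
    pd i (fun y => η (‖y‖ ^ 2)) = fun y => 2 * y i * deriv η (‖y‖ ^ 2) := by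
  ext y
  have h1 : HasFDerivAt (fun y : E3 => ‖y‖ ^ 2) (2 • innerSL ℝ y) y :=
    (hasStrictFDerivAt_norm_sq y).hasFDerivAt
  have h2 := ((hη.differentiable (by simp)) (‖y‖ ^ 2)).hasDerivAt.comp_hasFDerivAt y h1
  unfold pd
  rw [show (fun y : E3 => η (‖y‖ ^ 2)) = η ∘ fun y => ‖y‖ ^ 2 from rfl, h2.fderiv]
  simp [EuclideanSpace.inner_single_right]
  ring

lemma hasFDerivAt_coord (i : Fin 3) (y : E3) :
    HasFDerivAt (fun y : E3 => y i) (EuclideanSpace.proj i : E3 →L[ℝ] ℝ) y :=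
  (EuclideanSpace.proj i : E3 →L[ℝ] ℝ).hasFDerivAt

lemma lap_radial {η : ℝ → ℝ} (hη : ContDiff ℝ (⊤ : ℕ∞) η) :
    lap (fun y => η (‖y‖ ^ 2)) = fun y => radialLap η (‖y‖ ^ 2) := by
  ext y
  have key : ∀ i : Fin 3, pd i (pd i (fun y => η (‖y‖ ^ 2))) y
      = 2 * deriv η (‖y‖ ^ 2) + 4 * (y i) ^ 2 * deriv (deriv η) (‖y‖ ^ 2) := by
    intro i
    rw [pd_radial hη]
    have hη' := contDiff_deriv_top hη
    have h0 : Smooth (fun y => deriv η (‖y‖ ^ 2)) := hη'.comp (contDiff_norm_sq ℝ)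
    have h1 := ((hasFDerivAt_coord i y).const_mul 2).mul (h0.differentiable y).hasFDerivAt
    have h2 := congrFun (pd_radial hη' i) y
    unfold pd at h2 ⊢
    erw [h1.fderiv]
    simp [h2]
    ring
  unfold lap
  simp only [key]
  rw [EuclideanSpace.norm_sq_eq]
  simp only [radialLap, Fin.sum_univ_three, Real.norm_eq_abs, sq_abs]
  ring

/-- A smooth profile that equals `√q` for `q ≥ 1`. -/
def sqrtProfile (q : ℝ) : ℝ := Real.sqrt q * Real.smoothTransition (2 * q - 1)

lemma contDiff_sqrtProfile : ContDiff ℝ (⊤ : ℕ∞) sqrtProfile := by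
  rw [contDiff_iff_contDiffAt]
  intro q
  -- The transition function vanishes for `q ≤ 1/2`, which removes the singularity of `√q` at `0`.
  by_cases hq : q < 1 / 2
  · have : sqrtProfile =ᶠ[𝓝 q] fun _ => 0 := by
      filter_upwards [gt_mem_nhds hq] with r hr
      rw [sqrtProfile, Real.smoothTransition.zero_of_nonpos (by linarith), mul_zero]
    exact contDiffAt_const.congr_of_eventuallyEq this
  · refine (contDiffAt_id.sqrt (by simp only [id]; linarith)).mul ?_
    exact (Real.smoothTransition.contDiff.comp
      ((contDiff_const.mul contDiff_id).sub contDiff_const)).contDiffAt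

lemma sqrtProfile_of_one_le {q : ℝ} (hq : 1 ≤ q) : sqrtProfile q = Real.sqrt q := by
  rw [sqrtProfile, Real.smoothTransition.one_of_one_le (by linarith), mul_one]

/-- A smooth function on `ℝ³` that equals `|y|` for `|y| ≥ 1`. -/
def smoothNorm (y : E3) : ℝ := sqrtProfile (‖y‖ ^ 2)

lemma smooth_smoothNorm : Smooth smoothNorm :=
  contDiff_sqrtProfile.comp (contDiff_norm_sq ℝ)

lemma smoothNorm_of_one_le {y : E3} (hy : 1 ≤ ‖y‖) : smoothNorm y = ‖y‖ := by
  rw [smoothNorm, sqrtProfile_of_one_le (one_le_pow₀ hy), Real.sqrt_sq (norm_nonneg _)]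

lemma homog_smoothNorm : Homog 1 smoothNorm := by
  intro z hz l hl
  have hlz : ‖l • z‖ = l * ‖z‖ := by rw [norm_smul, Real.norm_of_nonneg (by linarith)]
  rw [smoothNorm_of_one_le hz.le, smoothNorm_of_one_le (by rw [hlz]; nlinarith), hlz, zpow_one]

/-- The bilaplacian of `smoothNorm`. -/
def bilapKernel : E3 → ℝ := lap (lap smoothNorm)

lemma smooth_bilapKernel : Smooth bilapKernel := smooth_smoothNorm.lap.lap

lemma bilapKernel_eq (y : E3) :
    bilapKernel y = radialLap (radialLap sqrtProfile) (‖y‖ ^ 2) := by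
  have h1 : lap smoothNorm = fun y => radialLap sqrtProfile (‖y‖ ^ 2) :=
    lap_radial contDiff_sqrtProfile
  rw [bilapKernel, h1, lap_radial (contDiff_radialLap contDiff_sqrtProfile)]

lemma eventuallyEq_Ioi {g₁ g₂ : ℝ → ℝ} (h : ∀ q, 1 < q → g₁ q = g₂ q) {q : ℝ} (hq : 1 < q) :
    g₁ =ᶠ[𝓝 q] g₂ :=
  Filter.eventuallyEq_of_mem (Ioi_mem_nhds hq) h

/-- In terms of `q = |y|²` this is `Δ|y| = 2/|y|`, and `1/|y|` is harmonic away from the origin.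
Hence the bilaplacian of `smoothNorm` is supported in the unit ball. -/
lemma radialLap_sqrtProfile {q : ℝ} (hq : 1 < q) :
    radialLap sqrtProfile q = 2 * q ^ (-(1 / 2) : ℝ) := by
  have h0 : ∀ q, 1 < q → sqrtProfile q = q ^ (1 / 2 : ℝ) := fun q hq => by
    rw [sqrtProfile_of_one_le hq.le, Real.sqrt_eq_rpow]
  have h1 : ∀ q, 1 < q → deriv sqrtProfile q = (1 / 2) * q ^ (-(1 / 2) : ℝ) := fun q hq => by
    rw [(eventuallyEq_Ioi h0 hq).deriv_eq, Real.deriv_rpow_const]; norm_num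
  have h2 : deriv (deriv sqrtProfile) q = -(1 / 4) * q ^ (-(3 / 2) : ℝ) := by
    rw [(eventuallyEq_Ioi h1 hq).deriv_eq, deriv_const_mul_field, Real.deriv_rpow_const]; norm_num
    ring
  have h3 : q ^ (-(1 / 2) : ℝ) = q * q ^ (-(3 / 2) : ℝ) := by
    rw [← Real.rpow_one_add' (by linarith) (by norm_num)]; norm_num
  rw [radialLap, h1 q hq, h2, h3]; ring

lemma deriv_radialLap_sqrtProfile {q : ℝ} (hq : 1 < q) :
    deriv (radialLap sqrtProfile) q = -q ^ (-(3 / 2) : ℝ) := by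
  rw [(eventuallyEq_Ioi (fun q hq => radialLap_sqrtProfile hq) hq).deriv_eq,
    deriv_const_mul_field, Real.deriv_rpow_const]
  norm_num
  ring

lemma radialLap_radialLap_sqrtProfile {q : ℝ} (hq : 1 < q) :
    radialLap (radialLap sqrtProfile) q = 0 := by
  have h2 : deriv (deriv (radialLap sqrtProfile)) q = (3 / 2) * q ^ (-(5 / 2) : ℝ) := by
    rw [(eventuallyEq_Ioi (fun q hq => deriv_radialLap_sqrtProfile hq) hq).deriv_eq, deriv.fun_neg,
      Real.deriv_rpow_const]
    norm_num
  have h3 : q ^ (-(3 / 2) : ℝ) = q * q ^ (-(5 / 2) : ℝ) := by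
    rw [← Real.rpow_one_add' (by linarith) (by norm_num)]; norm_num
  rw [radialLap, deriv_radialLap_sqrtProfile hq, h2, h3]; ring

lemma bilapKernel_eq_zero {y : E3} (hy : 1 < ‖y‖) : bilapKernel y = 0 := by
  rw [bilapKernel_eq, radialLap_radialLap_sqrtProfile (one_lt_pow₀ hy (by norm_num))]

lemma hasCompactSupport_bilapKernel : HasCompactSupport bilapKernel :=
  HasCompactSupport.intro (isCompact_closedBall (0 : E3) 1) fun y hy =>
    bilapKernel_eq_zero (by simpa using hy)

lemma isTest_bilapKernel : IsTest bilapKernel := ⟨smooth_bilapKernel, hasCompactSupport_bilapKernel⟩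

/-- The mass of the bilaplacian of `smoothNorm`; its value is `-8π`. -/
def kernelMass : ℝ := ∫ y, bilapKernel y

/-- In polar coordinates the integrand is an exact derivative, so the mass is the flux of the
gradient of `Δ smoothNorm` through the sphere of radius `2`. Outside the unit ball this gradient is
that of `2/|y|`, whose flux is nonzero. -/
lemma kernelMass_ne_zero : kernelMass ≠ 0 := by
  set η := radialLap sqrtProfile with hη
  have hηs : ContDiff ℝ (⊤ : ℕ∞) η := contDiff_radialLap contDiff_sqrtProfile
  have hη1 := contDiff_deriv_top hηs
  have e : kernelMass = ∫ y : E3, (fun r : ℝ => radialLap η (r ^ 2)) ‖y‖ := by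
    unfold kernelMass; simp only [bilapKernel_eq, hη]
  rw [e, integral_fun_norm_addHaar volume fun r : ℝ => radialLap η (r ^ 2)]
  -- This is the divergence theorem for a radial function: `r²` times the Laplacian is the
  -- derivative of `r²` times the radial derivative.
  have hd : ∀ r : ℝ, HasDerivAt (fun r : ℝ => 2 * r ^ 3 * deriv η (r ^ 2))
      (r ^ 2 * radialLap η (r ^ 2)) r := by
    intro r
    have h1 : HasDerivAt (fun r : ℝ => deriv η (r ^ 2)) (deriv (deriv η) (r ^ 2) * (2 * r)) r := by
      have := ((hη1.differentiable (by simp)) (r ^ 2)).hasDerivAt.comp r (hasDerivAt_pow 2 r)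
      exact this.congr_deriv (by norm_num)
    have h2 := ((hasDerivAt_pow 3 r).const_mul 2).mul h1
    refine h2.congr_deriv ?_
    simp only [radialLap]; push_cast; ring
  have hcont : Continuous fun r : ℝ => r ^ 2 * radialLap η (r ^ 2) := by
    have := (contDiff_radialLap hηs).continuous
    fun_prop
  have hsplit : ∫ r in Ioi (0 : ℝ), r ^ (Module.finrank ℝ E3 - 1) • radialLap η (r ^ 2)
      = ∫ r in (0 : ℝ)..2, r ^ 2 * radialLap η (r ^ 2) := by
    rw [intervalIntegral.integral_of_le (by norm_num)]
    simp only [finrank_euclideanSpace, Fintype.card_fin, smul_eq_mul]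
    refine setIntegral_eq_of_subset_of_forall_sdiff_eq_zero measurableSet_Ioi
      (fun r hr => hr.1) fun r hr => ?_
    have hr2 : 2 < r := by
      by_contra hcon; exact hr.2 ⟨hr.1, not_lt.1 hcon⟩
    rw [radialLap_radialLap_sqrtProfile (one_lt_pow₀ (by linarith) (by norm_num)), mul_zero]
  rw [hsplit, intervalIntegral.integral_eq_sub_of_hasDerivAt (fun r _ => hd r)
    (hcont.intervalIntegrable _ _), deriv_radialLap_sqrtProfile (by norm_num)]
  have hb : volume.real (Metric.ball (0 : E3) 1) ≠ 0 :=
    (ENNReal.toReal_pos (Metric.measure_ball_pos volume _ one_pos).ne'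
      measure_ball_lt_top.ne).ne'
  simp only [smul_ne_zero_iff]
  refine ⟨by simp, hb, ?_⟩
  simp

/-! ### Integration by parts against test functions -/

lemma integrable_mul_test {F g : E3 → ℝ} (hF : Continuous F) (hg : IsTest g) :
    Integrable (fun y => F y * g y) :=
  (hF.mul hg.continuous).integrable_of_hasCompactSupport hg.compact.mul_left

lemma integral_mul_pd {F g : E3 → ℝ} (hF : Differentiable ℝ F) {i : Fin 3}
    (hF' : Continuous (pd i F)) (hg : IsTest g) :
    ∫ y, F y * pd i g y = -∫ y, pd i F y * g y :=
  integral_mul_fderiv_eq_neg_fderiv_mul_of_integrable (integrable_mul_test hF' hg)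
    (integrable_mul_test hF.continuous (hg.pd i)) (integrable_mul_test hF.continuous hg)
    (fun y _ => hF y) fun y _ => hg.smooth.differentiable y

/-! ### The scaled kernels -/

/-- The kernel `s h((y - x) / s)`, where `h` is `smoothNorm`; it equals `|y - x|` for
`|y - x| ≥ s`. -/
def psi (s : ℝ) (x : E3) : E3 → ℝ := resc s s x smoothNorm

/-- The difference of two scaled kernels, a test function. -/
def psiDiff (s r : ℝ) (x : E3) : E3 → ℝ := fun y => psi s x y - psi r x y

lemma smooth_psi (s : ℝ) (x : E3) : Smooth (psi s x) := smooth_smoothNorm.resc s s x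

lemma psi_of_le {s : ℝ} (hs : 0 < s) {x y : E3} (h : s ≤ ‖y - x‖) : psi s x y = ‖y - x‖ := by
  have e : ‖s⁻¹ • (y - x)‖ = s⁻¹ * ‖y - x‖ := by
    rw [norm_smul, Real.norm_of_nonneg (by positivity)]
  rw [psi, resc, smoothNorm_of_one_le, e, mul_inv_cancel_left₀ hs.ne']
  rw [e, inv_mul_eq_div, le_div_iff₀ hs, one_mul]; exact h

lemma psiDiff_eq_zero {s r : ℝ} (hs : 0 < s) (hr : 0 < r) {x y : E3} (h₁ : s ≤ ‖y - x‖)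
    (h₂ : r ≤ ‖y - x‖) : psiDiff s r x y = 0 := by
  rw [psiDiff, psi_of_le hs h₁, psi_of_le hr h₂, sub_self]

lemma isTest_psiDiff {s r : ℝ} (hs : 0 < s) (hr : 0 < r) (x : E3) : IsTest (psiDiff s r x) := by
  refine ⟨(smooth_psi s x).sub (smooth_psi r x), ?_⟩
  refine HasCompactSupport.intro (isCompact_closedBall x (max s r)) fun y hy => ?_
  rw [Metric.mem_closedBall, dist_eq_norm, not_le, max_lt_iff] at hy
  exact psiDiff_eq_zero hs hr hy.1.le hy.2.le

lemma pd_psiDiff (s r : ℝ) (x : E3) (a : Fin 3) :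
    pd a (psiDiff s r x) = fun y => pd a (psi s x) y - pd a (psi r x) y :=
  pd_sub (smooth_psi s x).differentiable (smooth_psi r x).differentiable a

lemma pd_pd_psiDiff (s r : ℝ) (x : E3) (a b : Fin 3) :
    pd a (pd b (psiDiff s r x)) = fun y => pd a (pd b (psi s x)) y - pd a (pd b (psi r x)) y := by
  rw [pd_psiDiff, pd_sub ((smooth_psi s x).pd b).differentiable ((smooth_psi r x).pd b).differentiable]

lemma pd_pd_pd_psiDiff (s r : ℝ) (x : E3) (a b c : Fin 3) :
    pd a (pd b (pd c (psiDiff s r x)))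
      = fun y => pd a (pd b (pd c (psi s x))) y - pd a (pd b (pd c (psi r x))) y := by
  rw [pd_pd_psiDiff, pd_sub (((smooth_psi s x).pd c).pd b).differentiable
    (((smooth_psi r x).pd c).pd b).differentiable]

lemma pd_pd_pd_pd_psiDiff (s r : ℝ) (x : E3) (a b c d : Fin 3) :
    pd a (pd b (pd c (pd d (psiDiff s r x))))
      = fun y => pd a (pd b (pd c (pd d (psi s x)))) y - pd a (pd b (pd c (pd d (psi r x)))) y := by
  rw [pd_pd_pd_psiDiff, pd_sub ((((smooth_psi s x).pd d).pd c).pd b).differentiable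
    ((((smooth_psi r x).pd d).pd c).pd b).differentiable]

lemma pd_pd_psi (s : ℝ) (x : E3) (a b : Fin 3) :
    pd a (pd b (psi s x)) = resc (s * s⁻¹ * s⁻¹) s x (pd a (pd b smoothNorm)) := by
  rw [psi, pd_resc smooth_smoothNorm, pd_resc (smooth_smoothNorm.pd b)]

lemma pd_pd_pd_psi (s : ℝ) (x : E3) (a b c : Fin 3) :
    pd a (pd b (pd c (psi s x)))
      = resc (s * s⁻¹ * s⁻¹ * s⁻¹) s x (pd a (pd b (pd c smoothNorm))) := by
  rw [pd_pd_psi, pd_resc ((smooth_smoothNorm.pd c).pd b)]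

lemma pd_pd_pd_pd_psi (s : ℝ) (x : E3) (a b c d : Fin 3) :
    pd a (pd b (pd c (pd d (psi s x))))
      = resc (s * s⁻¹ * s⁻¹ * s⁻¹ * s⁻¹) s x (pd a (pd b (pd c (pd d smoothNorm)))) := by
  rw [pd_pd_pd_psi, pd_resc (((smooth_smoothNorm.pd d).pd c).pd b)]

lemma abs_resc_le {n : ℕ} {g : E3 → ℝ} {C s : ℝ} (hs : 0 < s)
    (h : ∀ z, |g z| * ‖z‖ ^ n ≤ C) {x y : E3} (hy : y ≠ x) :
    |resc (s⁻¹ ^ n) s x g y| ≤ C * ‖y - x‖ ^ (-(n : ℝ)) := by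
  have hpos : 0 < ‖y - x‖ := norm_pos_iff.2 (sub_ne_zero.2 hy)
  rw [Real.rpow_neg hpos.le, Real.rpow_natCast, ← div_eq_mul_inv, le_div_iff₀ (by positivity)]
  refine le_trans (le_of_eq ?_) (h (s⁻¹ • (y - x)))
  rw [resc, abs_mul, abs_of_pos (by positivity), norm_smul, Real.norm_of_nonneg (by positivity)]
  ring

/-- The natural exponent is `3`. For scales `s ≥ 1` it can be lowered to `8/3`, because the kernel
is bounded on `|z| ≤ 1` and the leftover factor `s^(-1/3)` is at most `1`. The smaller exponent is
integrable near `x`. -/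
lemma abs_resc_le_of_one_le {g : E3 → ℝ} {C s : ℝ} (hs : 1 ≤ s)
    (h : ∀ z, |g z| ≤ C ∧ |g z| * ‖z‖ ^ 3 ≤ C) {x y : E3} (hy : y ≠ x) :
    |resc (s⁻¹ ^ 3) s x g y| ≤ C * ‖y - x‖ ^ (-(8 / 3) : ℝ) := by
  have hs0 : 0 < s := by linarith
  have hpos : 0 < ‖y - x‖ := norm_pos_iff.2 (sub_ne_zero.2 hy)
  rw [Real.rpow_neg hpos.le, ← div_eq_mul_inv, le_div_iff₀ (by positivity)]
  set z := s⁻¹ • (y - x) with hz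
  have hzn : ‖y - x‖ = s * ‖z‖ := by
    rw [hz, norm_smul, Real.norm_of_nonneg (by positivity), mul_inv_cancel_left₀ hs0.ne']
  have hC : 0 ≤ C := (abs_nonneg _).trans (h z).1
  have hg : |g z| * ‖z‖ ^ (8 / 3 : ℝ) ≤ C := by
    by_cases h1 : ‖z‖ ≤ 1
    · have := Real.rpow_le_one (norm_nonneg z) h1 (by norm_num : (0 : ℝ) ≤ 8 / 3)
      calc |g z| * ‖z‖ ^ (8 / 3 : ℝ) ≤ |g z| * 1 := by gcongr
        _ ≤ C := by rw [mul_one]; exact (h z).1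
    · have : ‖z‖ ^ (8 / 3 : ℝ) ≤ ‖z‖ ^ (3 : ℝ) :=
        Real.rpow_le_rpow_of_exponent_le (not_le.1 h1).le (by norm_num)
      have h3 : ‖z‖ ^ (3 : ℝ) = ‖z‖ ^ 3 := by exact_mod_cast Real.rpow_natCast ‖z‖ 3
      rw [h3] at this
      calc |g z| * ‖z‖ ^ (8 / 3 : ℝ) ≤ |g z| * ‖z‖ ^ 3 := by gcongr
        _ ≤ C := (h z).2
  have hs3 : s⁻¹ ^ 3 * s ^ (8 / 3 : ℝ) ≤ 1 := by
    have h3 : s ^ (8 / 3 : ℝ) ≤ s ^ (3 : ℝ) := Real.rpow_le_rpow_of_exponent_le hs (by norm_num)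
    have h4 : s ^ (3 : ℝ) = s ^ 3 := by exact_mod_cast Real.rpow_natCast s 3
    rw [h4] at h3
    calc s⁻¹ ^ 3 * s ^ (8 / 3 : ℝ) ≤ s⁻¹ ^ 3 * s ^ 3 := by gcongr
      _ = 1 := by rw [← mul_pow, inv_mul_cancel₀ hs0.ne', one_pow]
  rw [resc, ← hz, abs_mul, abs_of_pos (by positivity), hzn, Real.mul_rpow hs0.le (norm_nonneg z)]
  calc s⁻¹ ^ 3 * |g z| * (s ^ (8 / 3 : ℝ) * ‖z‖ ^ (8 / 3 : ℝ))
      = (s⁻¹ ^ 3 * s ^ (8 / 3 : ℝ)) * (|g z| * ‖z‖ ^ (8 / 3 : ℝ)) := by ring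
    _ ≤ 1 * C := mul_le_mul hs3 hg (by positivity) zero_le_one
    _ = C := one_mul C

/-- Uniform bounds for the derivatives of the differences of scaled kernels. -/
structure KernelBound (C : ℝ) : Prop where
  nonneg : 0 ≤ C
  two : ∀ (s r : ℝ) (x y : E3) (a b : Fin 3), 0 < s → 0 < r → y ≠ x →
    |pd a (pd b (psiDiff s r x)) y| ≤ C * ‖y - x‖ ^ (-1 : ℝ)
  three : ∀ (s r : ℝ) (x y : E3) (a b c : Fin 3), 0 < s → 0 < r → y ≠ x →
    |pd a (pd b (pd c (psiDiff s r x))) y| ≤ C * ‖y - x‖ ^ (-2 : ℝ)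
  -- Only scales at least `1` are allowed: smaller ones have no uniform bound of this type near `x`,
  -- and are treated in `DensityBounds.abs_near_le`.
  four : ∀ (s r : ℝ) (x y : E3) (a b c d : Fin 3), 1 ≤ s → 1 ≤ r → y ≠ x →
    |pd a (pd b (pd c (pd d (psiDiff s r x)))) y| ≤ C * ‖y - x‖ ^ (-(8 / 3) : ℝ)

/-- Each derivative lowers the degree of homogeneity by one, starting from degree `1` for the norm.
The rescaling `s h((y - x)/s)` preserves the resulting bounds, so they do not depend on `s`. -/
lemma exists_kernelBound : ∃ C, KernelBound C := by
  have hom2 : ∀ a b, Homog (-((1 : ℕ) : ℤ)) (pd a (pd b smoothNorm)) := fun a b => by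
    simpa using (homog_smoothNorm.pd smooth_smoothNorm b).pd (smooth_smoothNorm.pd b) a
  have hom3 : ∀ a b c, Homog (-((2 : ℕ) : ℤ)) (pd a (pd b (pd c smoothNorm))) := fun a b c => by
    simpa using (hom2 b c).pd ((smooth_smoothNorm.pd c).pd b) a
  have hom4 : ∀ a b c d, Homog (-((3 : ℕ) : ℤ)) (pd a (pd b (pd c (pd d smoothNorm)))) :=
    fun a b c d => by
      simpa using (hom3 b c d).pd (((smooth_smoothNorm.pd d).pd c).pd b) a
  choose C2 hC2 hb2 using fun ab : Fin 3 × Fin 3 => (hom2 ab.1 ab.2).exists_bound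
    (((smooth_smoothNorm.pd ab.2).pd ab.1).differentiable.continuous)
  choose C3 hC3 hb3 using fun ab : Fin 3 × Fin 3 × Fin 3 => (hom3 ab.1 ab.2.1 ab.2.2).exists_bound
    ((((smooth_smoothNorm.pd ab.2.2).pd ab.2.1).pd ab.1).differentiable.continuous)
  choose C4 hC4 hb4 using fun ab : Fin 3 × Fin 3 × Fin 3 × Fin 3 =>
    (hom4 ab.1 ab.2.1 ab.2.2.1 ab.2.2.2).exists_bound
    (((((smooth_smoothNorm.pd ab.2.2.2).pd ab.2.2.1).pd ab.2.1).pd ab.1).differentiable.continuous)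
  set S := ∑ i, C2 i + ∑ i, C3 i + ∑ i, C4 i with hS
  have n2 : 0 ≤ ∑ i, C2 i := Finset.sum_nonneg fun i _ => hC2 i
  have n3 : 0 ≤ ∑ i, C3 i := Finset.sum_nonneg fun i _ => hC3 i
  have n4 : 0 ≤ ∑ i, C4 i := Finset.sum_nonneg fun i _ => hC4 i
  have l2 : ∀ i, C2 i ≤ S := fun i => by
    have := Finset.single_le_sum (fun i _ => hC2 i) (Finset.mem_univ i); linarith
  have l3 : ∀ i, C3 i ≤ S := fun i => by
    have := Finset.single_le_sum (fun i _ => hC3 i) (Finset.mem_univ i); linarith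
  have l4 : ∀ i, C4 i ≤ S := fun i => by
    have := Finset.single_le_sum (fun i _ => hC4 i) (Finset.mem_univ i); linarith
  have two : ∀ (s : ℝ) (x y : E3) (a b : Fin 3), 0 < s → y ≠ x →
      |pd a (pd b (psi s x)) y| ≤ S * ‖y - x‖ ^ (-1 : ℝ) := by
    intro s x y a b hs hy
    have := abs_resc_le (n := 1) hs (fun z => ((hb2 (a, b) z).2.trans (l2 _))) hy
    rw [pd_pd_psi, show s * s⁻¹ * s⁻¹ = s⁻¹ ^ 1 by field_simp]
    simpa using this
  have three : ∀ (s : ℝ) (x y : E3) (a b c : Fin 3), 0 < s → y ≠ x →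
      |pd a (pd b (pd c (psi s x))) y| ≤ S * ‖y - x‖ ^ (-2 : ℝ) := by
    intro s x y a b c hs hy
    have := abs_resc_le (n := 2) hs (fun z => ((hb3 (a, b, c) z).2.trans (l3 _))) hy
    rw [pd_pd_pd_psi, show s * s⁻¹ * s⁻¹ * s⁻¹ = s⁻¹ ^ 2 by field_simp]
    simpa using this
  have four : ∀ (s : ℝ) (x y : E3) (a b c d : Fin 3), 1 ≤ s → y ≠ x →
      |pd a (pd b (pd c (pd d (psi s x)))) y| ≤ S * ‖y - x‖ ^ (-(8 / 3) : ℝ) := by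
    intro s x y a b c d hs hy
    have := abs_resc_le_of_one_le hs (fun z => ⟨(hb4 (a, b, c, d) z).1.trans (l4 _),
      (hb4 (a, b, c, d) z).2.trans (l4 _)⟩) hy
    have hs0 : s ≠ 0 := by linarith
    rw [pd_pd_pd_pd_psi, show s * s⁻¹ * s⁻¹ * s⁻¹ * s⁻¹ = s⁻¹ ^ 3 by field_simp]
    exact this
  refine ⟨2 * S, by positivity, ?_, ?_, ?_⟩
  · intro s r x y a b hs hr hy
    rw [pd_pd_psiDiff]
    refine (abs_sub _ _).trans ?_
    linarith [two s x y a b hs hy, two r x y a b hr hy]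
  · intro s r x y a b c hs hr hy
    rw [pd_pd_pd_psiDiff]
    refine (abs_sub _ _).trans ?_
    linarith [three s x y a b c hs hy, three r x y a b c hr hy]
  · intro s r x y a b c d hs hr hy
    rw [pd_pd_pd_pd_psiDiff]
    refine (abs_sub _ _).trans ?_
    linarith [four s x y a b c d hs hy, four r x y a b c d hr hy]

/-! ### Recovering a function from its integrals against the kernels -/

lemma integral_mul_resc (F g : E3 → ℝ) {s : ℝ} (hs : 0 < s) (x : E3) :
    ∫ y, F y * resc (s⁻¹ ^ 3) s x g y = ∫ z, F (x + s • z) * g z := by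
  have h1 : ∫ y, F y * resc (s⁻¹ ^ 3) s x g y
      = ∫ y, (fun u => s⁻¹ ^ 3 * (F (x + s • (s⁻¹ • u)) * g (s⁻¹ • u))) (y - x) := by
    refine integral_congr_ae (ae_of_all _ fun y => ?_)
    simp only [resc, smul_smul, mul_inv_cancel₀ hs.ne', one_smul, add_sub_cancel]
    ring
  rw [h1, integral_sub_right_eq_self (fun u => s⁻¹ ^ 3 * (F (x + s • (s⁻¹ • u)) * g (s⁻¹ • u))) x,
    integral_const_mul, Measure.integral_comp_inv_smul volume (fun z => F (x + s • z) * g z) s]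
  simp only [finrank_euclideanSpace, Fintype.card_fin, smul_eq_mul]
  rw [abs_of_pos (by positivity), ← mul_assoc, ← mul_pow, inv_mul_cancel₀ hs.ne', one_pow, one_mul]

lemma tendsto_integral_comp_scale_zero {F g : E3 → ℝ} (hF : Continuous F) {M : ℝ}
    (hM : ∀ y, |F y| ≤ M) (hg : IsTest g) (x : E3) :
    Tendsto (fun s : ℝ => ∫ z, F (x + s • z) * g z) (𝓝[>] 0) (𝓝 (F x * ∫ z, g z)) := by
  rw [← integral_const_mul]
  refine tendsto_integral_filter_of_dominated_convergence (fun z => M * |g z|)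
    (Eventually.of_forall fun s => ?_) (Eventually.of_forall fun s => ae_of_all _ fun z => ?_) ?_
    (ae_of_all _ fun z => ?_)
  · have := hg.continuous
    exact (by fun_prop : Continuous fun z => F (x + s • z) * g z).aestronglyMeasurable
  · rw [Real.norm_eq_abs, abs_mul]
    exact mul_le_mul_of_nonneg_right (hM _) (abs_nonneg _)
  · exact (hg.continuous.integrable_of_hasCompactSupport hg.compact).abs.const_mul M
  · have hc : Continuous fun s : ℝ => F (x + s • z) * g z := by fun_prop
    have := hc.tendsto 0
    simp only [zero_smul, add_zero] at this
    exact this.mono_left nhdsWithin_le_nhds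

lemma tendsto_integral_comp_scale_atTop {F g : E3 → ℝ} (hF : Continuous F) {M : ℝ}
    (hM : ∀ y, |F y| ≤ M) (hF0 : Tendsto F (cocompact E3) (𝓝 0)) (hg : IsTest g) (x : E3) :
    Tendsto (fun s : ℝ => ∫ z, F (x + s • z) * g z) atTop (𝓝 0) := by
  have h0 : (0 : ℝ) = ∫ _ : E3, (0 : ℝ) := by simp
  rw [h0]
  refine tendsto_integral_filter_of_dominated_convergence (fun z => M * |g z|)
    (Eventually.of_forall fun s => ?_) (Eventually.of_forall fun s => ae_of_all _ fun z => ?_) ?_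
    ?_
  · have := hg.continuous
    exact (by fun_prop : Continuous fun z => F (x + s • z) * g z).aestronglyMeasurable
  · rw [Real.norm_eq_abs, abs_mul]
    exact mul_le_mul_of_nonneg_right (hM _) (abs_nonneg _)
  · exact (hg.continuous.integrable_of_hasCompactSupport hg.compact).abs.const_mul M
  -- For `z ≠ 0` the points `x + s z` leave every compact set, so the decay of `F` at infinity gives
  -- pointwise convergence almost everywhere.
  · filter_upwards [Measure.ae_ne volume (0 : E3)] with z hz
    have hzn : 0 < ‖z‖ := norm_pos_iff.2 hz
    have h1 : Tendsto (fun s : ℝ => x + s • z) atTop (cocompact E3) := by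
      rw [← Metric.cobounded_eq_cocompact, ← tendsto_norm_atTop_iff_cobounded]
      refine tendsto_atTop_mono' atTop (f₁ := fun s : ℝ => s * ‖z‖ - ‖x‖) ?_ ?_
      · filter_upwards [eventually_ge_atTop (0 : ℝ)] with s hs
        have h2 : ‖s • z‖ = s * ‖z‖ := by rw [norm_smul, Real.norm_of_nonneg hs]
        have h3 := norm_sub_le (x + s • z) x
        rw [add_sub_cancel_left, h2] at h3
        linarith
      · exact tendsto_atTop_add_const_right _ _ (tendsto_id.atTop_mul_const hzn)
    simpa using (hF0.comp h1).mul_const (g z)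

lemma lap_lap_psi {s : ℝ} (hs : 0 < s) (x : E3) :
    lap (lap (psi s x)) = resc (s⁻¹ ^ 3) s x bilapKernel := by
  rw [psi, lap_resc smooth_smoothNorm, lap_resc smooth_smoothNorm.lap, bilapKernel]
  congr 1
  field_simp

lemma lap_lap_psiDiff {s r : ℝ} (hs : 0 < s) (hr : 0 < r) (x : E3) :
    lap (lap (psiDiff s r x))
      = fun y => resc (s⁻¹ ^ 3) s x bilapKernel y - resc (r⁻¹ ^ 3) r x bilapKernel y := by
  unfold psiDiff
  rw [lap_sub (smooth_psi s x) (smooth_psi r x),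
    lap_sub (smooth_psi s x).lap (smooth_psi r x).lap, lap_lap_psi hs, lap_lap_psi hr]

lemma isTest_resc {g : E3 → ℝ} (hg : IsTest g) (c : ℝ) {s : ℝ} (hs : 0 < s) (x : E3) :
    IsTest (resc c s x g) := by
  refine ⟨hg.smooth.resc c s x, ?_⟩
  have h1 := hg.compact.comp_homeomorph
    ((Homeomorph.subRight x).trans (Homeomorph.smulOfNeZero s⁻¹ (inv_ne_zero hs.ne')))
  exact h1.mul_left (f := fun _ => c)

/-- Pointwise bound of a function by its integrals against bilaplacians of the kernels. -/
lemma abs_le_of_integral_bilap {F : E3 → ℝ} (hF : Continuous F) {M : ℝ}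
    (hM : ∀ y, |F y| ≤ M) (hF0 : Tendsto F (cocompact E3) (𝓝 0)) {x : E3} {Q : ℝ}
    (hQ : ∀ s r : ℝ, 0 < s → s < 1 → 1 < r → |∫ y, F y * lap (lap (psiDiff s r x)) y| ≤ Q) :
    |kernelMass| * |F x| ≤ Q := by
  -- After the change of variables `y = x + s z`, the scale `s` gives an average of `F` near `x`
  -- with weight `bilapKernel`. The scale `r` gives one that escapes to infinity.
  have e : ∀ s r : ℝ, 0 < s → 0 < r → ∫ y, F y * lap (lap (psiDiff s r x)) y
      = (∫ z, F (x + s • z) * bilapKernel z) - ∫ z, F (x + r • z) * bilapKernel z := by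
    intro s r hs hr
    rw [lap_lap_psiDiff hs hr]
    simp only [mul_sub]
    rw [integral_sub (integrable_mul_test hF (isTest_resc isTest_bilapKernel _ hs x))
      (integrable_mul_test hF (isTest_resc isTest_bilapKernel _ hr x)),
      integral_mul_resc F _ hs, integral_mul_resc F _ hr]
  have hs1 : ∀ᶠ s : ℝ in 𝓝[>] 0, 0 < s ∧ s < 1 := by
    filter_upwards [Ioo_mem_nhdsGT (zero_lt_one (α := ℝ))] with s hs using hs
  have step : ∀ s : ℝ, 0 < s → s < 1 → |∫ z, F (x + s • z) * bilapKernel z| ≤ Q := by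
    intro s hs hs1
    have ht := ((tendsto_integral_comp_scale_atTop hF hM hF0 isTest_bilapKernel x).const_sub
      (∫ z, F (x + s • z) * bilapKernel z)).abs
    rw [sub_zero] at ht
    refine le_of_tendsto ht ?_
    filter_upwards [eventually_gt_atTop (1 : ℝ)] with r hr
    rw [← e s r hs (by linarith)]
    exact hQ s r hs hs1 hr
  have ht := (tendsto_integral_comp_scale_zero hF hM isTest_bilapKernel x).abs
  rw [abs_mul, mul_comm] at ht
  exact le_of_tendsto ht (hs1.mono fun s hs => step s hs.1 hs.2)

/-- Pointwise bound of a partial derivative by integrals against bilaplacians of derivatives of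
the kernels. -/
lemma abs_pd_le_of_integral_bilap {F : E3 → ℝ} (hF : Differentiable ℝ F) {l : Fin 3}
    (hF' : Continuous (pd l F)) {M M' : ℝ} (hM : ∀ y, |F y| ≤ M) (hM' : ∀ y, |pd l F y| ≤ M')
    {x : E3} {Q : ℝ}
    (hQ : ∀ s r : ℝ, 0 < s → s < 1 → 1 < r →
      |∫ y, F y * lap (lap (pd l (psiDiff s r x))) y| ≤ Q) :
    |kernelMass| * |pd l F x| ≤ Q := by
  -- The derivative is moved onto `F` only at the small scale. At the large scale it stays on the
  -- kernel and yields a factor `r⁻¹`, so boundedness of `F` suffices and no decay of its gradient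
  -- is needed.
  have e : ∀ s r : ℝ, 0 < s → 0 < r → ∫ y, F y * lap (lap (pd l (psiDiff s r x))) y
      = -(∫ z, pd l F (x + s • z) * bilapKernel z)
        - r⁻¹ * ∫ z, F (x + r • z) * pd l bilapKernel z := by
    intro s r hs hr
    have ts := isTest_resc isTest_bilapKernel (s⁻¹ ^ 3) hs x
    have tr := isTest_resc isTest_bilapKernel (r⁻¹ ^ 3) hr x
    rw [← pd_lap (isTest_psiDiff hs hr x).smooth, ← pd_lap (isTest_psiDiff hs hr x).smooth.lap,
      lap_lap_psiDiff hs hr, pd_sub ts.smooth.differentiable tr.smooth.differentiable]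
    simp only [mul_sub]
    rw [integral_sub (integrable_mul_test hF.continuous (ts.pd l))
      (integrable_mul_test hF.continuous (tr.pd l)), integral_mul_pd hF hF' ts,
      integral_mul_resc _ _ hs, pd_resc isTest_bilapKernel.smooth, ← integral_mul_resc _ _ hr,
      ← integral_const_mul]
    congr 1
    refine integral_congr_ae (ae_of_all _ fun y => ?_)
    simp only [resc]; ring
  have hs1 : ∀ᶠ s : ℝ in 𝓝[>] 0, 0 < s ∧ s < 1 := by
    filter_upwards [Ioo_mem_nhdsGT (zero_lt_one (α := ℝ))] with s hs using hs
  have hint : ∀ r : ℝ, |∫ z, F (x + r • z) * pd l bilapKernel z|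
      ≤ ∫ z, M * |pd l bilapKernel z| := by
    intro r
    have tk := isTest_bilapKernel.pd l
    have hi : Integrable (fun z => M * |pd l bilapKernel z|) :=
      (tk.continuous.integrable_of_hasCompactSupport tk.compact).abs.const_mul M
    rw [← Real.norm_eq_abs]
    refine norm_integral_le_of_norm_le hi (ae_of_all _ fun z => ?_)
    rw [Real.norm_eq_abs, abs_mul]
    exact mul_le_mul_of_nonneg_right (hM _) (abs_nonneg _)
  have hlim : Tendsto (fun r : ℝ => r⁻¹ * ∫ z, F (x + r • z) * pd l bilapKernel z) atTop (𝓝 0) := by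
    have h0 : Tendsto (fun r : ℝ => |r⁻¹| * ∫ z, M * |pd l bilapKernel z|) atTop (𝓝 0) := by
      simpa using (tendsto_inv_atTop_zero (𝕜 := ℝ)).abs.mul_const (∫ z, M * |pd l bilapKernel z|)
    refine squeeze_zero_norm (fun r => ?_) h0
    rw [Real.norm_eq_abs, abs_mul]
    exact mul_le_mul_of_nonneg_left (hint r) (abs_nonneg _)
  have step : ∀ s : ℝ, 0 < s → s < 1 → |∫ z, pd l F (x + s • z) * bilapKernel z| ≤ Q := by
    intro s hs hs1
    have ht := (hlim.const_sub (-∫ z, pd l F (x + s • z) * bilapKernel z)).abs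
    rw [sub_zero, abs_neg] at ht
    refine le_of_tendsto ht ?_
    filter_upwards [eventually_gt_atTop (1 : ℝ)] with r hr
    rw [← e s r hs (by linarith)]
    exact hQ s r hs hs1 hr
  have ht := (tendsto_integral_comp_scale_zero hF' hM' isTest_bilapKernel x).abs
  rw [abs_mul, mul_comm] at ht
  exact le_of_tendsto ht (hs1.mono fun s hs => step s hs.1 hs.2)

/-! ### Characteristics of a decaying force field -/

/-- A force field that decays like the one of a solution with the free streaming condition. -/
structure ForceBounds (α a : ℝ) (K : ℝ → E3 → E3 → E3) : Prop where
  nonneg : 0 ≤ α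
  le_sixth : α ≤ 1 / 6
  cont : ∀ x p, ContinuousOn (fun s => K s x p) (Icc 0 a)
  norm_le : ∀ s ∈ Icc 0 a, ∀ x p, ‖K s x p‖ ≤ α * (1 + s) ^ (-(3 / 2) : ℝ)
  lip : ∀ s ∈ Icc 0 a, ∀ x y p q, ‖K s x p - K s y q‖
    ≤ α * (1 + s) ^ (-(5 / 2) : ℝ) * ‖x - y‖ + α * (1 + s) ^ (-(3 / 2) : ℝ) * ‖p - q‖

/-- `(X, P)` solves `X' = v(P)`, `P' = K(s, X, P)` on `[0,t]`. -/
structure IsCharacteristic (K : ℝ → E3 → E3 → E3) (t : ℝ) (X P : ℝ → E3) : Prop where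
  pos : ∀ s ∈ Icc 0 t, HasDerivWithinAt X (velocity (P s)) (Icc 0 t) s
  mom : ∀ s ∈ Icc 0 t, HasDerivWithinAt P (K s (X s) (P s)) (Icc 0 t) s

lemma rpow_neg_le_one {s β : ℝ} (hs : 0 ≤ s) (hβ : β ≤ 0) : (1 + s) ^ β ≤ 1 :=
  Real.rpow_le_one_of_one_le_of_nonpos (by linarith) hβ

/-- Picard–Lindelöf is applied backward from the final time. The vector field is bounded by `1 + α`
and globally Lipschitz with constant `1 + 2α`, so a ball of radius `(1 + α) t` contains the solution
on all of `[0, t]`. -/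
lemma ForceBounds.exists_characteristic {α a : ℝ} {K : ℝ → E3 → E3 → E3}
    (hK : ForceBounds α a K) {t : ℝ} (ht : t ∈ Icc 0 a) (x p : E3) :
    ∃ X P : ℝ → E3, IsCharacteristic K t X P ∧ X t = x ∧ P t = p := by
  have hα := hK.nonneg
  have hsub : ∀ s ∈ Icc 0 t, s ∈ Icc 0 a := fun s hs => ⟨hs.1, hs.2.trans ht.2⟩
  set V : ℝ → E3 × E3 → E3 × E3 := fun s z => (velocity z.2, K s z.1 z.2) with hV
  have c1 : ((1 + α).toNNReal : ℝ) = 1 + α := Real.coe_toNNReal _ (by positivity)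
  have c2 : ((1 + 2 * α).toNNReal : ℝ) = 1 + 2 * α := Real.coe_toNNReal _ (by positivity)
  have hpl : IsPicardLindelof V (tmin := 0) (tmax := t) ⟨t, ⟨ht.1, le_rfl⟩⟩ (x, p)
      ((1 + α).toNNReal * t.toNNReal) 0 (1 + α).toNNReal (1 + 2 * α).toNNReal := by
    constructor
    · intro s hs
      refine LipschitzWith.lipschitzOnWith (LipschitzWith.of_dist_le_mul fun z z' => ?_)
      rw [dist_eq_norm, dist_eq_norm, c2]
      have h1 : ‖z.1 - z'.1‖ ≤ ‖z - z'‖ := norm_fst_le (z - z')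
      have h2 : ‖z.2 - z'.2‖ ≤ ‖z - z'‖ := norm_snd_le (z - z')
      have hn := norm_nonneg (z - z')
      have h5 := rpow_neg_le_one hs.1 (by norm_num : (-(5 / 2) : ℝ) ≤ 0)
      have h3 := rpow_neg_le_one hs.1 (by norm_num : (-(3 / 2) : ℝ) ≤ 0)
      refine max_le ?_ ?_
      · calc ‖velocity z.2 - velocity z'.2‖ ≤ ‖z.2 - z'.2‖ := norm_velocity_sub_le _ _
          _ ≤ (1 + 2 * α) * ‖z - z'‖ := by nlinarith
      · calc ‖K s z.1 z.2 - K s z'.1 z'.2‖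
            ≤ α * (1 + s) ^ (-(5 / 2) : ℝ) * ‖z.1 - z'.1‖
              + α * (1 + s) ^ (-(3 / 2) : ℝ) * ‖z.2 - z'.2‖ := hK.lip s (hsub s hs) _ _ _ _
          _ ≤ α * 1 * ‖z - z'‖ + α * 1 * ‖z - z'‖ := by gcongr
          _ ≤ (1 + 2 * α) * ‖z - z'‖ := by nlinarith
    · intro z _
      exact continuousOn_const.prodMk ((hK.cont z.1 z.2).mono hsub)
    · intro s hs z _
      rw [c1]
      have h3 := rpow_neg_le_one hs.1 (by norm_num : (-(3 / 2) : ℝ) ≤ 0)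
      refine max_le ?_ ?_
      · exact (norm_velocity_le_one _).trans (by linarith)
      · refine (hK.norm_le s (hsub s hs) _ _).trans ?_
        nlinarith
    · simp [ht.1]
  obtain ⟨Z, hZ0, hZ⟩ := hpl.exists_eq_forall_mem_Icc_hasDerivWithinAt₀
  refine ⟨fun s => (Z s).1, fun s => (Z s).2, ⟨fun s hs => ?_, fun s hs => ?_⟩, ?_, ?_⟩
  · exact (hZ s hs).fst
  · exact (hZ s hs).snd
  · exact congrArg Prod.fst hZ0
  · exact congrArg Prod.snd hZ0

/-- This replaces integration of `φ` over `[s, t]` by an explicit antiderivative: `-Φ` has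
derivative `φ`. -/
lemma norm_sub_le_of_norm_deriv_le {V : Type*} [NormedAddCommGroup V] [NormedSpace ℝ V]
    {t : ℝ} {u u' : ℝ → V} {Φ φ : ℝ → ℝ}
    (hu : ∀ s ∈ Icc 0 t, HasDerivWithinAt u (u' s) (Icc 0 t) s)
    (hΦ : ∀ s ∈ Icc 0 t, HasDerivAt Φ (-φ s) s) (hb : ∀ s ∈ Icc 0 t, ‖u' s‖ ≤ φ s)
    {s : ℝ} (hs : s ∈ Icc 0 t) : ‖u t - u s‖ ≤ Φ s - Φ t := by
  have hsub : ∀ τ ∈ Icc s t, τ ∈ Icc 0 t := fun τ hτ => ⟨hs.1.trans hτ.1, hτ.2⟩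
  refine image_norm_le_of_norm_deriv_right_le_deriv_boundary' (f := fun τ => u τ - u s)
    (f' := u') (a := s) (b := t) (B := fun τ => Φ s - Φ τ) (B' := φ) ?_ ?_ (by simp) ?_ ?_ ?_
    ⟨hs.2, le_rfl⟩
  · intro τ hτ
    exact (((hu τ (hsub τ hτ)).continuousWithinAt).mono hsub).sub continuousWithinAt_const
  · intro τ hτ
    have h1 := (hu τ (hsub τ ⟨hτ.1, hτ.2.le⟩)).sub_const (u s)
    refine h1.mono_of_mem_nhdsWithin ?_
    exact mem_of_superset (Icc_mem_nhdsGE hτ.2) fun y hy => ⟨(hs.1.trans hτ.1).trans hy.1, hy.2⟩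
  · intro τ hτ
    exact ((hΦ τ (hsub τ hτ)).continuousAt.continuousWithinAt).const_sub _ 
  · intro τ hτ
    have := ((hΦ τ (hsub τ ⟨hτ.1, hτ.2.le⟩)).const_sub (Φ s)).hasDerivWithinAt (s := Ici τ)
    simpa using this
  · exact fun τ hτ => hb τ (hsub τ ⟨hτ.1, hτ.2.le⟩)

lemma hasDerivAt_one_add_rpow {s : ℝ} (hs : 0 ≤ s) (β : ℝ) :
    HasDerivAt (fun s : ℝ => (1 + s) ^ β) (β * (1 + s) ^ (β - 1)) s := by
  have h := ((hasDerivAt_id s).const_add 1).rpow_const (p := β) (Or.inl (by simp; linarith))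
  simpa using h

lemma hasDerivAt_rpow_three_half {s : ℝ} (hs : 0 ≤ s) :
    HasDerivAt (fun s : ℝ => (2 / 3) * (1 + s) ^ (-(3 / 2) : ℝ)) (-(1 + s) ^ (-(5 / 2) : ℝ)) s := by
  refine ((hasDerivAt_one_add_rpow hs (-(3 / 2))).const_mul (2 / 3)).congr_deriv ?_
  norm_num; ring

lemma hasDerivAt_rpow_half {s : ℝ} (hs : 0 ≤ s) :
    HasDerivAt (fun s : ℝ => 2 * (1 + s) ^ (-(1 / 2) : ℝ)) (-(1 + s) ^ (-(3 / 2) : ℝ)) s := by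
  refine ((hasDerivAt_one_add_rpow hs (-(1 / 2))).const_mul 2).congr_deriv ?_
  norm_num; ring

lemma one_add_rpow_pos {s : ℝ} (hs : 0 ≤ s) (β : ℝ) : 0 < (1 + s) ^ β :=
  Real.rpow_pos_of_pos (by linarith) β

lemma one_add_rpow_mono {s : ℝ} (hs : 0 ≤ s) {β γ : ℝ} (h : β ≤ γ) :
    (1 + s) ^ β ≤ (1 + s) ^ γ :=
  Real.rpow_le_rpow_of_exponent_le (by linarith) h

section

variable {α a t : ℝ} {K : ℝ → E3 → E3 → E3} {X P Y Q : ℝ → E3}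

lemma IsCharacteristic.continuousOn_mom (h : IsCharacteristic K t X P) :
    ContinuousOn P (Icc 0 t) := fun s hs => (h.mom s hs).continuousWithinAt

/-- The force is integrable in time with total at most `2α ≤ 1/3`. -/
lemma ForceBounds.norm_mom_sub_le (hK : ForceBounds α a K) (ht : t ∈ Icc 0 a)
    (h : IsCharacteristic K t X P) {s : ℝ} (hs : s ∈ Icc 0 t) : ‖P t - P s‖ ≤ 1 / 3 := by
  have hα := hK.nonneg
  have hα6 := hK.le_sixth
  have h1 := norm_sub_le_of_norm_deriv_le (φ := fun s => α * (1 + s) ^ (-(3 / 2) : ℝ)) h.mom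
    (fun s hs => ((hasDerivAt_rpow_half hs.1).const_mul α).congr_deriv (by ring))
    (fun s hs => hK.norm_le s ⟨hs.1, hs.2.trans ht.2⟩ _ _) hs
  have h2 := rpow_neg_le_one hs.1 (by norm_num : (-(1 / 2) : ℝ) ≤ 0)
  have h3 := one_add_rpow_pos ht.1 (-(1 / 2))
  nlinarith

lemma IsCharacteristic.norm_pos_sub_le (h : IsCharacteristic K t X P) (ht : 0 ≤ t) :
    ‖X t - X 0‖ ≤ t := by
  have h1 := norm_sub_le_of_norm_deriv_le (φ := fun _ => 1) (Φ := fun s => -s) h.pos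
    (fun s _ => (hasDerivAt_id s).neg) (fun s _ => norm_velocity_le_one _)
    (s := 0) ⟨le_rfl, ht⟩
  linarith

/-- Two characteristics with the same momentum at time `t` stay close back to time `0`. -/
lemma ForceBounds.norm_sub_le_of_mom_eq (hK : ForceBounds α a K) (ht : t ∈ Icc 0 a)
    (h : IsCharacteristic K t X P) (h' : IsCharacteristic K t Y Q) (hPQ : P t = Q t) :
    ‖X 0 - Y 0‖ ≤ 2 * ‖X t - Y t‖ ∧ ‖P 0 - Q 0‖ ≤ ‖X t - Y t‖ := by
  have hα := hK.nonneg
  have hα6 := hK.le_sixth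
  have hsub : ∀ s ∈ Icc 0 t, s ∈ Icc 0 a := fun s hs => ⟨hs.1, hs.2.trans ht.2⟩
  have h0 : (0 : ℝ) ∈ Icc 0 t := ⟨le_rfl, ht.1⟩
  set e := ‖X t - Y t‖ with he
  have hcont : ContinuousOn (fun s => (1 + s) ^ (3 / 2 : ℝ) * ‖P s - Q s‖) (Icc 0 t) := by
    refine ContinuousOn.mul (fun s hs => ?_) (h.continuousOn_mom.sub h'.continuousOn_mom).norm
    exact (hasDerivAt_one_add_rpow hs.1 _).continuousAt.continuousWithinAt
  obtain ⟨m, hm, hmax⟩ := isCompact_Icc.exists_isMaxOn ⟨0, h0⟩ hcont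
  -- `N` is the least constant with `|P - Q| ≤ N (1 + s)^(-3/2)`. The argument bounds `N` in terms
  -- of itself and `e`, with a small factor in front of `N`.
  set N := (1 + m) ^ (3 / 2 : ℝ) * ‖P m - Q m‖ with hN
  have hN0 : 0 ≤ N := mul_nonneg (one_add_rpow_pos hm.1 _).le (norm_nonneg _)
  have hP : ∀ s ∈ Icc 0 t, ‖P s - Q s‖ ≤ N * (1 + s) ^ (-(3 / 2) : ℝ) := by
    intro s hs
    have h1 : (1 + s) ^ (3 / 2 : ℝ) * ‖P s - Q s‖ ≤ N := hmax hs
    rw [Real.rpow_neg (by linarith [hs.1]), ← div_eq_mul_inv, le_div_iff₀ (one_add_rpow_pos hs.1 _)]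
    linarith
  have hX : ∀ s ∈ Icc 0 t, ‖X s - Y s‖ ≤ e + 2 * N := by
    intro s hs
    have h1 := norm_sub_le_of_norm_deriv_le (φ := fun s => N * (1 + s) ^ (-(3 / 2) : ℝ))
      (fun s hs => (h.pos s hs).sub (h'.pos s hs))
      (fun s hs => ((hasDerivAt_rpow_half hs.1).const_mul N).congr_deriv (by ring))
      (fun s hs => (norm_velocity_sub_le _ _).trans (hP s hs)) hs
    have h2 := rpow_neg_le_one hs.1 (by norm_num : (-(1 / 2) : ℝ) ≤ 0)
    have h3 := one_add_rpow_pos ht.1 (-(1 / 2))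
    have h4 := norm_sub_norm_le (X s - Y s) (X t - Y t)
    rw [norm_sub_rev (X s - Y s)] at h4
    simp only [Pi.sub_apply] at h1
    nlinarith
  -- Equal momenta at time `t` allow integration of the force difference from `t` back to `s`. The
  -- coefficient `e + 3N` consists of `e + 2N` from the positions and `N` from the momenta.
  have hD : ∀ s ∈ Icc 0 t, ‖P s - Q s‖
      ≤ α * (e + 3 * N) * ((2 / 3) * (1 + s) ^ (-(3 / 2) : ℝ)) := by
    intro s hs
    have h1 := norm_sub_le_of_norm_deriv_le
      (φ := fun s => α * (e + 3 * N) * (1 + s) ^ (-(5 / 2) : ℝ))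
      (fun s hs => (h.mom s hs).sub (h'.mom s hs))
      (fun s hs => ((hasDerivAt_rpow_three_half hs.1).const_mul (α * (e + 3 * N))).congr_deriv
        (by ring)) (fun s hs => ?_) hs
    · simp only [Pi.sub_apply, hPQ, sub_self, zero_sub, norm_neg] at h1
      have h3 := one_add_rpow_pos ht.1 (-(3 / 2))
      have h4 : 0 ≤ α * (e + 3 * N) := by positivity
      nlinarith
    · have h5 := one_add_rpow_pos hs.1 (-(5 / 2))
      have h3 := one_add_rpow_pos hs.1 (-(3 / 2))
      have h33 : (1 + s) ^ (-(3 / 2) : ℝ) * (1 + s) ^ (-(3 / 2) : ℝ)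
          ≤ (1 + s) ^ (-(5 / 2) : ℝ) := by
        rw [← Real.rpow_add (by linarith [hs.1])]
        exact one_add_rpow_mono hs.1 (by norm_num)
      calc ‖K s (X s) (P s) - K s (Y s) (Q s)‖
          ≤ α * (1 + s) ^ (-(5 / 2) : ℝ) * ‖X s - Y s‖
            + α * (1 + s) ^ (-(3 / 2) : ℝ) * ‖P s - Q s‖ := hK.lip s (hsub s hs) _ _ _ _
        _ ≤ α * (1 + s) ^ (-(5 / 2) : ℝ) * (e + 2 * N)
            + α * (1 + s) ^ (-(3 / 2) : ℝ) * (N * (1 + s) ^ (-(3 / 2) : ℝ)) := by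
          gcongr
          · exact hX s hs
          · exact hP s hs
        _ = α * (1 + s) ^ (-(5 / 2) : ℝ) * (e + 2 * N)
            + α * N * ((1 + s) ^ (-(3 / 2) : ℝ) * (1 + s) ^ (-(3 / 2) : ℝ)) := by ring
        _ ≤ α * (1 + s) ^ (-(5 / 2) : ℝ) * (e + 2 * N) + α * N * (1 + s) ^ (-(5 / 2) : ℝ) := by
          gcongr
        _ = _ := by ring
  have he0 : 0 ≤ e := norm_nonneg _
  have hNle : N ≤ α * (e + 3 * N) * (2 / 3) := by
    have h1 := hD m hm
    have h2 : (1 + m) ^ (3 / 2 : ℝ) * (1 + m) ^ (-(3 / 2) : ℝ) = 1 := by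
      rw [← Real.rpow_add (by linarith [hm.1])]; norm_num
    calc N ≤ (1 + m) ^ (3 / 2 : ℝ) * (α * (e + 3 * N) * ((2 / 3) * (1 + m) ^ (-(3 / 2) : ℝ))) :=
          mul_le_mul_of_nonneg_left h1 (one_add_rpow_pos hm.1 _).le
      _ = α * (e + 3 * N) * (2 / 3) * ((1 + m) ^ (3 / 2 : ℝ) * (1 + m) ^ (-(3 / 2) : ℝ)) := by ring
      _ = _ := by rw [h2, mul_one]
  -- With `α ≤ 1/6` the previous bound reads `N ≤ e/9 + N/3`.
  have hNe : N ≤ e / 6 := by nlinarith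
  refine ⟨(hX 0 h0).trans (by linarith), (hP 0 h0).trans ?_⟩
  have := rpow_neg_le_one (le_refl (0 : ℝ)) (by norm_num : (-(3 / 2) : ℝ) ≤ 0)
  nlinarith

/-- Two characteristics that meet at time `t` with different momenta are apart at time `0`. -/
lemma ForceBounds.norm_sub_ge_of_pos_eq (hK : ForceBounds α a K) (ht : t ∈ Icc 0 a) {R : ℝ}
    (hαR : 36 * α ≤ monoConst (3 * R)) (h : IsCharacteristic K t X P)
    (h' : IsCharacteristic K t Y Q) (hXY : X t = Y t) (hP : ∀ s ∈ Icc 0 t, ‖P s‖ ≤ R)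
    (hQ : ∀ s ∈ Icc 0 t, ‖Q s‖ ≤ R) :
    monoConst (3 * R) / 2 * t * ‖P t - Q t‖ ≤ ‖X 0 - Y 0‖ := by
  have hα := hK.nonneg
  have hα6 := hK.le_sixth
  have ht0 := ht.1
  have hsub : ∀ s ∈ Icc 0 t, s ∈ Icc 0 a := fun s hs => ⟨hs.1, hs.2.trans ht.2⟩
  have h0 : (0 : ℝ) ∈ Icc 0 t := ⟨le_rfl, ht.1⟩
  have htt : t ∈ Icc 0 t := ⟨ht.1, le_rfl⟩
  have hR : 0 ≤ R := (norm_nonneg _).trans (hP 0 h0)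
  set d := P t - Q t with hd
  set c := monoConst (3 * R) with hc
  -- The weight is the shape of the deviation expected from the force: positions differ by `O(t)`,
  -- so the field gradient changes the momentum difference by `O(t (1 + s)^(-3/2))`. This may be
  -- large near `s = 0`, but the integral of `W` over `[0, t]` is at most `3t`.
  set W : ℝ → ℝ := fun s => 1 + t * (1 + s) ^ (-(3 / 2) : ℝ) with hW
  have hWpos : ∀ s ∈ Icc 0 t, 0 < W s := fun s hs => by
    have := one_add_rpow_pos hs.1 (-(3 / 2)); simp only [hW]; positivity
  have hcont : ContinuousOn (fun s => ‖P s - Q s‖ / W s) (Icc 0 t) := by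
    refine ContinuousOn.div (h.continuousOn_mom.sub h'.continuousOn_mom).norm (fun s hs => ?_)
      fun s hs => (hWpos s hs).ne'
    exact (((hasDerivAt_one_add_rpow hs.1 _).const_mul t).const_add 1).continuousAt.continuousWithinAt
  obtain ⟨m, hm, hmax⟩ := isCompact_Icc.exists_isMaxOn ⟨0, h0⟩ hcont
  set M := ‖P m - Q m‖ / W m with hM
  have hM0 : 0 ≤ M := div_nonneg (norm_nonneg _) (hWpos m hm).le
  have hPM : ∀ s ∈ Icc 0 t, ‖P s - Q s‖ ≤ M * W s := by
    intro s hs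
    have h1 : ‖P s - Q s‖ / W s ≤ M := hmax hs
    rwa [div_le_iff₀ (hWpos s hs)] at h1
  have hdW : ∀ s ∈ Icc 0 t, HasDerivAt (fun s => -s + t * (2 * (1 + s) ^ (-(1 / 2) : ℝ)))
      (-W s) s := fun s hs =>
    ((hasDerivAt_id s).neg.add ((hasDerivAt_rpow_half hs.1).const_mul t)).congr_deriv
      (by simp only [hW]; ring)
  have hX : ∀ s ∈ Icc 0 t, ‖X s - Y s‖ ≤ 3 * M * t := by
    intro s hs
    have h1 := norm_sub_le_of_norm_deriv_le (φ := fun s => M * W s)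
      (fun s hs => (h.pos s hs).sub (h'.pos s hs))
      (fun s hs => ((hdW s hs).const_mul M).congr_deriv (by ring))
      (fun s hs => (norm_velocity_sub_le _ _).trans (hPM s hs)) hs
    have h2 := rpow_neg_le_one hs.1 (by norm_num : (-(1 / 2) : ℝ) ≤ 0)
    have h3 := one_add_rpow_pos ht.1 (-(1 / 2))
    simp only [Pi.sub_apply, hXY, sub_self, zero_sub, norm_neg] at h1
    refine h1.trans ?_
    have h4 : -s + t * (2 * (1 + s) ^ (-(1 / 2) : ℝ)) - (-t + t * (2 * (1 + t) ^ (-(1 / 2) : ℝ)))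
        ≤ 3 * t := by nlinarith [hs.1, mul_nonneg ht0 h3.le, mul_le_mul_of_nonneg_left h2 ht0]
    nlinarith
  -- The coefficient `4t` is `3t` from the bound on the positions plus `t` from the second summand
  -- of `W`. Integrating from `s` to `t` reproduces the weight `W` with the small factor `3α`.
  have hD : ∀ s ∈ Icc 0 t, ‖d - (P s - Q s)‖ ≤ 3 * α * M * W s := by
    intro s hs
    have h1 := norm_sub_le_of_norm_deriv_le
      (φ := fun s => α * M * (4 * t * (1 + s) ^ (-(5 / 2) : ℝ) + (1 + s) ^ (-(3 / 2) : ℝ)))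
      (Φ := fun s => α * M * (4 * t * ((2 / 3) * (1 + s) ^ (-(3 / 2) : ℝ))
        + 2 * (1 + s) ^ (-(1 / 2) : ℝ)))
      (fun s hs => (h.mom s hs).sub (h'.mom s hs))
      (fun s hs => ((((hasDerivAt_rpow_three_half hs.1).const_mul (4 * t)).add
        (hasDerivAt_rpow_half hs.1)).const_mul (α * M)).congr_deriv
        (by ring)) (fun s hs => ?_) hs
    · simp only [Pi.sub_apply] at h1
      have p1 := one_add_rpow_pos ht.1 (-(3 / 2))
      have p2 := one_add_rpow_pos ht.1 (-(1 / 2))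
      have p3 := one_add_rpow_pos hs.1 (-(3 / 2))
      have p4 := rpow_neg_le_one hs.1 (by norm_num : (-(1 / 2) : ℝ) ≤ 0)
      refine h1.trans ?_
      rw [← mul_sub]
      have : 4 * t * ((2 / 3) * (1 + s) ^ (-(3 / 2) : ℝ)) + 2 * (1 + s) ^ (-(1 / 2) : ℝ)
          - (4 * t * ((2 / 3) * (1 + t) ^ (-(3 / 2) : ℝ)) + 2 * (1 + t) ^ (-(1 / 2) : ℝ))
          ≤ 3 * W s := by
        simp only [hW]
        nlinarith [mul_nonneg ht0 p1.le, mul_nonneg ht0 p3.le]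
      calc α * M * _ ≤ α * M * (3 * W s) := mul_le_mul_of_nonneg_left this (by positivity)
        _ = _ := by ring
    · have h5 := one_add_rpow_pos hs.1 (-(5 / 2))
      have h3 := one_add_rpow_pos hs.1 (-(3 / 2))
      have h33 : (1 + s) ^ (-(3 / 2) : ℝ) * (1 + s) ^ (-(3 / 2) : ℝ)
          ≤ (1 + s) ^ (-(5 / 2) : ℝ) := by
        rw [← Real.rpow_add (by linarith [hs.1])]
        exact one_add_rpow_mono hs.1 (by norm_num)
      calc ‖K s (X s) (P s) - K s (Y s) (Q s)‖
          ≤ α * (1 + s) ^ (-(5 / 2) : ℝ) * ‖X s - Y s‖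
            + α * (1 + s) ^ (-(3 / 2) : ℝ) * ‖P s - Q s‖ := hK.lip s (hsub s hs) _ _ _ _
        _ ≤ α * (1 + s) ^ (-(5 / 2) : ℝ) * (3 * M * t)
            + α * (1 + s) ^ (-(3 / 2) : ℝ) * (M * W s) := by
          gcongr
          · exact hX s hs
          · exact hPM s hs
        _ = α * M * (3 * t * (1 + s) ^ (-(5 / 2) : ℝ) + (1 + s) ^ (-(3 / 2) : ℝ)
            + t * ((1 + s) ^ (-(3 / 2) : ℝ) * (1 + s) ^ (-(3 / 2) : ℝ))) := by
          simp only [hW]; ring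
        _ ≤ α * M * (3 * t * (1 + s) ^ (-(5 / 2) : ℝ) + (1 + s) ^ (-(3 / 2) : ℝ)
            + t * (1 + s) ^ (-(5 / 2) : ℝ)) := by gcongr
        _ = _ := by ring
  -- At the maximizing time, `M ≤ |d| + 3αM`, and `3α ≤ 1/2`.
  have hMd : M ≤ 2 * ‖d‖ := by
    have h1 := hD m hm
    have hWm := hWpos m hm
    have hW1 : 1 ≤ W m := by
      have := one_add_rpow_pos hm.1 (-(3 / 2)); simp only [hW]; nlinarith
    have h2 : M * W m = ‖P m - Q m‖ := by rw [hM]; field_simp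
    have h3 := norm_sub_norm_le (P m - Q m) d
    rw [norm_sub_rev (P m - Q m)] at h3
    have h4 : M * W m ≤ ‖d‖ * W m + 3 * α * M * W m := by
      nlinarith [norm_nonneg d]
    have h5 : M ≤ ‖d‖ + 3 * α * M := by
      refine le_of_mul_le_mul_right ?_ hWm
      linarith
    nlinarith
  have hDd : ∀ s ∈ Icc 0 t, ‖d - (P s - Q s)‖ ≤ 6 * α * ‖d‖ * W s := by
    intro s hs
    refine (hD s hs).trans ?_
    have := hWpos s hs
    calc 3 * α * M * W s ≤ 3 * α * (2 * ‖d‖) * W s := by gcongr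
      _ = _ := by ring
  -- Strong monotonicity is applied to `P s` and `P s - d`, which differ exactly by `d`. The
  -- remaining difference of `P s - d` and `Q s` is an error already controlled. As `|d| ≤ 2R`, the
  -- shifted momentum lies in the ball of radius `3R`.
  have hinner : ∀ s ∈ Icc 0 t,
      c * ‖d‖ ^ 2 - 6 * α * ‖d‖ ^ 2 * W s ≤ inner ℝ (velocity (P s) - velocity (Q s)) d := by
    intro s hs
    have hd2 : ‖d‖ ≤ 2 * R := by
      have := norm_sub_le (P t) (Q t); have := hP t htt; have := hQ t htt; linarith
    have b1 : ‖P s‖ ≤ 3 * R := (hP s hs).trans (by linarith)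
    have b2 : ‖P s - d‖ ≤ 3 * R := by
      have := norm_sub_le (P s) d; have := hP s hs; linarith
    have m1 := inner_velocity_sub_ge b1 b2
    rw [sub_sub_cancel] at m1
    have m2 : inner ℝ (velocity (P s) - velocity (Q s)) d
        = inner ℝ (velocity (P s) - velocity (P s - d)) d
          + inner ℝ (velocity (P s - d) - velocity (Q s)) d := by
      rw [← inner_add_left]; congr 1; abel
    have m3 := (abs_le.1 (abs_real_inner_le_norm (velocity (P s - d) - velocity (Q s)) d)).1
    have m4 : ‖velocity (P s - d) - velocity (Q s)‖ ≤ 6 * α * ‖d‖ * W s := by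
      refine (norm_velocity_sub_le _ _).trans ?_
      rw [show P s - d - Q s = -(d - (P s - Q s)) by abel, norm_neg]
      exact hDd s hs
    have m5 : ‖velocity (P s - d) - velocity (Q s)‖ * ‖d‖ ≤ 6 * α * ‖d‖ * W s * ‖d‖ := by gcongr
    rw [m2]
    nlinarith
  -- Integrating the lower bound over `[0, t]`, with total weight at most `3t`, gives `(c - 18α) t
  -- |d|²` at least. The assumption `36α ≤ c` leaves half of the main term.
  have hmono : MonotoneOn (fun s => inner ℝ (X s - Y s) d - (c * ‖d‖ ^ 2 * s
      + 6 * α * ‖d‖ ^ 2 * (-s + t * (2 * (1 + s) ^ (-(1 / 2) : ℝ))))) (Icc 0 t) := by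
    have hder : ∀ s ∈ Icc 0 t, HasDerivWithinAt (fun s => inner ℝ (X s - Y s) d - (c * ‖d‖ ^ 2 * s
        + 6 * α * ‖d‖ ^ 2 * (-s + t * (2 * (1 + s) ^ (-(1 / 2) : ℝ)))))
        (inner ℝ (velocity (P s) - velocity (Q s)) d
          - (c * ‖d‖ ^ 2 - 6 * α * ‖d‖ ^ 2 * W s)) (Icc 0 t) s := by
      intro s hs
      have g1 := ((h.pos s hs).sub (h'.pos s hs)).inner ℝ (hasDerivWithinAt_const s (Icc 0 t) d)
      have g2 := (((hasDerivAt_id s).const_mul (c * ‖d‖ ^ 2)).add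
        ((hdW s hs).const_mul (6 * α * ‖d‖ ^ 2))).hasDerivWithinAt (s := Icc 0 t)
      refine (g1.sub g2).congr_deriv ?_
      simp; ring
    refine monotoneOn_of_deriv_nonneg (convex_Icc 0 t) (fun s hs => (hder s hs).continuousWithinAt)
      (fun s hs => ?_) fun s hs => ?_
    · exact ((hder s (interior_subset hs)).hasDerivAt
        (mem_interior_iff_mem_nhds.1 hs)).differentiableAt.differentiableWithinAt
    · rw [((hder s (interior_subset hs)).hasDerivAt (mem_interior_iff_mem_nhds.1 hs)).deriv]
      have := hinner s (interior_subset hs)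
      linarith
  have hfin := hmono h0 htt ht.1
  simp only [hXY, sub_self, inner_zero_left, add_zero, Real.one_rpow] at hfin
  have hi := (abs_le.1 (abs_real_inner_le_norm (X 0 - Y 0) d)).1
  have p2 := one_add_rpow_pos ht.1 (-(1 / 2))
  have hd0 := norm_nonneg d
  have key : c / 2 * t * ‖d‖ * ‖d‖ ≤ ‖X 0 - Y 0‖ * ‖d‖ := by
    have q1 : 0 ≤ 12 * α * ‖d‖ ^ 2 * t * (1 + t) ^ (-(1 / 2) : ℝ) := by positivity
    have q2 : 0 ≤ (c - 36 * α) * (‖d‖ ^ 2 * t) :=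
      mul_nonneg (by linarith) (by positivity)
    nlinarith
  rcases hd0.eq_or_lt with hz | hz
  · rw [← hz, mul_zero]; exact norm_nonneg _
  · exact le_of_mul_le_mul_right key hz

end

/-! ### Functions of class `C¹` on a time slab -/

section Slab

variable {V W : Type*} [NormedAddCommGroup V] [NormedSpace ℝ V] [NormedAddCommGroup W]
  [NormedSpace ℝ W] {T : ℝ} {G : ℝ × V → W}

/-- The derivative of a function on the slab `[0,T[ × V`. -/
def slabDeriv (T : ℝ) (G : ℝ × V → W) (z : ℝ × V) : ℝ × V →L[ℝ] W :=
  fderivWithin ℝ G (Ico 0 T ×ˢ univ) z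

lemma hasFDerivWithinAt_slab (hG : ContDiffOn ℝ 1 G (Ico 0 T ×ˢ univ)) {t : ℝ} (ht : t ∈ Ico 0 T)
    (y : V) : HasFDerivWithinAt G (slabDeriv T G (t, y)) (Ico 0 T ×ˢ univ) (t, y) :=
  ((hG.differentiableOn (by simp)) (t, y) ⟨ht, mem_univ _⟩).hasFDerivWithinAt

lemma continuousOn_slabDeriv (hG : ContDiffOn ℝ 1 G (Ico 0 T ×ˢ univ)) :
    ContinuousOn (slabDeriv T G) (Ico 0 T ×ˢ univ) :=
  hG.continuousOn_fderivWithin ((uniqueDiffOn_Ico 0 T).prod uniqueDiffOn_univ) le_rfl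

lemma hasDerivWithinAt_slab (hG : ContDiffOn ℝ 1 G (Ico 0 T ×ˢ univ)) {t : ℝ} (ht : t ∈ Ico 0 T)
    (y : V) : HasDerivWithinAt (fun s => G (s, y)) (slabDeriv T G (t, y) (1, 0)) (Ico 0 T) t := by
  have h1 : HasDerivWithinAt (fun s : ℝ => (s, y)) ((1 : ℝ), (0 : V)) (Ico 0 T) t :=
    (hasDerivWithinAt_id t _).prodMk (hasDerivWithinAt_const t _ y)
  have hm : MapsTo (fun s : ℝ => (s, y)) (Ico 0 T) (Ico 0 T ×ˢ (univ : Set V)) :=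
    fun s hs => ⟨hs, mem_univ _⟩
  exact (hasFDerivWithinAt_slab hG ht y).comp_hasDerivWithinAt t h1 hm

lemma derivWithin_slab (hG : ContDiffOn ℝ 1 G (Ico 0 T ×ˢ univ)) {t : ℝ} (ht : t ∈ Ico 0 T)
    (y : V) : derivWithin (fun s => G (s, y)) (Ico 0 T) t = slabDeriv T G (t, y) (1, 0) :=
  (hasDerivWithinAt_slab hG ht y).derivWithin (uniqueDiffOn_Ico 0 T t ht)

lemma hasDerivAt_slab (hG : ContDiffOn ℝ 1 G (Ico 0 T ×ˢ univ)) {t : ℝ} (ht : t ∈ Ioo 0 T)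
    (y : V) : HasDerivAt (fun s => G (s, y)) (slabDeriv T G (t, y) (1, 0)) t :=
  (hasDerivWithinAt_slab hG ⟨ht.1.le, ht.2⟩ y).hasDerivAt (Ico_mem_nhds ht.1 ht.2)

lemma hasFDerivAt_slab (hG : ContDiffOn ℝ 1 G (Ico 0 T ×ˢ univ)) {t : ℝ} (ht : t ∈ Ico 0 T)
    (y : V) : HasFDerivAt (fun y => G (t, y))
      ((slabDeriv T G (t, y)).comp (ContinuousLinearMap.inr ℝ ℝ V)) y := by
  have h1 : HasFDerivAt (fun y : V => (t, y)) (ContinuousLinearMap.inr ℝ ℝ V) y :=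
    (hasFDerivAt_const t y).prodMk (hasFDerivAt_id y)
  rw [← hasFDerivWithinAt_univ] at h1 ⊢
  exact (hasFDerivWithinAt_slab hG ht y).comp y h1 fun s _ => ⟨ht, mem_univ _⟩

lemma differentiable_slab (hG : ContDiffOn ℝ 1 G (Ico 0 T ×ˢ univ)) {t : ℝ} (ht : t ∈ Ico 0 T) :
    Differentiable ℝ fun y => G (t, y) := fun y => (hasFDerivAt_slab hG ht y).differentiableAt

lemma continuousOn_fderiv_slab (hG : ContDiffOn ℝ 1 G (Ico 0 T ×ˢ univ)) :
    ContinuousOn (fun z : ℝ × V => fderiv ℝ (fun y => G (z.1, y)) z.2) (Ico 0 T ×ˢ univ) := by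
  have h1 : ContinuousOn (fun z => (slabDeriv T G z).comp (ContinuousLinearMap.inr ℝ ℝ V))
      (Ico 0 T ×ˢ univ) := (continuousOn_slabDeriv hG).clm_comp continuousOn_const
  exact h1.congr fun z hz => (hasFDerivAt_slab hG hz.1 z.2).fderiv

lemma continuous_fderiv_slab (hG : ContDiffOn ℝ 1 G (Ico 0 T ×ˢ univ)) {t : ℝ}
    (ht : t ∈ Ico 0 T) : Continuous (fderiv ℝ fun y => G (t, y)) :=
  (continuousOn_fderiv_slab hG).comp_continuous (f := fun y => (t, y)) (by fun_prop)
    fun y => ⟨ht, mem_univ _⟩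

end Slab

/-! ### The force of a solution with the free streaming condition -/

lemma exists_bounds_of_supNorm_add_le {V : Type} [NormedAddCommGroup V] {F G H : E3 → V} {c : ℝ}
    (hc : 0 ≤ c) (h : supNorm F + supNorm G + supNorm H ≤ ENNReal.ofReal c) :
    ∃ a b d : ℝ, 0 ≤ a ∧ 0 ≤ b ∧ 0 ≤ d ∧ a + b + d ≤ c ∧ (∀ x, ‖F x‖ ≤ a) ∧ (∀ x, ‖G x‖ ≤ b) ∧
      ∀ x, ‖H x‖ ≤ d := by
  have hfin : supNorm F + supNorm G + supNorm H ≠ ⊤ := (h.trans_lt ENNReal.ofReal_lt_top).ne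
  have hH : supNorm H ≠ ⊤ := (ENNReal.add_ne_top.1 hfin).2
  have hFG := (ENNReal.add_ne_top.1 hfin).1
  have hF : supNorm F ≠ ⊤ := (ENNReal.add_ne_top.1 hFG).1
  have hG : supNorm G ≠ ⊤ := (ENNReal.add_ne_top.1 hFG).2
  have key : ∀ {J : E3 → V}, supNorm J ≠ ⊤ → ∀ x, ‖J x‖ ≤ (supNorm J).toReal := by
    intro J hJ x
    rw [← toReal_enorm]
    exact ENNReal.toReal_mono hJ (le_iSup (fun x => ‖J x‖ₑ) x)
  refine ⟨(supNorm F).toReal, (supNorm G).toReal, (supNorm H).toReal, ENNReal.toReal_nonneg,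
    ENNReal.toReal_nonneg, ENNReal.toReal_nonneg, ?_, key hF, key hG, key hH⟩
  rw [← ENNReal.toReal_add hF hG, ← ENNReal.toReal_add hFG hH]
  exact ENNReal.toReal_le_of_le_ofReal hc h

lemma cross_sub_sub (u u' w w' : E3) :
    cross u w - cross u' w' = cross u (w - w') + cross (u - u') w' := by
  simp only [cross, WithLp.ofLp_sub, map_sub, LinearMap.sub_apply]
  rw [← WithLp.toLp_sub, ← WithLp.toLp_add]
  congr 1
  abel

lemma norm_sub_le_of_norm_fderiv_le {F : E3 → E3} (hF : Differentiable ℝ F) {C : ℝ}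
    (h : ∀ x, ‖fderiv ℝ F x‖ ≤ C) (x x' : E3) : ‖F x - F x'‖ ≤ C * ‖x - x'‖ :=
  convex_univ.norm_image_sub_le_of_norm_fderiv_le (fun x _ => hF x) (fun x _ => h x)
    (mem_univ _) (mem_univ _)

lemma continuous_cross : Continuous fun z : E3 × E3 => cross z.1 z.2 := by
  refine (PiLp.continuous_toLp 2 _).comp ?_
  refine continuous_pi fun i => ?_
  fin_cases i <;> simp [cross_apply] <;> fun_prop

lemma continuousOn_cross {Z : Type*} [TopologicalSpace Z] {u w : Z → E3} {S : Set Z}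
    (hu : ContinuousOn u S) (hw : ContinuousOn w S) : ContinuousOn (fun z => cross (u z) (w z)) S :=
  Continuous.comp_continuousOn (g := fun z : E3 × E3 => cross z.1 z.2)
    (f := fun z => (u z, w z)) continuous_cross (hu.prodMk hw)

section Solution

variable {T : ℝ} {f : ℝ → E3 → E3 → ℝ} {EL ET B : ℝ → E3 → E3}

lemma IsClassicalSolution.differentiable_EL (h : IsClassicalSolution T f EL ET B) {t : ℝ}
    (ht : t ∈ Ico 0 T) : Differentiable ℝ (EL t) := differentiable_slab h.contDiffOn_EL ht

lemma IsClassicalSolution.differentiable_B (h : IsClassicalSolution T f EL ET B) {t : ℝ}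
    (ht : t ∈ Ico 0 T) : Differentiable ℝ (B t) := differentiable_slab h.contDiffOn_B ht

lemma IsClassicalSolution.continuous_force (h : IsClassicalSolution T f EL ET B) :
    ContinuousOn (fun z : ℝ × E3 × E3 => force EL ET B z.1 z.2.1 z.2.2)
      (Ico 0 T ×ˢ (univ : Set (E3 × E3))) := by
  have hmap : MapsTo (fun z : ℝ × E3 × E3 => (z.1, z.2.1)) (Ico 0 T ×ˢ (univ : Set (E3 × E3)))
      (Ico 0 T ×ˢ (univ : Set E3)) := fun z hz => ⟨hz.1, mem_univ _⟩
  have hc : ContinuousOn (fun z : ℝ × E3 × E3 => (z.1, z.2.1))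
      (Ico 0 T ×ˢ (univ : Set (E3 × E3))) := by fun_prop
  have lift : ∀ {F : ℝ → E3 → E3}, ContinuousOn (fun z : ℝ × E3 => F z.1 z.2)
      (Ico 0 T ×ˢ (univ : Set E3)) → ContinuousOn (fun z : ℝ × E3 × E3 => F z.1 z.2.1)
      (Ico 0 T ×ˢ (univ : Set (E3 × E3))) := fun hF => hF.comp hc hmap
  have h1 := lift h.contDiffOn_EL.continuousOn
  have h2 := lift h.continuousOn_ET
  have h3 := lift h.contDiffOn_B.continuousOn
  have hv : ContinuousOn (fun z : ℝ × E3 × E3 => velocity z.2.2)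
      (Ico 0 T ×ˢ (univ : Set (E3 × E3))) := by
    have := (contDiff_velocity (n := 0)).continuous
    fun_prop
  have h4 : ContinuousOn (fun z : ℝ × E3 × E3 => cross (velocity z.2.2) (B z.1 z.2.1))
      (Ico 0 T ×ˢ (univ : Set (E3 × E3))) := continuousOn_cross hv h3
  unfold force
  exact ContinuousOn.add (ContinuousOn.add h1 h2) h4

/-- The field bound also controls the dependence on `p`, since the momentum enters only through
`v(p) × B` and `v` is 1-Lipschitz. The gradient bound controls the dependence on `x`. -/
lemma IsClassicalSolution.forceBounds (h : IsClassicalSolution T f EL ET B) {α a : ℝ}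
    (hα : 0 ≤ α) (hα6 : α ≤ 1 / 6) (ha : a < T) (hfs : FreeStreaming α a EL ET B) :
    ForceBounds α a (force EL ET B) := by
  refine ⟨hα, hα6, fun x p => ?_, fun s hs x p => ?_, fun s hs x x' p p' => ?_⟩
  · exact h.continuous_force.comp (f := fun s => (s, x, p)) (by fun_prop)
      fun s hs => ⟨⟨hs.1, hs.2.trans_lt ha⟩, mem_univ _⟩
  · have hw := one_add_rpow_pos hs.1 (-(3 / 2))
    obtain ⟨eT, eL, b, -, -, hb0, hsum, hT, hL, hB⟩ :=
      exists_bounds_of_supNorm_add_le (by positivity) (hfs s hs).1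
    have hc := norm_cross_le (velocity p) (B s x)
    have hv := norm_velocity_le_one p
    calc ‖force EL ET B s x p‖ ≤ ‖EL s x‖ + ‖ET s x‖ + ‖cross (velocity p) (B s x)‖ :=
          norm_add₃_le
      _ ≤ eL + eT + 1 * b := by
          refine add_le_add (add_le_add (hL x) (hT x)) (hc.trans ?_)
          exact mul_le_mul hv (hB x) (norm_nonneg _) zero_le_one
      _ ≤ _ := by linarith
  · have hsT : s ∈ Ico 0 T := ⟨hs.1, hs.2.trans_lt ha⟩
    have hw := one_add_rpow_pos hs.1 (-(3 / 2))
    have hw5 := one_add_rpow_pos hs.1 (-(5 / 2))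
    obtain ⟨eT, eL, b, heT, heL, hb0, hsum, hT, hL, hB⟩ :=
      exists_bounds_of_supNorm_add_le (by positivity) (hfs s hs).1
    obtain ⟨gT, gL, gb, -, -, hgb0, hgsum, hgT, hgL, hgB⟩ :=
      exists_bounds_of_supNorm_add_le (by positivity) (hfs s hs).2
    have hv := norm_velocity_le_one p
    have l1 := norm_sub_le_of_norm_fderiv_le (h.differentiable_EL hsT) hgL x x'
    have l2 := norm_sub_le_of_norm_fderiv_le (h.differentiable_ET s hsT) hgT x x'
    have l3 := norm_sub_le_of_norm_fderiv_le (h.differentiable_B hsT) hgB x x'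
    have e : force EL ET B s x p - force EL ET B s x' p'
        = (EL s x - EL s x') + (ET s x - ET s x')
          + (cross (velocity p) (B s x - B s x') + cross (velocity p - velocity p') (B s x')) := by
      rw [← cross_sub_sub]; unfold force; abel
    have c1 : ‖cross (velocity p) (B s x - B s x')‖ ≤ 1 * (gb * ‖x - x'‖) :=
      (norm_cross_le _ _).trans (mul_le_mul hv l3 (norm_nonneg _) zero_le_one)
    have c2 : ‖cross (velocity p - velocity p') (B s x')‖ ≤ ‖p - p'‖ * b :=
      (norm_cross_le _ _).trans
        (mul_le_mul (norm_velocity_sub_le _ _) (hB x') (norm_nonneg _) (norm_nonneg _))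
    rw [e]
    have hx := norm_nonneg (x - x')
    have hp := norm_nonneg (p - p')
    calc _ ≤ ‖EL s x - EL s x'‖ + ‖ET s x - ET s x'‖
          + (‖cross (velocity p) (B s x - B s x')‖
            + ‖cross (velocity p - velocity p') (B s x')‖) :=
          norm_add₃_le.trans (by gcongr; exact norm_add_le _ _)
      _ ≤ gL * ‖x - x'‖ + gT * ‖x - x'‖ + (1 * (gb * ‖x - x'‖) + ‖p - p'‖ * b) := by gcongr
      _ = (gT + gL + gb) * ‖x - x'‖ + b * ‖p - p'‖ := by ring
      _ ≤ _ := by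
        refine add_le_add (mul_le_mul_of_nonneg_right hgsum hx) (mul_le_mul_of_nonneg_right ?_ hp)
        linarith

/-! ### The distribution function along characteristics -/

/-- The distribution function as a function on space-time. -/
def spaceTime (f : ℝ → E3 → E3 → ℝ) : ℝ × E3 × E3 → ℝ := fun z => f z.1 z.2.1 z.2.2

lemma fderiv_eq_inner_gradient {g : E3 → ℝ} {x u : E3} (hg : DifferentiableAt ℝ g x) :
    fderiv ℝ g x u = inner ℝ u (gradient g x) := by
  rw [real_inner_comm]
  have := hg.hasGradientAt.hasFDerivAt.fderiv
  rw [this, InnerProductSpace.toDual_apply_apply]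

lemma IsClassicalSolution.slabDeriv_x (h : IsClassicalSolution T f EL ET B) {t : ℝ}
    (ht : t ∈ Ico 0 T) (x p : E3) :
    HasFDerivAt (fun y => f t y p) ((slabDeriv T (spaceTime f) (t, x, p)).comp
      ((ContinuousLinearMap.inr ℝ ℝ (E3 × E3)).comp (ContinuousLinearMap.inl ℝ E3 E3))) x := by
  have h1 : HasFDerivAt (fun y : E3 => (y, p)) (ContinuousLinearMap.inl ℝ E3 E3) x :=
    (hasFDerivAt_id x).prodMk (hasFDerivAt_const p x)
  exact HasFDerivAt.comp x (hasFDerivAt_slab (G := spaceTime f) h.contDiffOn_f ht (x, p)) h1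

lemma IsClassicalSolution.slabDeriv_p (h : IsClassicalSolution T f EL ET B) {t : ℝ}
    (ht : t ∈ Ico 0 T) (x p : E3) :
    HasFDerivAt (fun q => f t x q) ((slabDeriv T (spaceTime f) (t, x, p)).comp
      ((ContinuousLinearMap.inr ℝ ℝ (E3 × E3)).comp (ContinuousLinearMap.inr ℝ E3 E3))) p := by
  have h1 : HasFDerivAt (fun q : E3 => (x, q)) (ContinuousLinearMap.inr ℝ E3 E3) p :=
    (hasFDerivAt_const x p).prodMk (hasFDerivAt_id p)
  exact HasFDerivAt.comp p (hasFDerivAt_slab (G := spaceTime f) h.contDiffOn_f ht (x, p)) h1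

/-- The Vlasov equation: the derivative in the direction `(1, v(p), K)` vanishes. -/
lemma IsClassicalSolution.slabDeriv_vlasov (h : IsClassicalSolution T f EL ET B) {t : ℝ}
    (ht : t ∈ Ico 0 T) (x p : E3) :
    slabDeriv T (spaceTime f) (t, x, p) (1, velocity p, force EL ET B t x p) = 0 := by
  have hv := h.vlasov t ht x p
  have hx := h.slabDeriv_x ht x p
  have hp := h.slabDeriv_p ht x p
  have ht' := derivWithin_slab (G := spaceTime f) h.contDiffOn_f ht (x, p)
  rw [← fderiv_eq_inner_gradient hx.differentiableAt, ← fderiv_eq_inner_gradient hp.differentiableAt,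
    hx.fderiv, hp.fderiv] at hv
  have e : ((1 : ℝ), velocity p, force EL ET B t x p)
      = (1, 0, 0) + ((0, velocity p, 0) + (0, 0, force EL ET B t x p)) := by simp
  rw [e, map_add, map_add, ← add_assoc]
  change _ + slabDeriv T (spaceTime f) (t, x, p) (0, velocity p, 0)
    + slabDeriv T (spaceTime f) (t, x, p) (0, 0, force EL ET B t x p) = 0 at hv
  change derivWithin (fun s => f s x p) (Ico 0 T) t
    = slabDeriv T (spaceTime f) (t, x, p) (1, 0, 0) at ht'
  rw [← ht']
  exact hv

/-- By the Vlasov equation, `f` has zero derivative along a characteristic. -/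
lemma IsClassicalSolution.eq_initial (h : IsClassicalSolution T f EL ET B) {t : ℝ}
    (ht : t ∈ Ico 0 T) {X P : ℝ → E3} (hc : IsCharacteristic (force EL ET B) t X P) :
    f t (X t) (P t) = f 0 (X 0) (P 0) := by
  have hsub : ∀ s ∈ Icc 0 t, s ∈ Ico 0 T := fun s hs => ⟨hs.1, hs.2.trans_lt ht.2⟩
  have hd : ∀ s ∈ Icc 0 t, HasDerivWithinAt (fun s => f s (X s) (P s)) 0 (Icc 0 t) s := by
    intro s hs
    have h1 : HasDerivWithinAt (fun s => (s, X s, P s))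
        ((1 : ℝ), velocity (P s), force EL ET B s (X s) (P s)) (Icc 0 t) s :=
      (hasDerivWithinAt_id s _).prodMk ((hc.pos s hs).prodMk (hc.mom s hs))
    have hm : MapsTo (fun s => (s, X s, P s)) (Icc 0 t) (Ico 0 T ×ˢ (univ : Set (E3 × E3))) :=
      fun τ hτ => ⟨hsub τ hτ, mem_univ _⟩
    have h2 := (hasFDerivWithinAt_slab (G := spaceTime f) h.contDiffOn_f (hsub s hs)
      (X s, P s)).comp_hasDerivWithinAt s h1 hm
    rw [h.slabDeriv_vlasov (hsub s hs)] at h2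
    exact h2
  have := norm_sub_le_of_norm_deriv_le (φ := fun _ => 0) (Φ := fun _ => 0) hd
    (fun s _ => by simpa using hasDerivAt_const s (0 : ℝ)) (fun s _ => by simp)
    (s := 0) ⟨le_rfl, ht.1⟩
  rw [sub_self] at this
  exact sub_eq_zero.1 (norm_le_zero_iff.1 this)

end Solution

/-! ### From the initial data to bounds at time `t`. -/

lemma InitialData.abs_sub_le {R₀ P₀ : ℝ} {g : E3 → E3 → ℝ} (h : InitialData R₀ P₀ g)
    (x x' p p' : E3) : |g x p - g x' p'| ≤ ‖x - x'‖ + ‖p - p'‖ := by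
  have hd := h.contDiff.differentiable (by norm_num)
  have dx : ∀ p, Differentiable ℝ fun y => g y p := fun p y =>
    DifferentiableAt.comp (g := fun z : E3 × E3 => g z.1 z.2) (f := fun y => (y, p)) y (hd (y, p)) ((differentiableAt_id).prodMk (differentiableAt_const p))
  have dp : ∀ x, Differentiable ℝ fun q => g x q := fun x q =>
    DifferentiableAt.comp (g := fun z : E3 × E3 => g z.1 z.2) (f := fun q => (x, q)) q (hd (x, q)) ((differentiableAt_const x).prodMk differentiableAt_id)
  have nb : ∀ x p, ‖gradient (fun y => g y p) x‖ ≤ 1 ∧ ‖gradient (fun q => g x q) p‖ ≤ 1 := by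
    intro x p
    have := h.gradient_le_one x p
    constructor
    · exact (Real.le_sqrt_of_sq_le (by nlinarith [sq_nonneg ‖gradient (fun q => g x q) p‖])).trans this
    · exact (Real.le_sqrt_of_sq_le (by nlinarith [sq_nonneg ‖gradient (fun y => g y p) x‖])).trans this
  have fg : ∀ {k : E3 → ℝ} (y : E3), ‖gradient k y‖ ≤ 1 → ‖fderiv ℝ k y‖ ≤ 1 := by
    intro k y hk
    rw [gradient, LinearIsometryEquiv.norm_map] at hk
    exact hk
  have m1 : ‖g x p - g x' p‖ ≤ 1 * ‖x - x'‖ :=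
    convex_univ.norm_image_sub_le_of_norm_fderiv_le (f := fun y => g y p) (fun y _ => dx p y)
      (fun y _ => fg y (nb y p).1) (mem_univ _) (mem_univ _)
  have m2 : ‖g x' p - g x' p'‖ ≤ 1 * ‖p - p'‖ :=
    convex_univ.norm_image_sub_le_of_norm_fderiv_le (f := fun q => g x' q) (fun q _ => dp x' q)
      (fun q _ => fg q (nb x' q).2) (mem_univ _) (mem_univ _)
  rw [one_mul, Real.norm_eq_abs] at m1 m2
  calc |g x p - g x' p'| ≤ |g x p - g x' p| + |g x' p - g x' p'| := _root_.abs_sub_le _ _ _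
    _ ≤ _ := add_le_add m1 m2

lemma InitialData.norm_lt {R₀ P₀ : ℝ} {g : E3 → E3 → ℝ} (h : InitialData R₀ P₀ g) {x p : E3}
    (hg : g x p ≠ 0) : ‖x‖ < R₀ ∧ ‖p‖ < P₀ := by
  have : (x, p) ∈ tsupport (fun z : E3 × E3 => g z.1 z.2) := subset_tsupport _ hg
  have := h.support this
  simpa using this

/-- The dispersion constant of the distribution function. -/
def dispersion (R₀ P₀ : ℝ) : ℝ := 4 * R₀ / monoConst (3 * (P₀ + 1))

/-- The properties of the distribution function at time `t` that follow from the free streaming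
condition. -/
structure DensityBounds (R₀ P₀ t : ℝ) (g : E3 → E3 → ℝ) : Prop where
  nonneg : ∀ x p, 0 ≤ g x p
  le_one : ∀ x p, g x p ≤ 1
  pos_le : ∀ {x p}, g x p ≠ 0 → ‖x‖ ≤ R₀ + t
  mom_le : ∀ {x p}, g x p ≠ 0 → ‖p‖ ≤ P₀ + 1
  mom_sub_le : ∀ {x p q}, g x p ≠ 0 → g x q ≠ 0 → t * ‖p - q‖ ≤ dispersion R₀ P₀
  lip : ∀ x x' p, |g x p - g x' p| ≤ 3 * ‖x - x'‖

/-- Each property is read off at time `0` after following characteristics back from time `t`. The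
bound `P₀ + 1` covers two momentum changes of at most `1/3`. The dispersion constant comes from two
starting points in the ball of radius `R₀`. The Lipschitz constant `3` is `2` for positions plus `1`
for momenta. -/
lemma IsClassicalSolution.densityBounds {T : ℝ} {f : ℝ → E3 → E3 → ℝ} {EL ET B : ℝ → E3 → E3}
    (h : IsClassicalSolution T f EL ET B) {R₀ P₀ α a : ℝ} (hα : 0 ≤ α) (hα6 : α ≤ 1 / 6)
    (hαP : 36 * α ≤ monoConst (3 * (P₀ + 1))) (hI : InitialData R₀ P₀ (f 0)) (ha : a < T)
    (hfs : FreeStreaming α a EL ET B) {t : ℝ} (ht : t ∈ Icc 0 a) :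
    DensityBounds R₀ P₀ t (f t) := by
  have hK := h.forceBounds hα hα6 ha hfs
  have htT : t ∈ Ico 0 T := ⟨ht.1, ht.2.trans_lt ha⟩
  have h0t : (0 : ℝ) ∈ Icc 0 t := ⟨le_rfl, ht.1⟩
  have hmom : ∀ {X P : ℝ → E3}, IsCharacteristic (force EL ET B) t X P → f t (X t) (P t) ≠ 0 →
      ‖X 0‖ < R₀ ∧ ∀ s ∈ Icc 0 t, ‖P s‖ ≤ P₀ + 1 := by
    intro X P hc hne
    rw [h.eq_initial htT hc] at hne
    obtain ⟨h1, h2⟩ := hI.norm_lt hne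
    refine ⟨h1, fun s hs => ?_⟩
    have b1 := hK.norm_mom_sub_le ht hc hs
    have b2 := hK.norm_mom_sub_le ht hc h0t
    have b3 : ‖P s‖ ≤ ‖P t - P 0‖ + ‖P 0‖ + ‖P t - P s‖ := by
      calc ‖P s‖ = ‖(P t - P 0) + P 0 - (P t - P s)‖ := by congr 1; abel
        _ ≤ _ := (norm_sub_le _ _).trans (by gcongr; exact norm_add_le _ _)
    linarith
  constructor
  · intro x p
    obtain ⟨X, P, hc, rfl, rfl⟩ := hK.exists_characteristic ht x p
    rw [h.eq_initial htT hc]; exact hI.nonneg _ _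
  · intro x p
    obtain ⟨X, P, hc, rfl, rfl⟩ := hK.exists_characteristic ht x p
    rw [h.eq_initial htT hc]; exact (le_abs_self _).trans (hI.le_one _ _)
  · intro x p hne
    obtain ⟨X, P, hc, rfl, rfl⟩ := hK.exists_characteristic ht x p
    have h1 := (hmom hc hne).1
    have h2 := hc.norm_pos_sub_le ht.1
    have h3 := norm_sub_norm_le (X t) (X 0)
    linarith
  · intro x p hne
    obtain ⟨X, P, hc, rfl, rfl⟩ := hK.exists_characteristic ht x p
    exact (hmom hc hne).2 t ⟨ht.1, le_rfl⟩
  · intro x p q hp hq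
    obtain ⟨X, P, hc, rfl, rfl⟩ := hK.exists_characteristic ht x p
    obtain ⟨Y, Q, hc', hY, rfl⟩ := hK.exists_characteristic ht (X t) q
    rw [← hY] at hq
    obtain ⟨x1, p1⟩ := hmom hc hp
    obtain ⟨x2, p2⟩ := hmom hc' hq
    have h1 := hK.norm_sub_ge_of_pos_eq ht hαP hc hc' hY.symm p1 p2
    have h2 := norm_sub_le (X 0) (Y 0)
    have hm := monoConst_pos (3 * (P₀ + 1))
    rw [dispersion, le_div_iff₀ hm]
    linarith
  · intro x x' p
    obtain ⟨X, P, hc, rfl, rfl⟩ := hK.exists_characteristic ht x p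
    obtain ⟨Y, Q, hc', rfl, hQ⟩ := hK.exists_characteristic ht x' (P t)
    have e : f t (Y t) (P t) = f t (Y t) (Q t) := by rw [hQ]
    rw [e, h.eq_initial htT hc, h.eq_initial htT hc']
    obtain ⟨h1, h2⟩ := hK.norm_sub_le_of_mom_eq ht hc hc' hQ.symm
    have := hI.abs_sub_le (X 0) (Y 0) (P 0) (Q 0)
    linarith

/-! ### Weak form of the div-curl system -/

lemma hasFDerivAt_comp_coord {F : E3 → E3} {L : E3 →L[ℝ] E3} {x : E3} (hF : HasFDerivAt F L x)
    (i : Fin 3) : HasFDerivAt (fun y => F y i) ((EuclideanSpace.proj i : E3 →L[ℝ] ℝ).comp L) x :=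
  (EuclideanSpace.proj i : E3 →L[ℝ] ℝ).hasFDerivAt.comp x hF

lemma partialD_eq_pd {F : E3 → E3} (hF : Differentiable ℝ F) (k i : Fin 3) (x : E3) :
    partialD F k i x = pd k (fun y => F y i) x := by
  rw [pd, (hasFDerivAt_comp_coord (hF x).hasFDerivAt i).fderiv]; rfl

lemma differentiable_coord {F : E3 → E3} (hF : Differentiable ℝ F) (i : Fin 3) :
    Differentiable ℝ fun y => F y i :=
  fun x => (hasFDerivAt_comp_coord (hF x).hasFDerivAt i).differentiableAt

lemma continuous_pd_coord {F : E3 → E3} (hF : Differentiable ℝ F) (hF' : Continuous (fderiv ℝ F))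
    (k i : Fin 3) : Continuous (pd k fun y => F y i) := by
  have : (pd k fun y => F y i) = fun x => (fderiv ℝ F x (EuclideanSpace.single k 1)) i :=
    funext fun x => (partialD_eq_pd hF k i x).symm
  rw [this]
  fun_prop

lemma continuous_curl {F : E3 → E3} (hF' : Continuous (fderiv ℝ F)) (i : Fin 3) :
    Continuous fun y => curl F y i := by
  have h : ∀ k l : Fin 3, Continuous fun y => partialD F k l y := fun k l => by
    unfold partialD; fun_prop
  fin_cases i
  · exact (h 1 2).sub (h 2 1)
  · exact (h 2 0).sub (h 0 2)
  · exact (h 0 1).sub (h 1 0)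

/-- Integrating a vector field against the Laplacian of a test function. -/
lemma integral_mul_lap {F : E3 → E3} (hF : Differentiable ℝ F) (hF' : Continuous (fderiv ℝ F))
    {g : E3 → ℝ} (hg : IsTest g) (i : Fin 3) :
    ∫ y, F y i * lap g y = -(∫ y, divergence F y * pd i g y)
      - ∫ y, (curl F y (i + 1) * pd (i + 2) g y - curl F y (i + 2) * pd (i + 1) g y) := by
  have hd := differentiable_coord hF
  have hc := continuous_pd_coord hF hF'
  have h1 : ∫ y, F y i * lap g y = -∑ k, ∫ y, pd k (fun y => F y i) y * pd k g y := by
    unfold lap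
    simp only [Finset.mul_sum]
    rw [integral_finsetSum _ fun k _ =>
      integrable_mul_test (hd i).continuous ((hg.pd k).pd k), ← Finset.sum_neg_distrib]
    exact Finset.sum_congr rfl fun k _ => integral_mul_pd (hd i) (hc k i) (hg.pd k)
  -- The interchange of derivatives is carried out on the smooth test function, so second
  -- derivatives of `F` are never needed. The whole lemma is the weak form of `ΔF = ∇(∇·F) -
  -- ∇×(∇×F)`, with indices taken modulo `3`.
  have h2 : ∀ k, ∫ y, pd i (fun y => F y k) y * pd k g y
      = ∫ y, pd k (fun y => F y k) y * pd i g y := by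
    intro k
    have e1 := integral_mul_pd (hd k) (hc i k) (hg.pd k)
    have e2 := integral_mul_pd (hd k) (hc k k) (hg.pd i)
    rw [pd_comm hg.smooth] at e1
    linarith
  have h3 : ∫ y, divergence F y * pd i g y = ∑ k, ∫ y, pd i (fun y => F y k) y * pd k g y := by
    unfold divergence
    simp only [Finset.sum_mul, h2, partialD_eq_pd hF]
    exact integral_finsetSum _ fun k _ => integrable_mul_test (hc k k) (hg.pd i)
  have h4 : ∫ y, (curl F y (i + 1) * pd (i + 2) g y - curl F y (i + 2) * pd (i + 1) g y)
      = ∑ k, ((∫ y, pd k (fun y => F y i) y * pd k g y)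
        - ∫ y, pd i (fun y => F y k) y * pd k g y) := by
    have e : ∀ k, (∫ y, pd k (fun y => F y i) y * pd k g y)
        - ∫ y, pd i (fun y => F y k) y * pd k g y
        = ∫ y, (pd k (fun y => F y i) y * pd k g y - pd i (fun y => F y k) y * pd k g y) :=
      fun k => (integral_sub (integrable_mul_test (hc k i) (hg.pd k))
        (integrable_mul_test (hc i k) (hg.pd k))).symm
    simp only [e]
    have hi : ∀ k ∈ Finset.univ, Integrable fun y =>
        pd k (fun y => F y i) y * pd k g y - pd i (fun y => F y k) y * pd k g y :=
      fun k _ => (integrable_mul_test (hc k i) (hg.pd k)).sub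
        (integrable_mul_test (hc i k) (hg.pd k))
    rw [← integral_finsetSum _ hi]
    refine integral_congr_ae (ae_of_all _ fun y => ?_)
    simp only [← partialD_eq_pd hF]
    fin_cases i <;> simp [curl, Fin.sum_univ_three] <;> ring
  rw [h1, h4, h3, Finset.sum_sub_distrib]
  ring

/-! ### Differentiation under the integral sign -/

lemma hasDerivAt_integral_of_compact {Z : Type*} [TopologicalSpace Z] [MeasurableSpace Z]
    [OpensMeasurableSpace Z] [SecondCountableTopology Z] [T2Space Z]
    {μ : Measure Z} [IsFiniteMeasureOnCompacts μ] {U U' : ℝ → Z → ℝ} {b c t : ℝ}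
    (ht : t ∈ Ioo b c) {S : Set Z} (hS : IsCompact S)
    (hU : ∀ s ∈ Ioo b c, Continuous (U s))
    (hU' : ContinuousOn (fun z : ℝ × Z => U' z.1 z.2) (Ioo b c ×ˢ univ))
    (hd : ∀ s ∈ Ioo b c, ∀ z, HasDerivAt (fun s => U s z) (U' s z) s)
    (hz : ∀ s ∈ Ioo b c, ∀ z ∉ S, U s z = 0) :
    HasDerivAt (fun s => ∫ z, U s z ∂μ) (∫ z, U' t z ∂μ) t := by
  -- Off `S` the function vanishes for all nearby times, hence so does its time derivative. This
  -- confines the dominating function to `S`.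
  have hz' : ∀ s ∈ Ioo b c, ∀ z ∉ S, U' s z = 0 := by
    intro s hs z hzS
    have e : (fun s => U s z) =ᶠ[𝓝 s] fun _ => 0 :=
      Filter.eventuallyEq_of_mem (isOpen_Ioo.mem_nhds hs) fun s hs => hz s hs z hzS
    exact (hd s hs z).unique ((hasDerivAt_const s (0 : ℝ)).congr_of_eventuallyEq e)
  obtain ⟨δ, hδ, hsub⟩ := Metric.nhds_basis_closedBall.mem_iff.1 (isOpen_Ioo.mem_nhds ht)
  obtain ⟨C, hC⟩ := ((isCompact_closedBall t δ).prod hS).exists_bound_of_continuousOn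
    (hU'.mono (prod_mono hsub (subset_univ _)))
  have hcU' : Continuous (U' t) :=
    hU'.comp_continuous (f := fun z => (t, z)) (by fun_prop) fun z => ⟨ht, mem_univ _⟩
  have hmeas : MeasurableSet S := hS.measurableSet
  refine (hasDerivAt_integral_of_dominated_loc_of_deriv_le (s := Metric.closedBall t δ)
    (bound := S.indicator fun _ => C) (Metric.closedBall_mem_nhds t hδ) ?_ ?_
    hcU'.aestronglyMeasurable (ae_of_all _ fun z s hs => ?_) ?_
    (ae_of_all _ fun z s hs => hd s (hsub hs) z)).2
  · filter_upwards [isOpen_Ioo.mem_nhds ht] with s hs using (hU s hs).aestronglyMeasurable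
  · exact (hU t ht).integrable_of_hasCompactSupport (HasCompactSupport.intro hS (hz t ht))
  · by_cases hzS : z ∈ S
    · rw [indicator_of_mem hzS]; exact hC (s, z) ⟨hs, hzS⟩
    · rw [indicator_of_notMem hzS, hz' s (hsub hs) z hzS, norm_zero]
  · exact (integrable_indicator_iff hmeas).2 (integrableOn_const hS.measure_lt_top.ne)

lemma hasDerivAt_coord {u : ℝ → E3} {u' : E3} {t : ℝ} (h : HasDerivAt u u' t) (i : Fin 3) :
    HasDerivAt (fun s => u s i) (u' i) t :=
  (EuclideanSpace.proj i : E3 →L[ℝ] ℝ).hasFDerivAt.comp_hasDerivAt t h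

/-- The time derivative of a field. -/
def timeDeriv (T : ℝ) (F : ℝ → E3 → E3) (t : ℝ) (y : E3) : E3 :=
  slabDeriv T (fun z : ℝ × E3 => F z.1 z.2) (t, y) (1, 0)

section Field

variable {T : ℝ} {F : ℝ → E3 → E3}

lemma continuousOn_timeDeriv
    (hF : ContDiffOn ℝ 1 (fun z : ℝ × E3 => F z.1 z.2) (Ico 0 T ×ˢ univ)) :
    ContinuousOn (fun z : ℝ × E3 => timeDeriv T F z.1 z.2) (Ico 0 T ×ˢ univ) :=
  (continuousOn_slabDeriv hF).clm_apply continuousOn_const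

lemma continuous_timeDeriv
    (hF : ContDiffOn ℝ 1 (fun z : ℝ × E3 => F z.1 z.2) (Ico 0 T ×ˢ univ)) {t : ℝ}
    (ht : t ∈ Ico 0 T) : Continuous (timeDeriv T F t) :=
  (continuousOn_timeDeriv hF).comp_continuous (f := fun y => (t, y)) (by fun_prop)
    fun y => ⟨ht, mem_univ _⟩

lemma hasDerivAt_integral_field
    (hF : ContDiffOn ℝ 1 (fun z : ℝ × E3 => F z.1 z.2) (Ico 0 T ×ˢ univ)) {t : ℝ}
    (ht : t ∈ Ioo 0 T) {g : E3 → ℝ} (hg : IsTest g) (i : Fin 3) :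
    HasDerivAt (fun s => ∫ y, F s y i * g y) (∫ y, timeDeriv T F t y i * g y) t := by
  have hgc := hg.continuous
  refine hasDerivAt_integral_of_compact (U := fun s y => F s y i * g y)
    (U' := fun s y => timeDeriv T F s y i * g y) ht hg.compact
    (fun s hs => ?_) ?_ (fun s hs y => ?_) fun s hs y hy => ?_
  · have : Continuous (F s) := (differentiable_slab hF ⟨hs.1.le, hs.2⟩).continuous
    fun_prop
  · have h1 := (continuousOn_timeDeriv hF).mono
      (prod_mono Ioo_subset_Ico_self (subset_refl (univ : Set E3)))
    have h2 : ContinuousOn (fun z : ℝ × E3 => timeDeriv T F z.1 z.2 i) (Ioo 0 T ×ˢ univ) :=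
      (EuclideanSpace.proj i : E3 →L[ℝ] ℝ).continuous.comp_continuousOn h1
    exact h2.mul (by fun_prop)
  · exact (hasDerivAt_coord (hasDerivAt_slab hF hs y) i).mul_const (g y)
  · simp only [image_eq_zero_of_notMem_tsupport hy, mul_zero]

end Field

section Solution

variable {T : ℝ} {f : ℝ → E3 → E3 → ℝ} {EL ET B : ℝ → E3 → E3}

lemma IsClassicalSolution.continuous_fderiv_EL (h : IsClassicalSolution T f EL ET B) {t : ℝ}
    (ht : t ∈ Ico 0 T) : Continuous (fderiv ℝ (EL t)) := continuous_fderiv_slab h.contDiffOn_EL ht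

lemma IsClassicalSolution.continuous_fderiv_B (h : IsClassicalSolution T f EL ET B) {t : ℝ}
    (ht : t ∈ Ico 0 T) : Continuous (fderiv ℝ (B t)) := continuous_fderiv_slab h.contDiffOn_B ht

lemma IsClassicalSolution.continuous_fderiv_ET (h : IsClassicalSolution T f EL ET B) {t : ℝ}
    (ht : t ∈ Ico 0 T) : Continuous (fderiv ℝ (ET t)) :=
  h.continuousOn_fderiv_ET.comp_continuous (f := fun y => (t, y)) (by fun_prop)
    fun y => ⟨ht, mem_univ _⟩

lemma IsClassicalSolution.integral_EL (h : IsClassicalSolution T f EL ET B) {t : ℝ}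
    (ht : t ∈ Ico 0 T) {g : E3 → ℝ} (hg : IsTest g) (i : Fin 3) :
    ∫ y, EL t y i * lap g y = -∫ y, chargeDensity f t y * pd i g y := by
  rw [integral_mul_lap (h.differentiable_EL ht) (h.continuous_fderiv_EL ht) hg]
  simp [h.curl_EL t ht, h.gauss t ht]

lemma IsClassicalSolution.integral_cross_EL (h : IsClassicalSolution T f EL ET B) {t : ℝ}
    (ht : t ∈ Ico 0 T) {g : E3 → ℝ} (hg : IsTest g) (i : Fin 3) :
    (∫ y, EL t y (i + 1) * pd (i + 2) g y) - ∫ y, EL t y (i + 2) * pd (i + 1) g y = 0 := by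
  have hd := differentiable_coord (h.differentiable_EL ht)
  have hc := continuous_pd_coord (h.differentiable_EL ht) (h.continuous_fderiv_EL ht)
  rw [integral_mul_pd (hd _) (hc _ _) hg, integral_mul_pd (hd _) (hc _ _) hg, sub_eq_zero, neg_inj]
  refine integral_congr_ae (ae_of_all _ fun y => ?_)
  have hcurl := h.curl_EL t ht y
  have e : ∀ k, curl (EL t) y k = 0 := fun k => by rw [hcurl]; rfl
  have e0 := e 0
  have e1 := e 1
  have e2 := e 2
  simp only [← partialD_eq_pd (h.differentiable_EL ht)]
  simp only [curl] at e0 e1 e2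
  simp at e0 e1 e2
  fin_cases i
  · simp; left; linarith
  · simp; left; linarith
  · simp; left; linarith

/-- As `E_L` is only `C¹`, the curl of its time derivative need not exist classically. The weak curl
identity for `E_L` is differentiated in time instead. -/
lemma IsClassicalSolution.integral_cross_timeDeriv_EL (h : IsClassicalSolution T f EL ET B) {t : ℝ}
    (ht : t ∈ Ioo 0 T) {g : E3 → ℝ} (hg : IsTest g) (i : Fin 3) :
    (∫ y, timeDeriv T EL t y (i + 1) * pd (i + 2) g y)
      - ∫ y, timeDeriv T EL t y (i + 2) * pd (i + 1) g y = 0 := by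
  have h1 := (hasDerivAt_integral_field h.contDiffOn_EL ht (hg.pd (i + 2)) (i + 1)).sub
    (hasDerivAt_integral_field h.contDiffOn_EL ht (hg.pd (i + 1)) (i + 2))
  refine HasDerivAt.unique h1 (HasDerivAt.congr_of_eventuallyEq (hasDerivAt_const t (0 : ℝ)) ?_)
  filter_upwards [isOpen_Ioo.mem_nhds ht] with s hs
  exact h.integral_cross_EL ⟨hs.1.le, hs.2⟩ hg i

lemma IsClassicalSolution.currentDensity_eq (h : IsClassicalSolution T f EL ET B) {t : ℝ}
    (ht : t ∈ Ico 0 T) (y : E3) :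
    currentDensity f t y = curl (B t) y - timeDeriv T EL t y := by
  have h1 := h.ampere t ht y
  have h2 : derivWithin (fun s => EL s y) (Ico 0 T) t = timeDeriv T EL t y :=
    derivWithin_slab h.contDiffOn_EL ht y
  rw [h2] at h1
  rw [← neg_neg (currentDensity f t y), ← h1]; abel

/-- By Ampère's law `∇×B` is `j + ∂ₜE_L`, and the second summand drops out because it is weakly curl
free. -/
lemma IsClassicalSolution.integral_B (h : IsClassicalSolution T f EL ET B) {t : ℝ}
    (ht : t ∈ Ioo 0 T) {g : E3 → ℝ} (hg : IsTest g) (i : Fin 3) :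
    ∫ y, B t y i * lap g y = -(∫ y, currentDensity f t y (i + 1) * pd (i + 2) g y)
      + ∫ y, currentDensity f t y (i + 2) * pd (i + 1) g y := by
  have ht' : t ∈ Ico 0 T := ⟨ht.1.le, ht.2⟩
  have hz := h.integral_cross_timeDeriv_EL ht hg i
  have hcB := continuous_curl (h.continuous_fderiv_B ht')
  have hcE : ∀ k, Continuous fun y => timeDeriv T EL t y k := fun k => by
    have := continuous_timeDeriv h.contDiffOn_EL ht'; fun_prop
  have e : ∀ k l, ∫ y, currentDensity f t y k * pd l g y
      = (∫ y, curl (B t) y k * pd l g y) - ∫ y, timeDeriv T EL t y k * pd l g y := by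
    intro k l
    rw [← integral_sub (integrable_mul_test (hcB k) (hg.pd l))
      (integrable_mul_test (hcE k) (hg.pd l))]
    simp only [h.currentDensity_eq ht', PiLp.sub_apply, sub_mul]
  rw [integral_mul_lap (h.differentiable_B ht') (h.continuous_fderiv_B ht') hg, e, e,
    integral_sub (integrable_mul_test (hcB _) (hg.pd _)) (integrable_mul_test (hcB _) (hg.pd _))]
  simp only [h.div_B t ht', zero_mul, integral_zero]
  linarith

/-- The weak form of the equation for `E_T`, given the time derivatives `J n k l` of the integrals
of the current density against second derivatives of the test function. -/
lemma IsClassicalSolution.integral_ET (h : IsClassicalSolution T f EL ET B) {t : ℝ}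
    (ht : t ∈ Ioo 0 T) {g : E3 → ℝ} (hg : IsTest g) (i : Fin 3) {J : Fin 3 → Fin 3 → Fin 3 → ℝ}
    (hJ : ∀ n k l, HasDerivAt (fun s => ∫ y, currentDensity f s y n * pd k (pd l g) y)
      (J n k l) t) :
    ∫ y, ET t y i * lap (lap g) y
      = (-J (i + 1 + 1) (i + 1 + 2) (i + 2) + J (i + 1 + 2) (i + 1 + 1) (i + 2))
        - (-J (i + 2 + 1) (i + 2 + 2) (i + 1) + J (i + 2 + 2) (i + 2 + 1) (i + 1)) := by
  have ht' : t ∈ Ico 0 T := ⟨ht.1.le, ht.2⟩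
  have hc : ∀ y k, curl (ET t) y k = -timeDeriv T B t y k := by
    intro y k
    have h1 := h.faraday t ht' y
    have h2 : derivWithin (fun s => B s y) (Ico 0 T) t = timeDeriv T B t y :=
      derivWithin_slab h.contDiffOn_B ht' y
    rw [h2] at h1
    rw [eq_neg_of_add_eq_zero_right h1]; rfl
  have hcB : ∀ k, Continuous fun y => timeDeriv T B t y k := fun k => by
    have := continuous_timeDeriv h.contDiffOn_B ht'; fun_prop
  have e1 : ∫ y, ET t y i * lap (lap g) y
      = (∫ y, timeDeriv T B t y (i + 1) * pd (i + 2) (lap g) y)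
        - ∫ y, timeDeriv T B t y (i + 2) * pd (i + 1) (lap g) y := by
    rw [integral_mul_lap (h.differentiable_ET t ht') (h.continuous_fderiv_ET ht') hg.lap,
      ← integral_sub (integrable_mul_test (hcB _) (hg.lap.pd _))
        (integrable_mul_test (hcB _) (hg.lap.pd _))]
    simp only [h.div_ET t ht', zero_mul, integral_zero, hc, neg_zero, zero_sub]
    rw [← integral_neg]
    refine integral_congr_ae (ae_of_all _ fun y => ?_)
    simp only
    ring
  -- Faraday's law has replaced `E_T` by `∂ₜB`. The resulting expression is the time derivative of
  -- integrals of `B`, which for all nearby times equal integrals of `j`. Uniqueness of the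
  -- derivative identifies the two.
  have d1 := (hasDerivAt_integral_field h.contDiffOn_B ht (hg.lap.pd (i + 2)) (i + 1)).sub
    (hasDerivAt_integral_field h.contDiffOn_B ht (hg.lap.pd (i + 1)) (i + 2))
  rw [e1]
  refine d1.unique ?_
  refine HasDerivAt.congr_of_eventuallyEq
    (((hJ (i + 1 + 1) (i + 1 + 2) (i + 2)).neg.add (hJ (i + 1 + 2) (i + 1 + 1) (i + 2))).sub
      ((hJ (i + 2 + 1) (i + 2 + 2) (i + 1)).neg.add (hJ (i + 2 + 2) (i + 2 + 1) (i + 1)))) ?_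
  filter_upwards [isOpen_Ioo.mem_nhds ht] with s hs
  simp only [Pi.sub_apply, Pi.add_apply, Pi.neg_apply]
  rw [pd_lap hg.smooth, pd_lap hg.smooth, h.integral_B hs (hg.pd (i + 2)),
    h.integral_B hs (hg.pd (i + 1))]

end Solution

/-! ### Moments of the distribution function -/

lemma continuous_coord {Z : Type*} [TopologicalSpace Z] {u : Z → E3} (hu : Continuous u)
    (k : Fin 3) : Continuous fun z => u z k :=
  (EuclideanSpace.proj k : E3 →L[ℝ] ℝ).continuous.comp hu

lemma continuous_velocity_coord (k : Fin 3) : Continuous fun p => velocity p k :=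
  continuous_coord (contDiff_velocity (n := 0)).continuous k

lemma sum_coord_smul_single (u : E3) :
    ∑ k, u k • (EuclideanSpace.single k 1 : E3) = u := by
  ext i
  fin_cases i <;> simp [Fin.sum_univ_three]

lemma hasCompactSupport_fst_slice {g : E3 → E3 → ℝ}
    (hc : HasCompactSupport fun z : E3 × E3 => g z.1 z.2) (y : E3) :
    HasCompactSupport fun p => g y p := by
  refine HasCompactSupport.intro (hc.image continuous_snd) fun p hp => ?_
  by_contra hne
  exact hp ⟨(y, p), subset_tsupport _ hne, rfl⟩

lemma integral_moment_mul {g : E3 → E3 → ℝ} (hg : Continuous fun z : E3 × E3 => g z.1 z.2)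
    (hc : HasCompactSupport fun z : E3 × E3 => g z.1 z.2) {w k : E3 → ℝ} (hw : Continuous w)
    (hk : Continuous k) :
    ∫ y, (∫ p, g y p * w p) * k y = ∫ z : E3 × E3, g z.1 z.2 * w z.2 * k z.1 := by
  have hcont : Continuous fun z : E3 × E3 => g z.1 z.2 * w z.2 * k z.1 :=
    (hg.mul (hw.comp continuous_snd)).mul (hk.comp continuous_fst)
  have hi : Integrable (fun z : E3 × E3 => g z.1 z.2 * w z.2 * k z.1) (volume.prod volume) :=
    hcont.integrable_of_hasCompactSupport (hc.mul_right.mul_right)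
  rw [Measure.volume_eq_prod, integral_prod _ hi]
  refine integral_congr_ae (ae_of_all _ fun y => ?_)
  exact (integral_mul_const (k y) fun p => g y p * w p).symm

/-- Integration by parts on phase space. -/
lemma integral_fderiv_mul {G : E3 × E3 → ℝ} (hG : Differentiable ℝ G)
    (hG' : Continuous (fderiv ℝ G)) (hc : HasCompactSupport G) {Ψ Ψ' : E3 × E3 → ℝ}
    (hΨ : Continuous Ψ) (hΨ' : Continuous Ψ') {w : E3 × E3}
    (hd : ∀ z, HasLineDerivAt ℝ Ψ (Ψ' z) z w) :
    ∫ z, fderiv ℝ G z w * Ψ z = -∫ z, G z * Ψ' z := by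
  have hGw : Continuous fun z => fderiv ℝ G z w := hG'.clm_apply continuous_const
  have hcw : HasCompactSupport fun z => fderiv ℝ G z w :=
    (hc.fderiv (𝕜 := ℝ)).comp_left (g := fun L : E3 × E3 →L[ℝ] ℝ => L w) rfl
  have i1 : Integrable fun z => fderiv ℝ G z w * Ψ z :=
    (hGw.mul hΨ).integrable_of_hasCompactSupport hcw.mul_right
  have i2 : Integrable fun z => G z * Ψ' z :=
    (hG.continuous.mul hΨ').integrable_of_hasCompactSupport hc.mul_right
  have i3 : Integrable fun z => G z * Ψ z :=
    (hG.continuous.mul hΨ).integrable_of_hasCompactSupport hc.mul_right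
  have : (volume : Measure (E3 × E3)).IsAddHaarMeasure :=
    inferInstanceAs ((volume : Measure E3).prod (volume : Measure E3)).IsAddHaarMeasure
  have := integral_bilinear_hasLineDerivAt_right_eq_neg_left_of_integrable
    (B := ContinuousLinearMap.mul ℝ ℝ) (f := G) (f' := fun z => fderiv ℝ G z w) (g := Ψ) (g' := Ψ')
    (v := w) (μ := volume) i1 i2 i3 (fun z _ => (hG z).hasFDerivAt.hasLineDerivAt w) fun z _ => hd z
  simp only [ContinuousLinearMap.mul_apply'] at this
  linarith

lemma hasLineDerivAt_fst {k : E3 → ℝ} (hk : Differentiable ℝ k) (z : E3 × E3) (u : E3) :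
    HasLineDerivAt ℝ (fun z : E3 × E3 => k z.1) (fderiv ℝ k z.1 u) z (u, 0) := by
  have h1 := ((hk z.1).hasFDerivAt.comp z hasFDerivAt_fst).hasLineDerivAt (u, 0)
  exact h1

lemma hasLineDerivAt_snd {k : E3 → ℝ} (hk : Differentiable ℝ k) (z : E3 × E3) (u : E3) :
    HasLineDerivAt ℝ (fun z : E3 × E3 => k z.2) (fderiv ℝ k z.2 u) z (0, u) := by
  have h1 := ((hk z.2).hasFDerivAt.comp z hasFDerivAt_snd).hasLineDerivAt (0, u)
  exact h1

lemma cross_coord (u w : E3) (k : Fin 3) :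
    cross u w k = u (k + 1) * w (k + 2) - u (k + 2) * w (k + 1) := by
  fin_cases k <;> simp [cross, cross_apply]

lemma fderiv_velocity_coord (p u : E3) (k : Fin 3) :
    fderiv ℝ (fun q => velocity q k) p u = fderiv ℝ velocity p u k := by
  have h := (contDiff_velocity (n := 1)).differentiable (by simp) p
  rw [(hasFDerivAt_comp_coord h.hasFDerivAt k).fderiv]; rfl

lemma differentiable_velocity_coord (k : Fin 3) : Differentiable ℝ fun q => velocity q k :=
  differentiable_coord ((contDiff_velocity (n := 1)).differentiable (by simp)) k

lemma continuous_fderiv_velocity : Continuous (fderiv ℝ velocity) :=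
  (contDiff_velocity (n := 1)).continuous_fderiv (by simp)

section Solution

variable {T : ℝ} {f : ℝ → E3 → E3 → ℝ} {EL ET B : ℝ → E3 → E3}

lemma IsClassicalSolution.differentiable_f (h : IsClassicalSolution T f EL ET B) {t : ℝ}
    (ht : t ∈ Ico 0 T) : Differentiable ℝ fun z : E3 × E3 => f t z.1 z.2 :=
  differentiable_slab (G := spaceTime f) h.contDiffOn_f ht

lemma IsClassicalSolution.continuous_fderiv_f (h : IsClassicalSolution T f EL ET B) {t : ℝ}
    (ht : t ∈ Ico 0 T) : Continuous (fderiv ℝ fun z : E3 × E3 => f t z.1 z.2) :=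
  continuous_fderiv_slab (G := spaceTime f) h.contDiffOn_f ht

lemma IsClassicalSolution.chargeDensity_mul (h : IsClassicalSolution T f EL ET B) {t : ℝ}
    (ht : t ∈ Ico 0 T) {k : E3 → ℝ} (hk : Continuous k) :
    ∫ y, chargeDensity f t y * k y = ∫ z : E3 × E3, f t z.1 z.2 * 1 * k z.1 := by
  rw [← integral_moment_mul (h.differentiable_f ht).continuous (h.compact_f t ht)
    (w := fun _ => 1) continuous_const hk]
  simp [chargeDensity]

lemma IsClassicalSolution.currentDensity_mul (h : IsClassicalSolution T f EL ET B) {t : ℝ}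
    (ht : t ∈ Ico 0 T) (n : Fin 3) {k : E3 → ℝ} (hk : Continuous k) :
    ∫ y, currentDensity f t y n * k y
      = ∫ z : E3 × E3, f t z.1 z.2 * velocity z.2 n * k z.1 := by
  rw [← integral_moment_mul (h.differentiable_f ht).continuous (h.compact_f t ht)
    (w := fun p => velocity p n) (continuous_velocity_coord n) hk]
  refine integral_congr_ae (ae_of_all _ fun y => ?_)
  have hcont : Continuous fun p => f t y p • velocity p := by
    have h1 : Continuous fun p => f t y p :=
      (h.differentiable_f ht).continuous.comp (by fun_prop : Continuous fun p : E3 => (y, p))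
    exact h1.smul (contDiff_velocity (n := 0)).continuous
  have hi : Integrable fun p => f t y p • velocity p :=
    hcont.integrable_of_hasCompactSupport
      (hasCompactSupport_fst_slice (h.compact_f t ht) y).smul_right
  have : ∫ p, f t y p * velocity p n = (∫ p, f t y p • velocity p) n :=
    (EuclideanSpace.proj n : E3 →L[ℝ] ℝ).integral_comp_comm hi
  simp only [currentDensity, this]

lemma IsClassicalSolution.continuous_force_slice (h : IsClassicalSolution T f EL ET B) {t : ℝ}
    (ht : t ∈ Ico 0 T) : Continuous fun z : E3 × E3 => force EL ET B t z.1 z.2 :=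
  h.continuous_force.comp_continuous (f := fun z : E3 × E3 => (t, z)) (by fun_prop)
    fun z => ⟨ht, mem_univ _⟩

/-- The derivative of the `k`-th component of the force in the `k`-th momentum direction. -/
def forceDiag (B : ℝ → E3 → E3) (t : ℝ) (k : Fin 3) (z : E3 × E3) : ℝ :=
  fderiv ℝ velocity z.2 (EuclideanSpace.single k 1) (k + 1) * B t z.1 (k + 2)
    - fderiv ℝ velocity z.2 (EuclideanSpace.single k 1) (k + 2) * B t z.1 (k + 1)

/-- The force is divergence free in `p`: the electric fields do not depend on `p`, and the magnetic
terms cancel in pairs by the symmetry of the Jacobian of `v`. -/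
lemma sum_forceDiag (B : ℝ → E3 → E3) (t : ℝ) (z : E3 × E3) : ∑ k, forceDiag B t k z = 0 := by
  have s := fderiv_velocity_symm z.2
  simp only [forceDiag, Fin.sum_univ_three]
  have e1 : (1 : Fin 3) + 1 = 2 := rfl
  have e2 : (1 : Fin 3) + 2 = 0 := rfl
  have e3 : (2 : Fin 3) + 1 = 0 := rfl
  have e4 : (2 : Fin 3) + 2 = 1 := rfl
  simp only [zero_add, e1, e2, e3, e4]
  rw [s 1 0, s 2 0, s 2 1]
  ring

lemma hasLineDerivAt_force (t : ℝ) (k : Fin 3) (z : E3 × E3) :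
    HasLineDerivAt ℝ (fun z : E3 × E3 => force EL ET B t z.1 z.2 k) (forceDiag B t k z) z
      (0, EuclideanSpace.single k 1) := by
  have hv : ∀ m, HasDerivAt
      (fun s : ℝ => velocity (z.2 + s • (EuclideanSpace.single k 1 : E3)) m)
      (fderiv ℝ velocity z.2 (EuclideanSpace.single k 1) m) 0 := by
    intro m
    have := (differentiable_velocity_coord m z.2).hasFDerivAt.hasLineDerivAt
      (EuclideanSpace.single k 1)
    rw [fderiv_velocity_coord] at this
    exact this
  have h1 := (((hv (k + 1)).mul_const (B t z.1 (k + 2))).sub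
    ((hv (k + 2)).mul_const (B t z.1 (k + 1)))).const_add (EL t z.1 k + ET t z.1 k)
  unfold HasLineDerivAt
  refine HasDerivAt.congr_of_eventuallyEq h1 (Eventually.of_forall fun s => ?_)
  simp only [force, PiLp.add_apply, cross_coord, Prod.fst_add, Prod.snd_add, Prod.smul_fst,
    Prod.smul_snd, smul_zero, add_zero, Pi.sub_apply]

/-- The weak form of the Vlasov equation, tested with `v_n(p) k(x)`. -/
lemma IsClassicalSolution.hasDerivAt_currentDensity (h : IsClassicalSolution T f EL ET B)
    {a : ℝ} (ha : a < T) {S : Set (E3 × E3)} (hS : IsCompact S)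
    (hfS : ∀ s ∈ Ioo 0 a, ∀ z ∉ S, f s z.1 z.2 = 0) {t : ℝ} (ht : t ∈ Ioo 0 a) (n : Fin 3)
    {k : E3 → ℝ} (hk : IsTest k) :
    HasDerivAt (fun s => ∫ y, currentDensity f s y n * k y)
      ((∑ l, ∫ z : E3 × E3, f t z.1 z.2 * (velocity z.2 l * velocity z.2 n) * pd l k z.1)
        + ∫ z : E3 × E3, f t z.1 z.2 * (fderiv ℝ velocity z.2 (force EL ET B t z.1 z.2) n * k z.1))
      t := by
  have hsub : ∀ s ∈ Ioo 0 a, s ∈ Ioo 0 T := fun s hs => ⟨hs.1, hs.2.trans ha⟩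
  have hIco : ∀ s ∈ Ioo 0 a, s ∈ Ico 0 T := fun s hs => ⟨hs.1.le, hs.2.trans ha⟩
  have hvc := continuous_velocity_coord
  have hkc := hk.continuous
  have hΦ : Continuous fun z : E3 × E3 => velocity z.2 n * k z.1 :=
    ((hvc n).comp continuous_snd).mul (hkc.comp continuous_fst)
  set G : E3 × E3 → ℝ := fun z => f t z.1 z.2 with hG
  have hGd : Differentiable ℝ G := h.differentiable_f (hIco t ht)
  have hGc : Continuous (fderiv ℝ G) := h.continuous_fderiv_f (hIco t ht)
  have hGs : HasCompactSupport G := h.compact_f t (hIco t ht)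
  have hKc : ∀ l, Continuous fun z : E3 × E3 => force EL ET B t z.1 z.2 l := fun l =>
    continuous_coord (h.continuous_force_slice (hIco t ht)) l
  have hdv : ∀ l m, Continuous fun z : E3 × E3 =>
      fderiv ℝ velocity z.2 (EuclideanSpace.single l 1) m := fun l m =>
    continuous_coord ((continuous_fderiv_velocity.comp continuous_snd).clm_apply
      continuous_const) m
  have hBc : ∀ m, Continuous fun z : E3 × E3 => B t z.1 m := fun m =>
    continuous_coord ((h.differentiable_B (hIco t ht)).continuous.comp continuous_fst) m
  have hdiag : ∀ l, Continuous (forceDiag B t l) := fun l =>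
    Continuous.sub (f := fun z : E3 × E3 =>
        fderiv ℝ velocity z.2 (EuclideanSpace.single l 1) (l + 1) * B t z.1 (l + 2))
      (g := fun z : E3 × E3 =>
        fderiv ℝ velocity z.2 (EuclideanSpace.single l 1) (l + 2) * B t z.1 (l + 1))
      ((hdv l _).mul (hBc _)) ((hdv l _).mul (hBc _))
  have hcx : ∀ l, Continuous fun z : E3 × E3 =>
      velocity z.2 l * (velocity z.2 n * pd l k z.1) := fun l =>
    ((hvc l).comp continuous_snd).mul (((hvc n).comp continuous_snd).mul
      ((hk.pd l).continuous.comp continuous_fst))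
  have hcp : ∀ l, Continuous fun z : E3 × E3 => forceDiag B t l z * (velocity z.2 n * k z.1)
      + force EL ET B t z.1 z.2 l
        * (fderiv ℝ velocity z.2 (EuclideanSpace.single l 1) n * k z.1) := fun l =>
    ((hdiag l).mul hΦ).add ((hKc l).mul ((hdv l n).mul (hkc.comp continuous_fst)))
  have hder := hasDerivAt_integral_of_compact (μ := (volume : Measure (E3 × E3)))
    (U := fun s z => f s z.1 z.2 * (velocity z.2 n * k z.1))
    (U' := fun s z => slabDeriv T (spaceTime f) (s, z) (1, 0) * (velocity z.2 n * k z.1))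
    ht hS (fun s hs => (h.differentiable_f (hIco s hs)).continuous.mul hΦ)
    (((((continuousOn_slabDeriv (G := spaceTime f) h.contDiffOn_f).clm_apply
      continuousOn_const).mono (prod_mono hIco (subset_refl _)))).mul
        (hΦ.comp continuous_snd).continuousOn)
    (fun s hs z => (hasDerivAt_slab (G := spaceTime f) h.contDiffOn_f (hsub s hs) z).mul_const _)
    (fun s hs z hz => by simp only [hfS s hs z hz, zero_mul])
  refine (hder.congr_of_eventuallyEq ?_).congr_deriv ?_
  · filter_upwards [isOpen_Ioo.mem_nhds ht] with s hs
    rw [h.currentDensity_mul (hIco s hs) n hkc]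
    simp only [mul_assoc]
  -- The Vlasov equation expresses `∂ₜf` through the phase space derivatives of `f`, split into
  -- coordinate directions for the integrations by parts below.
  · have hsplit : ∀ z : E3 × E3, slabDeriv T (spaceTime f) (t, z) (1, 0)
        = -∑ l, (fderiv ℝ G z (EuclideanSpace.single l 1, 0) * velocity z.2 l
          + fderiv ℝ G z (0, EuclideanSpace.single l 1) * force EL ET B t z.1 z.2 l) := by
      intro z
      have h1 := h.slabDeriv_vlasov (hIco t ht) z.1 z.2
      have h2 : fderiv ℝ G z = (slabDeriv T (spaceTime f) (t, z)).comp
          (ContinuousLinearMap.inr ℝ ℝ (E3 × E3)) :=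
        (hasFDerivAt_slab (G := spaceTime f) h.contDiffOn_f (hIco t ht) z).fderiv
      have h3 : ((1 : ℝ), velocity z.2, force EL ET B t z.1 z.2)
          = ((1 : ℝ), (0 : E3 × E3)) + ContinuousLinearMap.inr ℝ ℝ (E3 × E3)
            (velocity z.2, force EL ET B t z.1 z.2) := by simp
      rw [h3, map_add, ← ContinuousLinearMap.comp_apply, ← h2] at h1
      rw [eq_neg_of_add_eq_zero_left h1, neg_inj]
      have h4 : (velocity z.2, force EL ET B t z.1 z.2)
          = ∑ l, (velocity z.2 l • ((EuclideanSpace.single l 1 : E3), (0 : E3))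
            + force EL ET B t z.1 z.2 l • ((0 : E3), (EuclideanSpace.single l 1 : E3))) := by
        rw [Finset.sum_add_distrib]
        refine Prod.ext ?_ ?_
        · simp only [Prod.fst_add, Prod.fst_sum, Prod.smul_fst, smul_zero, Finset.sum_const_zero,
            add_zero, sum_coord_smul_single]
        · simp only [Prod.snd_add, Prod.snd_sum, Prod.smul_snd, smul_zero, Finset.sum_const_zero,
            zero_add, sum_coord_smul_single]
      rw [h4, map_sum]
      refine Finset.sum_congr rfl fun l _ => ?_
      rw [map_add, map_smul, map_smul, smul_eq_mul, smul_eq_mul]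
      ring
    have px : ∀ l, ∫ z, fderiv ℝ G z (EuclideanSpace.single l 1, 0)
          * (velocity z.2 l * (velocity z.2 n * k z.1))
        = -∫ z : E3 × E3, G z * (velocity z.2 l * (velocity z.2 n * pd l k z.1)) := by
      intro l
      refine integral_fderiv_mul hGd hGc hGs (((hvc l).comp continuous_snd).mul hΦ)
        (hcx l) fun z => ?_
      have h1 := hasLineDerivAt_fst hk.smooth.differentiable z (EuclideanSpace.single l 1)
      have h2 := HasDerivAt.const_mul (velocity z.2 l * velocity z.2 n) h1
      unfold HasLineDerivAt
      refine (h2.congr_of_eventuallyEq (Eventually.of_forall fun s => ?_)).congr_deriv ?_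
      · simp; ring
      · simp only [pd]; ring
    have pp : ∀ l, ∫ z, fderiv ℝ G z (0, EuclideanSpace.single l 1)
          * (force EL ET B t z.1 z.2 l * (velocity z.2 n * k z.1))
        = -∫ z : E3 × E3, G z * (forceDiag B t l z * (velocity z.2 n * k z.1)
          + force EL ET B t z.1 z.2 l
            * (fderiv ℝ velocity z.2 (EuclideanSpace.single l 1) n * k z.1)) := by
      intro l
      refine integral_fderiv_mul hGd hGc hGs ((hKc l).mul hΦ)
        (hcp l) fun z => ?_
      have h1 := hasLineDerivAt_force (EL := EL) (ET := ET) (B := B) t l z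
      have h2 := hasLineDerivAt_snd (differentiable_velocity_coord n) z (EuclideanSpace.single l 1)
      rw [fderiv_velocity_coord] at h2
      have h3 := HasDerivAt.mul h1 (HasDerivAt.mul_const h2 (k z.1))
      unfold HasLineDerivAt
      refine (h3.congr_of_eventuallyEq (Eventually.of_forall fun s => ?_)).congr_deriv ?_
      · simp
      · simp
    have hcw : ∀ w, HasCompactSupport fun z => fderiv ℝ G z w := fun w =>
      (hGs.fderiv (𝕜 := ℝ)).comp_left (g := fun L : E3 × E3 →L[ℝ] ℝ => L w) rfl
    have ix : ∀ l, Integrable fun z : E3 × E3 => fderiv ℝ G z (EuclideanSpace.single l 1, 0)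
          * (velocity z.2 l * (velocity z.2 n * k z.1)) := fun l =>
      ((hGc.clm_apply continuous_const).mul
        (((hvc l).comp continuous_snd).mul hΦ)).integrable_of_hasCompactSupport (hcw _).mul_right
    have ip : ∀ l, Integrable fun z : E3 × E3 => fderiv ℝ G z (0, EuclideanSpace.single l 1)
          * (force EL ET B t z.1 z.2 l * (velocity z.2 n * k z.1)) := fun l =>
      ((hGc.clm_apply continuous_const).mul
        ((hKc l).mul hΦ)).integrable_of_hasCompactSupport (hcw _).mul_right
    have jp : ∀ l, Integrable fun z : E3 × E3 =>
        G z * (forceDiag B t l z * (velocity z.2 n * k z.1) + force EL ET B t z.1 z.2 l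
            * (fderiv ℝ velocity z.2 (EuclideanSpace.single l 1) n * k z.1)) := fun l =>
      (hGd.continuous.mul (hcp l)).integrable_of_hasCompactSupport hGs.mul_right
    have e1 : ∫ z, slabDeriv T (spaceTime f) (t, z) (1, 0) * (velocity z.2 n * k z.1)
        = -∑ l, ((∫ z, fderiv ℝ G z (EuclideanSpace.single l 1, 0)
          * (velocity z.2 l * (velocity z.2 n * k z.1)))
          + ∫ z, fderiv ℝ G z (0, EuclideanSpace.single l 1)
          * (force EL ET B t z.1 z.2 l * (velocity z.2 n * k z.1))) := by
      simp only [← integral_add (ix _) (ip _)]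
      have ia : ∀ l ∈ Finset.univ, Integrable fun z : E3 × E3 =>
          fderiv ℝ G z (EuclideanSpace.single l 1, 0)
            * (velocity z.2 l * (velocity z.2 n * k z.1))
          + fderiv ℝ G z (0, EuclideanSpace.single l 1)
            * (force EL ET B t z.1 z.2 l * (velocity z.2 n * k z.1)) :=
        fun l _ => (ix l).add (ip l)
      rw [← integral_finsetSum _ ia, ← integral_neg]
      refine integral_congr_ae (ae_of_all _ fun z => ?_)
      simp only [hsplit, neg_mul, Finset.sum_mul]
      congr 1
      refine Finset.sum_congr rfl fun l _ => ?_
      ring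
    rw [e1]
    simp only [px, pp]
    rw [Finset.sum_add_distrib, Finset.sum_neg_distrib, Finset.sum_neg_distrib, neg_add, neg_neg,
      neg_neg, ← integral_finsetSum _ fun l _ => jp l]
    congr 1
    · refine Finset.sum_congr rfl fun l _ => ?_
      refine integral_congr_ae (ae_of_all _ fun z => ?_)
      simp only [hG]; ring
    · refine integral_congr_ae (ae_of_all _ fun z => ?_)
      simp only [hG]
      -- The divergence of the force vanishes, so the momentum derivative acts only on the weight
      -- `v_n(p)`.
      rw [← Finset.mul_sum, Finset.sum_add_distrib, ← Finset.sum_mul, sum_forceDiag, zero_mul,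
        zero_add]
      congr 1
      have h5 : fderiv ℝ velocity z.2 (force EL ET B t z.1 z.2) n
          = ∑ l, force EL ET B t z.1 z.2 l
            * fderiv ℝ velocity z.2 (EuclideanSpace.single l 1) n := by
        conv_lhs => rw [← sum_coord_smul_single (force EL ET B t z.1 z.2)]
        simp [Fin.sum_univ_three]
      rw [h5, Finset.sum_mul]
      exact Finset.sum_congr rfl fun l _ => by ring

end Solution

/-! ### Integrals of power kernels -/

/-- The volume of the unit ball. -/
def ballVol : ℝ := volume.real (Metric.ball (0 : E3) 1)

lemma ballVol_nonneg : 0 ≤ ballVol := measureReal_nonneg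

/-- The kernel `|y - x|^(-β)` cut off at distance `L`. -/
def nearKernel (β L : ℝ) (x y : E3) : ℝ := (Iio L).indicator (fun r => r ^ (-β)) ‖y - x‖

lemma nearKernel_of_lt {β L : ℝ} {x y : E3} (h : ‖y - x‖ < L) :
    nearKernel β L x y = ‖y - x‖ ^ (-β) := indicator_of_mem (s := Iio L) h _

lemma nearKernel_nonneg (β L : ℝ) (x y : E3) : 0 ≤ nearKernel β L x y :=
  indicator_apply_nonneg fun _ => Real.rpow_nonneg (norm_nonneg _) _

lemma sq_smul_indicator_eq {β L : ℝ} :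
    EqOn (fun r : ℝ => r ^ (Module.finrank ℝ E3 - 1) • (Iio L).indicator (fun r => r ^ (-β)) r)
      ((Ioc 0 L).indicator fun r => (Iio L).indicator (fun r => r ^ (2 - β)) r) (Ioi 0) := by
  intro r hr
  have hr0 : (0 : ℝ) < r := hr
  simp only [finrank_euclideanSpace, Fintype.card_fin, smul_eq_mul]
  by_cases h : r < L
  · rw [indicator_of_mem (s := Iio L) h, indicator_of_mem (s := Ioc 0 L) ⟨hr0, h.le⟩,
      indicator_of_mem (s := Iio L) h, sub_eq_add_neg, Real.rpow_add hr0]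
    norm_num
  · rw [indicator_of_notMem (s := Iio L) h]
    by_cases h' : r ∈ Ioc 0 L
    · rw [indicator_of_mem h', indicator_of_notMem (s := Iio L) h, mul_zero]
    · rw [indicator_of_notMem h', mul_zero]

lemma integrable_nearKernel {β L : ℝ} (hβ : β < 3) (hL : 0 ≤ L) (x : E3) :
    Integrable (nearKernel β L x) := by
  have h0 : Integrable fun z : E3 => (Iio L).indicator (fun r : ℝ => r ^ (-β)) ‖z‖ := by
    rw [integrable_fun_norm_addHaar volume (f := (Iio L).indicator fun r : ℝ => r ^ (-β)),
      integrableOn_congr_fun sq_smul_indicator_eq measurableSet_Ioi]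
    refine Integrable.integrableOn ?_
    rw [integrable_indicator_iff measurableSet_Ioc]
    refine Integrable.indicator ?_ measurableSet_Iio
    have := intervalIntegral.intervalIntegrable_rpow' (a := 0) (b := L) (r := 2 - β) (by linarith)
    rwa [intervalIntegrable_iff_integrableOn_Ioc_of_le hL] at this
  exact h0.comp_sub_right x

lemma integral_nearKernel {β L : ℝ} (hβ : β < 3) (hL : 0 ≤ L) (x : E3) :
    ∫ y, nearKernel β L x y = 3 * ballVol / (3 - β) * L ^ (3 - β) := by
  have h1 : ∫ y, nearKernel β L x y
      = ∫ z : E3, (Iio L).indicator (fun r : ℝ => r ^ (-β)) ‖z‖ :=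
    integral_sub_right_eq_self (fun z : E3 => (Iio L).indicator (fun r : ℝ => r ^ (-β)) ‖z‖) x
  rw [h1, integral_fun_norm_addHaar volume ((Iio L).indicator fun r : ℝ => r ^ (-β)),
    setIntegral_congr_fun measurableSet_Ioi sq_smul_indicator_eq]
  have h2 : ∫ r in Ioi (0 : ℝ), (Ioc 0 L).indicator
      (fun r => (Iio L).indicator (fun r => r ^ (2 - β)) r) r = ∫ r in (0 : ℝ)..L, r ^ (2 - β) := by
    rw [intervalIntegral.integral_of_le hL, setIntegral_indicator measurableSet_Ioc,
      inter_eq_self_of_subset_right Ioc_subset_Ioi_self]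
    refine integral_congr_ae ?_
    filter_upwards [ae_restrict_mem measurableSet_Ioc, ae_restrict_of_ae (Measure.ae_ne volume L)]
      with r hr hrL
    exact indicator_of_mem (s := Iio L) (lt_of_le_of_ne hr.2 hrL) _
  rw [h2, integral_rpow (Or.inl (by linarith)), Real.zero_rpow (by linarith)]
  simp only [finrank_euclideanSpace, Fintype.card_fin, nsmul_eq_mul, smul_eq_mul, ballVol]
  rw [show 2 - β + 1 = 3 - β by ring]
  push_cast
  ring

/-- A majorant of `|y - x|^(-β)` on the ball of radius `L` around the origin. -/
def ballKernel (β L : ℝ) (x y : E3) : ℝ :=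
  nearKernel β L x y + (Metric.closedBall (0 : E3) L).indicator (fun _ => L ^ (-β)) y

/-- The constant in the bound for the integral of `ballKernel`. -/
def ballConst (β : ℝ) : ℝ := 3 * ballVol / (3 - β) + ballVol

lemma ballConst_nonneg {β : ℝ} (hβ : β < 3) : 0 ≤ ballConst β :=
  add_nonneg (div_nonneg (mul_nonneg (by norm_num) ballVol_nonneg) (by linarith)) ballVol_nonneg

/-- Points within distance `L` of `x` are covered by the near part, and at other points of the ball
the power is at most `L^(-β)`. The integral of this majorant does not depend on `x`. -/
lemma le_ballKernel {β L : ℝ} (hβ : 0 ≤ β) (hL : 0 < L) {x y : E3} (hy : ‖y‖ ≤ L) :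
    ‖y - x‖ ^ (-β) ≤ ballKernel β L x y := by
  unfold ballKernel
  rw [indicator_of_mem (by simpa using hy)]
  by_cases h : ‖y - x‖ < L
  · rw [nearKernel_of_lt h]
    have := Real.rpow_nonneg hL.le (-β)
    linarith
  · have h1 := Real.rpow_le_rpow_of_nonpos hL (not_lt.1 h) (by linarith : -β ≤ 0)
    have h2 := nearKernel_nonneg β L x y
    linarith

lemma ballKernel_nonneg (β : ℝ) {L : ℝ} (hL : 0 < L) (x y : E3) : 0 ≤ ballKernel β L x y :=
  add_nonneg (nearKernel_nonneg _ _ _ _)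
    (indicator_apply_nonneg fun _ => Real.rpow_nonneg hL.le _)

lemma integrable_ballKernel {β L : ℝ} (hβ : β < 3) (hL : 0 ≤ L) (x : E3) :
    Integrable (ballKernel β L x) :=
  (integrable_nearKernel hβ hL x).add ((integrable_indicator_iff measurableSet_closedBall).2
    (integrableOn_const measure_closedBall_lt_top.ne))

lemma integral_ballKernel {β L : ℝ} (hβ : β < 3) (hL : 0 < L) (x : E3) :
    ∫ y, ballKernel β L x y = ballConst β * L ^ (3 - β) := by
  unfold ballKernel
  rw [integral_add (integrable_nearKernel hβ hL.le x)
    ((integrable_indicator_iff measurableSet_closedBall).2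
      (integrableOn_const measure_closedBall_lt_top.ne)), integral_nearKernel hβ hL.le,
    integral_indicator measurableSet_closedBall, setIntegral_const,
    Measure.addHaar_real_closedBall volume _ hL.le]
  simp only [finrank_euclideanSpace, Fintype.card_fin, smul_eq_mul]
  rw [ballConst, add_mul, sub_eq_add_neg, Real.rpow_add hL, ballVol]
  norm_num
  ring

/-! ### Estimates for moments of the distribution function -/

section Density

variable {R₀ P₀ t : ℝ} {g : E3 → E3 → ℝ}

lemma dispersion_nonneg (hR₀ : 0 < R₀) : 0 ≤ dispersion R₀ P₀ :=
  div_nonneg (by linarith) (monoConst_pos _).le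

/-- The constant in the decay of momentum integrals. -/
def momentConst (R₀ P₀ : ℝ) : ℝ := ballVol * dispersion R₀ P₀ ^ 3

lemma momentConst_nonneg (hR₀ : 0 < R₀) : 0 ≤ momentConst R₀ P₀ :=
  mul_nonneg ballVol_nonneg (pow_nonneg (dispersion_nonneg hR₀) 3)

/-- If the integrand is nonzero at some `q`, its support lies in the ball around `q` of radius
`dispersion R₀ P₀ / t`, whose volume is of order `t⁻³`. -/
lemma DensityBounds.abs_integral_le (h : DensityBounds R₀ P₀ t g) (hR₀ : 0 < R₀) (ht : 0 < t)
    {u : E3 → ℝ} {A : ℝ} (hA : 0 ≤ A) (y : E3) (hu : ∀ p, |u p| ≤ A)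
    (hs : ∀ p, u p ≠ 0 → g y p ≠ 0) :
    |∫ p, u p| ≤ A * (momentConst R₀ P₀ * t ^ (-3 : ℝ)) := by
  have hD : 0 ≤ dispersion R₀ P₀ := dispersion_nonneg hR₀
  have ht3 : 0 < t ^ (-3 : ℝ) := Real.rpow_pos_of_pos ht _
  have hM := momentConst_nonneg (P₀ := P₀) hR₀
  by_cases hz : ∃ p, u p ≠ 0
  · obtain ⟨q, hq⟩ := hz
    set S := Metric.closedBall q (dispersion R₀ P₀ / t) with hS
    have hsup : ∀ p ∉ S, u p = 0 := by
      intro p hp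
      by_contra hne
      apply hp
      rw [hS, Metric.mem_closedBall, dist_eq_norm, le_div_iff₀ ht, mul_comm]
      exact h.mom_sub_le (hs p hne) (hs q hq)
    rw [← setIntegral_eq_integral_of_forall_compl_eq_zero hsup, ← Real.norm_eq_abs]
    refine (norm_setIntegral_le_of_norm_le_const (C := A) measure_closedBall_lt_top
      fun p _ => hu p).trans (le_of_eq ?_)
    rw [Measure.addHaar_real_closedBall volume _ (by positivity), Real.rpow_neg ht.le,
      momentConst, ballVol, show (3 : ℝ) = ((3 : ℕ) : ℝ) by norm_num, Real.rpow_natCast]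
    simp only [finrank_euclideanSpace, Fintype.card_fin]
    rw [div_pow]
    ring
  · push Not at hz
    simp only [hz, integral_zero, abs_zero]
    positivity

/-- The `p`-integral is done first and costs `t⁻³`. The majorant is needed only on the spatial
support `|y| ≤ R₀ + t`, and the singular point `x` has measure zero. -/
lemma DensityBounds.abs_integral_mul_le (h : DensityBounds R₀ P₀ t g) (hR₀ : 0 < R₀) (ht : 0 < t)
    {u : E3 × E3 → ℝ} (huc : Continuous u) (hus : HasCompactSupport u) {A : ℝ} (hA : 0 ≤ A)
    (hu : ∀ z, |u z| ≤ A) (hs : ∀ z, u z ≠ 0 → g z.1 z.2 ≠ 0) {k b : E3 → ℝ} (hk : Continuous k)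
    (hb : Integrable b) (hb0 : ∀ y, 0 ≤ b y) {x : E3}
    (hkb : ∀ y, y ≠ x → ‖y‖ ≤ R₀ + t → |k y| ≤ b y) :
    |∫ z, u z * k z.1| ≤ A * (momentConst R₀ P₀ * t ^ (-3 : ℝ)) * ∫ y, b y := by
  have hi : Integrable (fun z : E3 × E3 => u z * k z.1) (volume.prod volume) :=
    (huc.mul (hk.comp continuous_fst)).integrable_of_hasCompactSupport hus.mul_right
  have hM := momentConst_nonneg (P₀ := P₀) hR₀
  have hA' : 0 ≤ A * (momentConst R₀ P₀ * t ^ (-3 : ℝ)) := by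
    have := Real.rpow_pos_of_pos ht (-3)
    positivity
  rw [Measure.volume_eq_prod, integral_prod _ hi, ← integral_const_mul, ← Real.norm_eq_abs]
  refine norm_integral_le_of_norm_le (hb.const_mul _) ?_
  filter_upwards [Measure.ae_ne volume x] with y hy
  rw [integral_mul_const, Real.norm_eq_abs, abs_mul]
  by_cases hyL : ‖y‖ ≤ R₀ + t
  · exact mul_le_mul (h.abs_integral_le hR₀ ht hA y (fun p => hu (y, p)) fun p hp => hs (y, p) hp)
      (hkb y hy hyL) (abs_nonneg _) hA'
  · have : ∀ p, u (y, p) = 0 := fun p => by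
      by_contra hne
      exact hyL (h.pos_le (hs (y, p) hne))
    simp only [this, integral_zero, abs_zero, zero_mul]
    exact mul_nonneg hA' (hb0 y)

/-- The factor `t⁻³` from the momenta meets `(R₀ + t)^(3 - β)` from the spatial integral. For `t ≥
1/2` one has `R₀ + t ≤ (2R₀ + 1) t`. -/
lemma DensityBounds.abs_integral_mul_le_rpow (h : DensityBounds R₀ P₀ t g) (hR₀ : 0 < R₀)
    (ht : 1 / 2 ≤ t) {u : E3 × E3 → ℝ} (huc : Continuous u) (hus : HasCompactSupport u) {A : ℝ}
    (hA : 0 ≤ A) (hu : ∀ z, |u z| ≤ A) (hs : ∀ z, u z ≠ 0 → g z.1 z.2 ≠ 0) {k : E3 → ℝ}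
    (hk : Continuous k) {x : E3} {C β : ℝ} (hC : 0 ≤ C) (hβ0 : 0 ≤ β) (hβ : β < 3)
    (hkb : ∀ y, y ≠ x → |k y| ≤ C * ‖y - x‖ ^ (-β)) :
    |∫ z, u z * k z.1|
      ≤ A * (momentConst R₀ P₀ * C * ballConst β * (2 * R₀ + 1) ^ (3 - β)) * t ^ (-β) := by
  have ht0 : 0 < t := by linarith
  have hL : 0 < R₀ + t := by linarith
  have hM := momentConst_nonneg (P₀ := P₀) hR₀
  have hc := ballConst_nonneg hβ
  refine (h.abs_integral_mul_le hR₀ ht0 huc hus hA hu hs hk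
    ((integrable_ballKernel hβ hL.le x).const_mul C)
    (fun y => mul_nonneg hC (ballKernel_nonneg β hL x y))
    fun y hy hyL => (hkb y hy).trans (mul_le_mul_of_nonneg_left (le_ballKernel hβ0 hL hyL) hC)).trans
    ?_
  rw [integral_const_mul, integral_ballKernel hβ hL]
  have h1 : (R₀ + t) ^ (3 - β) ≤ (2 * R₀ + 1) ^ (3 - β) * t ^ (3 - β) := by
    rw [← Real.mul_rpow (by linarith) ht0.le]
    exact Real.rpow_le_rpow hL.le (by nlinarith) (by linarith)
  have h2 : t ^ (-3 : ℝ) * t ^ (3 - β) = t ^ (-β) := by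
    rw [← Real.rpow_add ht0]; congr 1; ring
  have h3 : 0 < t ^ (-3 : ℝ) := Real.rpow_pos_of_pos ht0 _
  calc A * (momentConst R₀ P₀ * t ^ (-3 : ℝ)) * (C * (ballConst β * (R₀ + t) ^ (3 - β)))
      ≤ A * (momentConst R₀ P₀ * t ^ (-3 : ℝ))
        * (C * (ballConst β * ((2 * R₀ + 1) ^ (3 - β) * t ^ (3 - β)))) := by gcongr
    _ = A * (momentConst R₀ P₀ * C * ballConst β * (2 * R₀ + 1) ^ (3 - β))
        * (t ^ (-3 : ℝ) * t ^ (3 - β)) := by ring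
    _ = _ := by rw [h2]

/-- This weakens a decay exponent by at most `2`. For `t ≥ 1/2` the worst factor is `(1/2)^(-2) =
4`. -/
lemma rpow_neg_le_four_mul {t p q : ℝ} (ht : 1 / 2 ≤ t) (hqp : q ≤ p) (hpq : p ≤ q + 2) :
    t ^ (-p) ≤ 4 * t ^ (-q) := by
  have ht0 : 0 < t := by linarith
  have h1 : t ^ (-p) = t ^ (-(p - q)) * t ^ (-q) := by rw [← Real.rpow_add ht0]; congr 1; ring
  have h2 : t ^ (-(p - q)) ≤ 4 := by
    calc t ^ (-(p - q)) ≤ (1 / 2 : ℝ) ^ (-(p - q)) :=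
          Real.rpow_le_rpow_of_nonpos (by norm_num) ht (by linarith)
      _ = 2 ^ (p - q) := by rw [Real.rpow_neg (by norm_num), ← Real.inv_rpow (by norm_num)]; norm_num
      _ ≤ 2 ^ (2 : ℝ) := Real.rpow_le_rpow_of_exponent_le (by norm_num) (by linarith)
      _ = 4 := by norm_num
  rw [h1]
  exact mul_le_mul_of_nonneg_right h2 (Real.rpow_nonneg ht0.le _)

/-- The second part holds because a zero of the nonnegative `g` is a minimum. Thus the derivative
inherits the momentum localization of `g`, and the `t⁻³` bound applies to it as well. -/
lemma DensityBounds.fderiv_x (h : DensityBounds R₀ P₀ t g)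
    (hd : Differentiable ℝ fun z : E3 × E3 => g z.1 z.2) (z : E3 × E3) (i : Fin 3) :
    |fderiv ℝ (fun z : E3 × E3 => g z.1 z.2) z (EuclideanSpace.single i 1, 0)| ≤ 3 ∧
    (fderiv ℝ (fun z : E3 × E3 => g z.1 z.2) z (EuclideanSpace.single i 1, 0) ≠ 0 →
      g z.1 z.2 ≠ 0) := by
  constructor
  · have h1 : HasFDerivAt (fun y : E3 => (y, z.2)) (ContinuousLinearMap.inl ℝ E3 E3) z.1 :=
      (hasFDerivAt_id z.1).prodMk (hasFDerivAt_const z.2 z.1)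
    have h2 : HasFDerivAt (fun y => g y z.2) _ z.1 :=
      HasFDerivAt.comp (g := fun z : E3 × E3 => g z.1 z.2) (f := fun y => (y, z.2)) z.1
        (hd (z.1, z.2)).hasFDerivAt h1
    have h3 : ‖fderiv ℝ (fun y => g y z.2) z.1‖ ≤ ((3 : NNReal) : ℝ) := by
      refine norm_fderiv_le_of_lipschitz ℝ (LipschitzWith.of_dist_le_mul fun y y' => ?_)
      rw [Real.dist_eq, dist_eq_norm]
      exact h.lip y y' z.2
    have h4 := (fderiv ℝ (fun y => g y z.2) z.1).le_opNorm (EuclideanSpace.single i 1)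
    rw [PiLp.norm_single, norm_one, mul_one, Real.norm_eq_abs] at h4
    rw [h2.fderiv] at h3 h4
    exact h4.trans h3
  · intro hne hz
    apply hne
    have hmin : IsLocalMin (fun z : E3 × E3 => g z.1 z.2) z :=
      Eventually.of_forall fun z' => by simp only [hz]; exact h.nonneg _ _
    rw [hmin.fderiv_eq_zero]; rfl

end Density

/-! ### Estimates for the sources of the fields -/

lemma abs_coord_le (u : E3) (i : Fin 3) : |u i| ≤ ‖u‖ := PiLp.norm_apply_le u i

lemma abs_velocity_coord_le (p : E3) (i : Fin 3) : |velocity p i| ≤ 1 :=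
  (abs_coord_le _ i).trans (norm_velocity_le_one p)

/-- Bounds for the integrals of the distribution function `G` and the force `K` against the
derivatives of a test function `θ`. -/
structure SourceBound (G : E3 × E3 → ℝ) (K : E3 × E3 → E3) (θ : E3 → ℝ) (Q : ℝ) : Prop where
  -- The weight `w` is `1` for the charge density, `v_n` for the current density and `v_l v_n` for
  -- the time derivative of the current density.
  transport : ∀ w : E3 → ℝ, Continuous w → (∀ p, |w p| ≤ 1) → ∀ a b c : Fin 3,
    |∫ z, G z * w z.2 * pd a (pd b (pd c θ)) z.1| ≤ Q
  force : ∀ n a b : Fin 3,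
    |∫ z, G z * (fderiv ℝ velocity z.2 (K z) n * pd a (pd b θ) z.1)| ≤ Q

section Density

variable {R₀ P₀ t C : ℝ} {g : E3 → E3 → ℝ} {K : E3 × E3 → E3}

lemma DensityBounds.abs_transport_le (h : DensityBounds R₀ P₀ t g) (hR₀ : 0 < R₀)
    (ht : 1 / 2 ≤ t) (hg : Continuous fun z : E3 × E3 => g z.1 z.2)
    (hgs : HasCompactSupport fun z : E3 × E3 => g z.1 z.2) {w : E3 → ℝ} (hw : Continuous w)
    (hw1 : ∀ p, |w p| ≤ 1) {k : E3 → ℝ} (hk : Continuous k) {x : E3} {C β : ℝ} (hC : 0 ≤ C)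
    (hβ0 : 0 ≤ β) (hβ : β < 3) (hkb : ∀ y, y ≠ x → |k y| ≤ C * ‖y - x‖ ^ (-β)) :
    |∫ z : E3 × E3, g z.1 z.2 * w z.2 * k z.1|
      ≤ (momentConst R₀ P₀ * C * ballConst β * (2 * R₀ + 1) ^ (3 - β)) * t ^ (-β) := by
  have := h.abs_integral_mul_le_rpow hR₀ ht (u := fun z : E3 × E3 => g z.1 z.2 * w z.2)
    (hg.mul (hw.comp continuous_snd)) hgs.mul_right zero_le_one (fun z => ?_)
    (fun z hz => left_ne_zero_of_mul hz) hk hC hβ0 hβ hkb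
  · rwa [one_mul] at this
  · rw [abs_mul, abs_of_nonneg (h.nonneg _ _)]
    exact mul_le_one₀ (h.le_one _ _) (abs_nonneg _) (hw1 _)

lemma DensityBounds.abs_force_le (h : DensityBounds R₀ P₀ t g) (hR₀ : 0 < R₀)
    (ht : 1 / 2 ≤ t) (hg : Continuous fun z : E3 × E3 => g z.1 z.2)
    (hgs : HasCompactSupport fun z : E3 × E3 => g z.1 z.2) (hK : Continuous K)
    (hKb : ∀ z, ‖K z‖ ≤ t ^ (-(3 / 2) : ℝ)) (n : Fin 3) {k : E3 → ℝ} (hk : Continuous k) {x : E3}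
    {C β : ℝ} (hC : 0 ≤ C) (hβ0 : 0 ≤ β) (hβ : β < 3)
    (hkb : ∀ y, y ≠ x → |k y| ≤ C * ‖y - x‖ ^ (-β)) :
    |∫ z : E3 × E3, g z.1 z.2 * (fderiv ℝ velocity z.2 (K z) n * k z.1)|
      ≤ (momentConst R₀ P₀ * C * ballConst β * (2 * R₀ + 1) ^ (3 - β)) * t ^ (-(β + 3 / 2)) := by
  have ht0 : 0 < t := by linarith
  have hc : Continuous fun z : E3 × E3 => fderiv ℝ velocity z.2 (K z) n :=
    continuous_coord ((continuous_fderiv_velocity.comp continuous_snd).clm_apply hK) n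
  have := h.abs_integral_mul_le_rpow hR₀ ht
    (u := fun z : E3 × E3 => g z.1 z.2 * fderiv ℝ velocity z.2 (K z) n)
    (hg.mul hc) hgs.mul_right (A := t ^ (-(3 / 2) : ℝ)) (Real.rpow_nonneg ht0.le _) (fun z => ?_)
    (fun z hz => left_ne_zero_of_mul hz) hk hC hβ0 hβ hkb
  · have e : t ^ (-(β + 3 / 2)) = t ^ (-(3 / 2) : ℝ) * t ^ (-β) := by
      rw [← Real.rpow_add ht0]; congr 1; ring
    rw [e]
    simp only [mul_assoc] at this ⊢
    linarith
  · rw [abs_mul, abs_of_nonneg (h.nonneg _ _)]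
    have h1 : |fderiv ℝ velocity z.2 (K z) n| ≤ t ^ (-(3 / 2) : ℝ) := by
      refine (abs_coord_le _ n).trans (((fderiv ℝ velocity z.2).le_opNorm _).trans ?_)
      calc ‖fderiv ℝ velocity z.2‖ * ‖K z‖ ≤ 1 * t ^ (-(3 / 2) : ℝ) :=
            mul_le_mul (norm_fderiv_velocity_le _) (hKb z) (norm_nonneg _) zero_le_one
        _ = _ := one_mul _
    calc g z.1 z.2 * |fderiv ℝ velocity z.2 (K z) n| ≤ 1 * t ^ (-(3 / 2) : ℝ) :=
          mul_le_mul (h.le_one _ _) h1 (abs_nonneg _) zero_le_one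
      _ = _ := one_mul _

/-- The constant in the decay of the fields. -/
def fieldConst (R₀ P₀ C : ℝ) : ℝ :=
  4 * (momentConst R₀ P₀ * C * ballConst 2 * (2 * R₀ + 1) ^ ((3 : ℝ) - 2))
    + 4 * (momentConst R₀ P₀ * C * ballConst 1 * (2 * R₀ + 1) ^ ((3 : ℝ) - 1))

lemma sourceConst_nonneg (hR₀ : 0 < R₀) (hC : 0 ≤ C) {β : ℝ} (hβ : β < 3) :
    0 ≤ momentConst R₀ P₀ * C * ballConst β * (2 * R₀ + 1) ^ (3 - β) :=
  mul_nonneg (mul_nonneg (mul_nonneg (momentConst_nonneg hR₀) hC) (ballConst_nonneg hβ))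
    (Real.rpow_nonneg (by linarith) _)

lemma fieldConst_nonneg (hR₀ : 0 < R₀) (hC : 0 ≤ C) : 0 ≤ fieldConst R₀ P₀ C := by
  have h1 := sourceConst_nonneg (P₀ := P₀) hR₀ hC (by norm_num : (2 : ℝ) < 3)
  have h2 := sourceConst_nonneg (P₀ := P₀) hR₀ hC (by norm_num : (1 : ℝ) < 3)
  unfold fieldConst
  linarith

/-- Third derivatives of the kernel have exponent `β = 2` and give `t⁻²`. Second derivatives have `β
= 1` and, with the force bound `t^(-3/2)`, give `t^(-5/2)`. Both are relaxed to `t^(-9/5)`. -/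
lemma DensityBounds.sourceBound (h : DensityBounds R₀ P₀ t g) (hR₀ : 0 < R₀)
    (ht : 1 / 2 ≤ t) (hg : Continuous fun z : E3 × E3 => g z.1 z.2)
    (hgs : HasCompactSupport fun z : E3 × E3 => g z.1 z.2) (hK : Continuous K)
    (hKb : ∀ z, ‖K z‖ ≤ t ^ (-(3 / 2) : ℝ)) (hC : KernelBound C) {s r : ℝ} (hs : 0 < s)
    (hr : 0 < r) (x : E3) :
    SourceBound (fun z => g z.1 z.2) K (psiDiff s r x)
      (fieldConst R₀ P₀ C * t ^ (-(9 / 5) : ℝ)) := by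
  have ht0 : 0 < t := by linarith
  have tψ := isTest_psiDiff hs hr x
  have h1 := sourceConst_nonneg (P₀ := P₀) hR₀ hC.nonneg (by norm_num : (2 : ℝ) < 3)
  have h2 := sourceConst_nonneg (P₀ := P₀) hR₀ hC.nonneg (by norm_num : (1 : ℝ) < 3)
  have hp : 0 ≤ t ^ (-(9 / 5) : ℝ) := Real.rpow_nonneg ht0.le _
  have m1 := mul_nonneg h1 hp
  have m2 := mul_nonneg h2 hp
  constructor
  · intro w hw hw1 a b c
    have b1 := h.abs_transport_le hR₀ ht hg hgs hw hw1 (((tψ.pd c).pd b).pd a).continuous hC.nonneg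
      (by norm_num) (by norm_num) (fun y hy => hC.three s r x y a b c hs hr hy)
    have b2 := rpow_neg_le_four_mul (q := 9 / 5) (p := 2) ht (by norm_num) (by norm_num)
    have b3 := mul_le_mul_of_nonneg_left b2 h1
    refine b1.trans (b3.trans ?_)
    rw [fieldConst, add_mul, mul_left_comm, ← mul_assoc]
    exact le_add_of_nonneg_right (mul_nonneg (mul_nonneg (by norm_num) h2) hp)
  · intro n a b
    have b1 := h.abs_force_le hR₀ ht hg hgs hK hKb n ((tψ.pd b).pd a).continuous hC.nonneg
      (by norm_num) (by norm_num) (fun y hy => hC.two s r x y a b hs hr hy)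
    have b2 := rpow_neg_le_four_mul (q := 9 / 5) (p := 1 + 3 / 2) ht (by norm_num) (by norm_num)
    have b3 := mul_le_mul_of_nonneg_left b2 h2
    unfold fieldConst
    linarith

/-- The constant in the decay of the gradients of the fields. -/
def gradConst (R₀ P₀ C : ℝ) : ℝ :=
  momentConst R₀ P₀ * C * ballConst (8 / 3) * (2 * R₀ + 1) ^ ((3 : ℝ) - 8 / 3)
    + 72 * (momentConst R₀ P₀ * C * ballVol)
    + 4 * (momentConst R₀ P₀ * C * ballConst 2 * (2 * R₀ + 1) ^ ((3 : ℝ) - 2))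

lemma gradConst_nonneg (hR₀ : 0 < R₀) (hC : 0 ≤ C) : 0 ≤ gradConst R₀ P₀ C := by
  have h1 := sourceConst_nonneg (P₀ := P₀) hR₀ hC (by norm_num : (2 : ℝ) < 3)
  have h2 := sourceConst_nonneg (P₀ := P₀) hR₀ hC (by norm_num : (8 / 3 : ℝ) < 3)
  have h3 := mul_nonneg (mul_nonneg (momentConst_nonneg (P₀ := P₀) hR₀) hC) ballVol_nonneg
  exact add_nonneg (add_nonneg h2 (mul_nonneg (by norm_num) h3)) (mul_nonneg (by norm_num) h1)

lemma pd_pd_pd_psiDiff_one_eq_zero {s : ℝ} (hs : 0 < s) (hs1 : s < 1) {x y : E3}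
    (hy : 1 < ‖y - x‖) (a b c : Fin 3) : pd a (pd b (pd c (psiDiff s 1 x))) y = 0 := by
  have hU : IsOpen {y : E3 | 1 < ‖y - x‖} :=
    isOpen_lt continuous_const (continuous_id.sub continuous_const).norm
  refine pd_eq_zero_of_eqOn hU (pd_eq_zero_of_eqOn hU (pd_eq_zero_of_eqOn hU
    (fun y (hy : 1 < ‖y - x‖) => ?_) c) b) a y hy
  exact psiDiff_eq_zero hs one_pos (hs1.le.trans hy.le) hy.le

/-- A fourth derivative at small scale would be as singular as `|y - x|⁻³`, so one derivative is
moved onto `g`. The difference of the scales `s < 1` and `1` vanishes for `|y - x| > 1`, so the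
kernel may be cut off at `L = 2`, and the decay is the full `t⁻³`. -/
lemma DensityBounds.abs_near_le (h : DensityBounds R₀ P₀ t g) (hR₀ : 0 < R₀)
    (ht : 1 / 2 ≤ t) (hg : Differentiable ℝ fun z : E3 × E3 => g z.1 z.2)
    (hg' : Continuous (fderiv ℝ fun z : E3 × E3 => g z.1 z.2))
    (hgs : HasCompactSupport fun z : E3 × E3 => g z.1 z.2) (hC : KernelBound C) {s : ℝ}
    (hs : 0 < s) (hs1 : s < 1) (x : E3) {w : E3 → ℝ} (hw : Continuous w) (hw1 : ∀ p, |w p| ≤ 1)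
    (a b c l : Fin 3) :
    |∫ z : E3 × E3, g z.1 z.2 * w z.2 * pd a (pd b (pd c (pd l (psiDiff s 1 x)))) z.1|
      ≤ 72 * (momentConst R₀ P₀ * C * ballVol) * t ^ (-(8 / 3) : ℝ) := by
  have ht0 : 0 < t := by linarith
  have tψ := isTest_psiDiff hs one_pos x
  set k := pd b (pd c (pd l (psiDiff s 1 x))) with hk
  have tk : IsTest k := ((tψ.pd l).pd c).pd b
  have parts := integral_fderiv_mul hg hg' hgs (w := (EuclideanSpace.single a 1, 0))
    (Ψ := fun z => w z.2 * k z.1) (Ψ' := fun z => w z.2 * pd a k z.1)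
    ((hw.comp continuous_snd).mul (tk.continuous.comp continuous_fst))
    ((hw.comp continuous_snd).mul ((tk.pd a).continuous.comp continuous_fst)) fun z => by
      have h1 := HasDerivAt.const_mul (w z.2)
        (hasLineDerivAt_fst tk.smooth.differentiable z (EuclideanSpace.single a 1))
      unfold HasLineDerivAt
      refine HasDerivAt.congr_of_eventuallyEq h1 (Eventually.of_forall fun s => ?_)
      simp
  have e : ∫ z : E3 × E3, g z.1 z.2 * w z.2 * pd a k z.1
      = -∫ z : E3 × E3, (fderiv ℝ (fun z : E3 × E3 => g z.1 z.2) z (EuclideanSpace.single a 1, 0)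
        * w z.2) * k z.1 := by
    simp only [mul_assoc]
    rw [parts, neg_neg]
  rw [e, abs_neg]
  have hcw : HasCompactSupport fun z : E3 × E3 =>
      fderiv ℝ (fun z : E3 × E3 => g z.1 z.2) z (EuclideanSpace.single a 1, 0) :=
    (hgs.fderiv (𝕜 := ℝ)).comp_left
      (g := fun L : E3 × E3 →L[ℝ] ℝ => L (EuclideanSpace.single a 1, 0)) rfl
  have main := h.abs_integral_mul_le hR₀ ht0 (A := 3) (k := k)
    (u := fun z : E3 × E3 =>
      fderiv ℝ (fun z : E3 × E3 => g z.1 z.2) z (EuclideanSpace.single a 1, 0) * w z.2)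
    ((hg'.clm_apply continuous_const).mul (hw.comp continuous_snd)) hcw.mul_right (by norm_num)
    (fun z => by
      rw [abs_mul]
      calc _ ≤ (3 : ℝ) * 1 := mul_le_mul (h.fderiv_x hg z a).1 (hw1 _) (abs_nonneg _) (by norm_num)
        _ = 3 := mul_one 3)
    (fun z hz => (h.fderiv_x hg z a).2 (left_ne_zero_of_mul hz)) tk.continuous
    ((integrable_nearKernel (β := 2) (L := 2) (by norm_num) (by norm_num) x).const_mul C)
    (fun y => mul_nonneg hC.nonneg (nearKernel_nonneg _ _ _ _)) (x := x) (fun y hy _ => by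
      by_cases hd : ‖y - x‖ < 2
      · rw [nearKernel_of_lt hd]
        exact hC.three s 1 x y b c l hs one_pos hy
      · rw [hk, pd_pd_pd_psiDiff_one_eq_zero hs hs1 (by linarith [not_lt.1 hd]), abs_zero]
        exact mul_nonneg hC.nonneg (nearKernel_nonneg _ _ _ _))
  rw [integral_const_mul, integral_nearKernel (by norm_num) (by norm_num)] at main
  have h1 : (2 : ℝ) ^ ((3 : ℝ) - 2) = 2 := by norm_num
  rw [h1] at main
  have h2 := rpow_neg_le_four_mul (q := 8 / 3) (p := 3) ht (by norm_num) (by norm_num)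
  have h3 := mul_nonneg (mul_nonneg (momentConst_nonneg (P₀ := P₀) hR₀) hC.nonneg) ballVol_nonneg
  refine main.trans ?_
  -- Here `18` is the Lipschitz constant `3` times `6`, where the cut-off integral of `|y - x|⁻²` is
  -- `6 * ballVol`. Relaxing `t⁻³` to `t^(-8/3)` brings the factor `4`, hence `72`.
  calc 3 * (momentConst R₀ P₀ * t ^ (-3 : ℝ)) * (C * (3 * ballVol / (3 - 2) * 2))
      = 18 * (momentConst R₀ P₀ * C * ballVol) * t ^ (-3 : ℝ) := by ring
    _ ≤ 18 * (momentConst R₀ P₀ * C * ballVol) * (4 * t ^ (-(8 / 3) : ℝ)) := by gcongr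
    _ = _ := by ring

/-- The test function is split at the intermediate scale `1`. The near part uses the Lipschitz bound
on `g`, and the far part the exponent `8/3`. The force term has only third derivatives, which are
integrable, and decays like `t^(-7/2)`. -/
lemma DensityBounds.sourceBound_pd (h : DensityBounds R₀ P₀ t g) (hR₀ : 0 < R₀)
    (ht : 1 / 2 ≤ t) (hg : Differentiable ℝ fun z : E3 × E3 => g z.1 z.2)
    (hg' : Continuous (fderiv ℝ fun z : E3 × E3 => g z.1 z.2))
    (hgs : HasCompactSupport fun z : E3 × E3 => g z.1 z.2) (hK : Continuous K)
    (hKb : ∀ z, ‖K z‖ ≤ t ^ (-(3 / 2) : ℝ)) (hC : KernelBound C) {s r : ℝ} (hs : 0 < s)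
    (hs1 : s < 1) (hr : 1 < r) (x : E3) (l : Fin 3) :
    SourceBound (fun z => g z.1 z.2) K (pd l (psiDiff s r x))
      (gradConst R₀ P₀ C * t ^ (-(8 / 3) : ℝ)) := by
  have ht0 : 0 < t := by linarith
  have hr0 : 0 < r := by linarith
  have tψ := isTest_psiDiff hs hr0 x
  have h1 := sourceConst_nonneg (P₀ := P₀) hR₀ hC.nonneg (by norm_num : (2 : ℝ) < 3)
  have h2 := sourceConst_nonneg (P₀ := P₀) hR₀ hC.nonneg (by norm_num : (8 / 3 : ℝ) < 3)
  have h3 := mul_nonneg (mul_nonneg (momentConst_nonneg (P₀ := P₀) hR₀) hC.nonneg) ballVol_nonneg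
  have hp : 0 ≤ t ^ (-(8 / 3) : ℝ) := Real.rpow_nonneg ht0.le _
  have m1 := mul_nonneg h1 hp
  have m2 := mul_nonneg h2 hp
  have m3 := mul_nonneg h3 hp
  constructor
  · intro w hw hw1 a b c
    have near := h.abs_near_le hR₀ ht hg hg' hgs hC hs hs1 x hw hw1 a b c l
    have tn := ((((isTest_psiDiff hs one_pos x).pd l).pd c).pd b).pd a
    have tf := ((((isTest_psiDiff one_pos hr0 x).pd l).pd c).pd b).pd a
    have far := h.abs_transport_le hR₀ ht hg.continuous hgs hw hw1 tf.continuous hC.nonneg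
      (by norm_num) (by norm_num) (fun y hy => hC.four 1 r x y a b c l le_rfl hr.le hy)
    have int : ∀ {k : E3 → ℝ}, Continuous k →
        Integrable fun z : E3 × E3 => g z.1 z.2 * w z.2 * k z.1 := fun hk =>
      ((hg.continuous.mul (hw.comp continuous_snd)).mul
        (hk.comp continuous_fst)).integrable_of_hasCompactSupport hgs.mul_right.mul_right
    have e : ∫ z : E3 × E3, g z.1 z.2 * w z.2 * pd a (pd b (pd c (pd l (psiDiff s r x)))) z.1
        = (∫ z : E3 × E3, g z.1 z.2 * w z.2 * pd a (pd b (pd c (pd l (psiDiff s 1 x)))) z.1)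
          + ∫ z : E3 × E3, g z.1 z.2 * w z.2 * pd a (pd b (pd c (pd l (psiDiff 1 r x)))) z.1 := by
      rw [← integral_add (int tn.continuous) (int tf.continuous)]
      refine integral_congr_ae (ae_of_all _ fun z => ?_)
      simp only [pd_pd_pd_pd_psiDiff]
      ring
    rw [e]
    refine (abs_add_le _ _).trans ?_
    unfold gradConst
    linarith
  · intro n a b
    have b1 := h.abs_force_le hR₀ ht hg.continuous hgs hK hKb n
      (((tψ.pd l).pd b).pd a).continuous hC.nonneg
      (by norm_num) (by norm_num) (fun y hy => hC.three s r x y a b l hs hr0 hy)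
    have b2 := rpow_neg_le_four_mul (q := 8 / 3) (p := 2 + 3 / 2) ht (by norm_num) (by norm_num)
    have b3 := mul_le_mul_of_nonneg_left b2 h1
    unfold gradConst
    linarith

end Density

/-! ### Estimates for the fields -/

section Solution

variable {T : ℝ} {f : ℝ → E3 → E3 → ℝ} {EL ET B : ℝ → E3 → E3} {t Q : ℝ} {θ : E3 → ℝ}

lemma IsClassicalSolution.abs_transport_lap_le (h : IsClassicalSolution T f EL ET B)
    (ht : t ∈ Ico 0 T) (hθ : IsTest θ)
    (hQ : SourceBound (fun z => f t z.1 z.2) (fun z => force EL ET B t z.1 z.2) θ Q)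
    {w : E3 → ℝ} (hw : Continuous w) (hw1 : ∀ p, |w p| ≤ 1) (i : Fin 3) :
    |∫ z : E3 × E3, f t z.1 z.2 * w z.2 * pd i (lap θ) z.1| ≤ 3 * Q := by
  have hi : ∀ k ∈ Finset.univ, Integrable fun z : E3 × E3 =>
      f t z.1 z.2 * w z.2 * pd i (pd k (pd k θ)) z.1 := fun k _ =>
    (((h.differentiable_f ht).continuous.mul (hw.comp continuous_snd)).mul
      ((((hθ.pd k).pd k).pd i).continuous.comp continuous_fst)).integrable_of_hasCompactSupport
      (h.compact_f t ht).mul_right.mul_right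
  have e : ∫ z : E3 × E3, f t z.1 z.2 * w z.2 * pd i (lap θ) z.1
      = ∑ k, ∫ z : E3 × E3, f t z.1 z.2 * w z.2 * pd i (pd k (pd k θ)) z.1 := by
    rw [← integral_finsetSum _ hi]
    refine integral_congr_ae (ae_of_all _ fun z => ?_)
    simp only
    unfold lap
    rw [pd_sum _ fun k => ((hθ.pd k).pd k).smooth.differentiable, Finset.mul_sum]
  rw [e]
  refine (Finset.abs_sum_le_sum_abs _ _).trans ?_
  refine (Finset.sum_le_sum fun k _ => hQ.transport w hw hw1 i k k).trans ?_
  simp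

/-- The constant `16` is dictated by `E_T` and used for all three fields to treat them uniformly.
Here `3` suffices, and for `B` it is `6`. -/
lemma IsClassicalSolution.abs_integral_EL_le (h : IsClassicalSolution T f EL ET B)
    (ht : t ∈ Ico 0 T) (hθ : IsTest θ) (hQ0 : 0 ≤ Q)
    (hQ : SourceBound (fun z => f t z.1 z.2) (fun z => force EL ET B t z.1 z.2) θ Q)
    (i : Fin 3) : |∫ y, EL t y i * lap (lap θ) y| ≤ 16 * Q := by
  rw [h.integral_EL ht hθ.lap, abs_neg, h.chargeDensity_mul ht (hθ.lap.pd i).continuous]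
  have := h.abs_transport_lap_le ht hθ hQ (w := fun _ => 1) continuous_const (by simp) i
  linarith

lemma IsClassicalSolution.abs_integral_B_le (h : IsClassicalSolution T f EL ET B)
    (ht : t ∈ Ioo 0 T) (hθ : IsTest θ) (hQ0 : 0 ≤ Q)
    (hQ : SourceBound (fun z => f t z.1 z.2) (fun z => force EL ET B t z.1 z.2) θ Q)
    (i : Fin 3) : |∫ y, B t y i * lap (lap θ) y| ≤ 16 * Q := by
  have ht' : t ∈ Ico 0 T := ⟨ht.1.le, ht.2⟩
  rw [h.integral_B ht hθ.lap, h.currentDensity_mul ht' _ (hθ.lap.pd _).continuous,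
    h.currentDensity_mul ht' _ (hθ.lap.pd _).continuous]
  have b : ∀ n k : Fin 3, _ := fun n k => h.abs_transport_lap_le ht' hθ hQ
    (continuous_velocity_coord n) (fun p => abs_velocity_coord_le p n) k
  refine (abs_add_le _ _).trans ?_
  rw [abs_neg]
  linarith [b (i + 1) (i + 2), b (i + 2) (i + 1)]

lemma IsClassicalSolution.abs_integral_ET_le (h : IsClassicalSolution T f EL ET B) {a : ℝ}
    (ha : a < T) {S : Set (E3 × E3)} (hS : IsCompact S)
    (hfS : ∀ s ∈ Ioo 0 a, ∀ z ∉ S, f s z.1 z.2 = 0) (ht : t ∈ Ioo 0 a) (hθ : IsTest θ)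
    (hQ : SourceBound (fun z => f t z.1 z.2) (fun z => force EL ET B t z.1 z.2) θ Q)
    (i : Fin 3) : |∫ y, ET t y i * lap (lap θ) y| ≤ 16 * Q := by
  have ht' : t ∈ Ioo 0 T := ⟨ht.1, ht.2.trans ha⟩
  set J : Fin 3 → Fin 3 → Fin 3 → ℝ := fun n k m =>
    (∑ l, ∫ z : E3 × E3, f t z.1 z.2 * (velocity z.2 l * velocity z.2 n)
      * pd l (pd k (pd m θ)) z.1)
    + ∫ z : E3 × E3, f t z.1 z.2 * (fderiv ℝ velocity z.2 (force EL ET B t z.1 z.2) n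
      * pd k (pd m θ) z.1) with hJ
  -- Three transport integrals and one force integral. Four such terms occur in `integral_ET`, hence
  -- `16 * Q`.
  have hJb : ∀ n k m, |J n k m| ≤ 4 * Q := by
    intro n k m
    have h1 : |∑ l, ∫ z : E3 × E3, f t z.1 z.2 * (velocity z.2 l * velocity z.2 n)
        * pd l (pd k (pd m θ)) z.1| ≤ 3 * Q := by
      refine (Finset.abs_sum_le_sum_abs _ _).trans ?_
      refine (Finset.sum_le_sum fun l _ => hQ.transport
        (fun p => velocity p l * velocity p n) ((continuous_velocity_coord l).mul
          (continuous_velocity_coord n)) (fun p => ?_) l k m).trans (by simp)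
      rw [abs_mul]
      exact mul_le_one₀ (abs_velocity_coord_le p l) (abs_nonneg _) (abs_velocity_coord_le p n)
    have h2 := hQ.force n k m
    refine (abs_add_le _ _).trans ?_
    linarith
  rw [h.integral_ET ht' hθ i (J := J) fun n k m =>
    h.hasDerivAt_currentDensity ha hS hfS ht n ((hθ.pd m).pd k)]
  refine (abs_sub _ _).trans ?_
  have b1 := abs_add_le (-J (i + 1 + 1) (i + 1 + 2) (i + 2)) (J (i + 1 + 2) (i + 1 + 1) (i + 2))
  have b2 := abs_add_le (-J (i + 2 + 1) (i + 2 + 2) (i + 1)) (J (i + 2 + 2) (i + 2 + 1) (i + 1))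
  rw [abs_neg] at b1 b2
  linarith [hJb (i + 1 + 1) (i + 1 + 2) (i + 2), hJb (i + 1 + 2) (i + 1 + 1) (i + 2),
    hJb (i + 2 + 1) (i + 2 + 2) (i + 1), hJb (i + 2 + 2) (i + 2 + 1) (i + 1)]

end Solution

/-! ### Decay of the fields -/

lemma norm_le_of_abs_coord_le {u : E3} {q : ℝ} (h : ∀ i, |u i| ≤ q) : ‖u‖ ≤ 3 * q := by
  conv_lhs => rw [← sum_coord_smul_single u]
  refine (norm_sum_le _ _).trans ?_
  calc ∑ i, ‖u i • (EuclideanSpace.single i 1 : E3)‖ ≤ ∑ _i : Fin 3, q :=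
        Finset.sum_le_sum fun i _ => by
          rw [norm_smul, PiLp.norm_single, norm_one, mul_one]; exact h i
    _ = 3 * q := by simp

lemma norm_clm_le_of_abs_coord_le {L : E3 →L[ℝ] E3} {q : ℝ} (hq : 0 ≤ q)
    (h : ∀ l i, |L (EuclideanSpace.single l 1) i| ≤ q) : ‖L‖ ≤ 9 * q := by
  refine L.opNorm_le_bound (by linarith) fun u => ?_
  conv_lhs => rw [← sum_coord_smul_single u]
  rw [map_sum]
  refine (norm_sum_le _ _).trans ?_
  calc ∑ l, ‖L (u l • (EuclideanSpace.single l 1 : E3))‖ ≤ ∑ _l : Fin 3, ‖u‖ * (3 * q) :=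
        Finset.sum_le_sum fun l _ => by
          rw [map_smul, norm_smul]
          exact mul_le_mul (abs_coord_le u l) (norm_le_of_abs_coord_le (h l)) (norm_nonneg _)
            (norm_nonneg _)
    _ = 9 * q * ‖u‖ := by simp; ring

lemma norm_le_of_integral_bilap {F : E3 → E3} (hF : Continuous F) {M : ℝ} (hM : ∀ y, ‖F y‖ ≤ M)
    (hF0 : Tendsto F (cocompact E3) (𝓝 0)) {x : E3} {Q : ℝ}
    (hQ : ∀ (i : Fin 3) (s r : ℝ), 0 < s → s < 1 → 1 < r →
      |∫ y, F y i * lap (lap (psiDiff s r x)) y| ≤ Q) :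
    ‖F x‖ ≤ 3 * (Q / |kernelMass|) := by
  refine norm_le_of_abs_coord_le fun i => ?_
  rw [le_div_iff₀' (abs_pos.2 kernelMass_ne_zero)]
  refine abs_le_of_integral_bilap (F := fun y => F y i) (continuous_coord hF i)
    (fun y => (abs_coord_le _ i).trans (hM y)) ?_ (hQ i)
  exact squeeze_zero_norm (fun y => abs_coord_le (F y) i) (tendsto_zero_iff_norm_tendsto_zero.1 hF0)

lemma norm_fderiv_le_of_integral_bilap {F : E3 → E3} (hF : Differentiable ℝ F)
    (hF' : Continuous (fderiv ℝ F)) {M N : ℝ} (hM : ∀ y, ‖F y‖ ≤ M)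
    (hN : ∀ y, ‖fderiv ℝ F y‖ ≤ N) {x : E3} {Q : ℝ} (hQ0 : 0 ≤ Q)
    (hQ : ∀ (i l : Fin 3) (s r : ℝ), 0 < s → s < 1 → 1 < r →
      |∫ y, F y i * lap (lap (pd l (psiDiff s r x))) y| ≤ Q) :
    ‖fderiv ℝ F x‖ ≤ 9 * (Q / |kernelMass|) := by
  refine norm_clm_le_of_abs_coord_le (div_nonneg hQ0 (abs_nonneg _)) fun l i => ?_
  rw [le_div_iff₀' (abs_pos.2 kernelMass_ne_zero)]
  have e : ∀ y, pd l (fun y => F y i) y = fderiv ℝ F y (EuclideanSpace.single l 1) i :=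
    fun y => (partialD_eq_pd hF l i y).symm
  rw [← e]
  refine abs_pd_le_of_integral_bilap (F := fun y => F y i) (differentiable_coord hF i)
    (continuous_pd_coord hF hF' l i) (fun y => (abs_coord_le _ i).trans (hM y))
    (M' := N) (fun y => ?_) (hQ i l)
  rw [e]
  refine (abs_coord_le _ i).trans (((fderiv ℝ F y).le_opNorm _).trans ?_)
  rw [PiLp.norm_single, norm_one, mul_one]
  exact hN y

/-- The field `F` and its gradient are bounded by multiples of `t ^ (-9/5)` and `t ^ (-8/3)`. -/
def FieldDecay (c c' : ℝ) (F : ℝ → E3 → E3) (t : ℝ) : Prop :=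
  ∀ x, ‖F t x‖ ≤ c * t ^ (-(9 / 5) : ℝ) ∧ ‖fderiv ℝ (F t) x‖ ≤ c' * t ^ (-(8 / 3) : ℝ)

/-- The estimate for `E_T` differentiates in time and needs times strictly before `a`, so the final
time is reached by continuity. Starting from `1/2` leaves room below `t = 1`. -/
lemma FieldDecay.of_forall_lt {c c' T t : ℝ} {F : ℝ → E3 → E3}
    (hF : ContinuousOn (fun z : ℝ × E3 => F z.1 z.2) (Ico 0 T ×ˢ (univ : Set E3)))
    (hF' : ContinuousOn (fun z : ℝ × E3 => fderiv ℝ (F z.1) z.2) (Ico 0 T ×ˢ (univ : Set E3)))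
    (ht : 1 ≤ t) (htT : t < T) (h : ∀ s, 1 / 2 ≤ s → s < t → FieldDecay c c' F s) :
    FieldDecay c c' F t := by
  intro x
  have hsub : Ico (1 / 2) t ∈ 𝓝[<] t := Ico_mem_nhdsLT (by linarith)
  have hcurve : Tendsto (fun s : ℝ => (s, x)) (𝓝[<] t) (𝓝[Ico 0 T ×ˢ (univ : Set E3)] (t, x)) := by
    refine tendsto_nhdsWithin_iff.2 ⟨?_, ?_⟩
    · exact ((by fun_prop : Continuous fun s : ℝ => (s, x)).tendsto t).mono_left nhdsWithin_le_nhds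
    · filter_upwards [hsub] with s hs
      exact ⟨⟨by linarith [hs.1], hs.2.trans htT⟩, mem_univ _⟩
  have hmem : (t, x) ∈ Ico 0 T ×ˢ (univ : Set E3) := ⟨⟨by linarith, htT⟩, mem_univ _⟩
  have hp : ∀ q : ℝ, Tendsto (fun s : ℝ => s ^ q) (𝓝[<] t) (𝓝 (t ^ q)) := fun q =>
    (Real.continuousAt_rpow_const t q (Or.inl (by linarith))).mono_left nhdsWithin_le_nhds
  constructor
  · refine le_of_tendsto_of_tendsto ((hF _ hmem).tendsto.comp hcurve).norm
      ((hp _).const_mul c) ?_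
    filter_upwards [hsub] with s hs using (h s hs.1 hs.2 x).1
  · refine le_of_tendsto_of_tendsto ((hF' _ hmem).tendsto.comp hcurve).norm
      ((hp _).const_mul c') ?_
    filter_upwards [hsub] with s hs using (h s hs.1 hs.2 x).2

section Solution

variable {T α a R₀ P₀ C : ℝ} {f : ℝ → E3 → E3 → ℝ} {EL ET B : ℝ → E3 → E3}

lemma IsClassicalSolution.fieldDecay_of_lt (h : IsClassicalSolution T f EL ET B) (hR₀ : 0 < R₀)
    (hα : 0 ≤ α) (hα6 : α ≤ 1 / 6) (hαP : 36 * α ≤ monoConst (3 * (P₀ + 1)))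
    (hI : InitialData R₀ P₀ (f 0)) (ha : a < T) (hfs : FreeStreaming α a EL ET B)
    (hC : KernelBound C) {t : ℝ} (ht : 1 / 2 ≤ t) (hta : t < a) :
    ∀ F ∈ ({EL, ET, B} : Set (ℝ → E3 → E3)), FieldDecay (48 * fieldConst R₀ P₀ C / |kernelMass|)
      (144 * gradConst R₀ P₀ C / |kernelMass|) F t := by
  have ht0 : 0 < t := by linarith
  have htI : t ∈ Icc 0 a := ⟨ht0.le, hta.le⟩
  have hto : t ∈ Ioo 0 a := ⟨ht0, hta⟩
  have htT : t ∈ Ico 0 T := ⟨ht0.le, hta.trans ha⟩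
  have htT' : t ∈ Ioo 0 T := ⟨ht0, hta.trans ha⟩
  have hd := h.densityBounds hα hα6 hαP hI ha hfs htI
  -- One compact set carries `f(s)` for all `s` in `(0, a)`. The definition of a solution gives
  -- compact support only at each time separately, and differentiation under the integral needs this
  -- uniformity.
  set S : Set (E3 × E3) := Metric.closedBall 0 (R₀ + a) ×ˢ Metric.closedBall 0 (P₀ + 1)
  have hS : IsCompact S := (isCompact_closedBall _ _).prod (isCompact_closedBall _ _)
  have hfS : ∀ s ∈ Ioo 0 a, ∀ z ∉ S, f s z.1 z.2 = 0 := by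
    intro s hs z hz
    by_contra hne
    have hd := h.densityBounds hα hα6 hαP hI ha hfs ⟨hs.1.le, hs.2.le⟩
    refine hz ⟨mem_closedBall_zero_iff.2 ?_, mem_closedBall_zero_iff.2 (hd.mom_le hne)⟩
    linarith [hd.pos_le hne, hs.2]
  have hg : Differentiable ℝ fun z : E3 × E3 => f t z.1 z.2 :=
    differentiable_slab h.contDiffOn_f htT
  have hg' : Continuous (fderiv ℝ fun z : E3 × E3 => f t z.1 z.2) :=
    continuous_fderiv_slab h.contDiffOn_f htT
  have hgs := h.compact_f t htT
  have hK : Continuous fun z : E3 × E3 => force EL ET B t z.1 z.2 :=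
    h.continuous_force.comp_continuous (f := fun z : E3 × E3 => (t, z)) (by fun_prop)
      fun z => ⟨htT, mem_univ _⟩
  have hKb : ∀ z : E3 × E3, ‖force EL ET B t z.1 z.2‖ ≤ t ^ (-(3 / 2) : ℝ) := by
    intro z
    refine ((h.forceBounds hα hα6 ha hfs).norm_le t htI z.1 z.2).trans ?_
    calc α * (1 + t) ^ (-(3 / 2) : ℝ) ≤ 1 * t ^ (-(3 / 2) : ℝ) :=
          mul_le_mul (by linarith)
            (Real.rpow_le_rpow_of_nonpos ht0 (by linarith) (by norm_num))
            (Real.rpow_nonneg (by linarith) _) zero_le_one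
      _ = _ := one_mul _
  have hq1 : 0 ≤ fieldConst R₀ P₀ C * t ^ (-(9 / 5) : ℝ) :=
    mul_nonneg (fieldConst_nonneg hR₀ hC.nonneg) (Real.rpow_nonneg ht0.le _)
  have hq2 : 0 ≤ gradConst R₀ P₀ C * t ^ (-(8 / 3) : ℝ) :=
    mul_nonneg (gradConst_nonneg hR₀ hC.nonneg) (Real.rpow_nonneg ht0.le _)
  have hb1 : ∀ (x : E3) (s r : ℝ), 0 < s → 1 < r → _ := fun x s r hs hr =>
    hd.sourceBound hR₀ ht hg.continuous hgs hK hKb hC hs (zero_lt_one.trans hr) x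
  have hb2 : ∀ (x : E3) (l : Fin 3) (s r : ℝ), 0 < s → s < 1 → 1 < r → _ :=
    fun x l s r hs hs1 hr =>
      hd.sourceBound_pd hR₀ ht hg hg' hgs hK hKb hC hs hs1 hr x l
  have hw := one_add_rpow_pos ht0.le (-(3 / 2))
  have hw5 := one_add_rpow_pos ht0.le (-(5 / 2))
  obtain ⟨eT, eL, b, -, -, -, -, hT, hL, hB⟩ :=
    exists_bounds_of_supNorm_add_le (by positivity) (hfs t htI).1
  obtain ⟨gT, gL, gb, -, -, -, -, hgT, hgL, hgB⟩ :=
    exists_bounds_of_supNorm_add_le (by positivity) (hfs t htI).2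
  -- The constants are `48 = 3 * 16` and `144 = 9 * 16`, where `3` and `9` pass from coordinates to
  -- the norm of a vector and of a Jacobian.
  have key : ∀ {F : ℝ → E3 → E3} {M M' : ℝ}, Differentiable ℝ (F t) →
      Continuous (fderiv ℝ (F t)) → (∀ y, ‖F t y‖ ≤ M) → (∀ y, ‖fderiv ℝ (F t) y‖ ≤ M') →
      Tendsto (F t) (cocompact E3) (𝓝 0) →
      (∀ {θ : E3 → ℝ} {Q : ℝ}, IsTest θ → 0 ≤ Q →
        SourceBound (fun z => f t z.1 z.2) (fun z => force EL ET B t z.1 z.2) θ Q →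
        ∀ i : Fin 3, |∫ y, F t y i * lap (lap θ) y| ≤ 16 * Q) →
      FieldDecay (48 * fieldConst R₀ P₀ C / |kernelMass|)
        (144 * gradConst R₀ P₀ C / |kernelMass|) F t := by
    intro F M M' hF hF' hM hM' h0 hQ x
    constructor
    · refine (norm_le_of_integral_bilap hF.continuous hM h0 fun i s r hs hs1 hr =>
        hQ (isTest_psiDiff hs (zero_lt_one.trans hr) x) hq1 (hb1 x s r hs hr) i).trans_eq ?_
      ring
    · refine (norm_fderiv_le_of_integral_bilap hF hF' hM hM'
        (mul_nonneg (by norm_num) hq2) fun i l s r hs hs1 hr =>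
        hQ ((isTest_psiDiff hs (zero_lt_one.trans hr) x).pd l) hq2
          (hb2 x l s r hs hs1 hr) i).trans_eq ?_
      ring
  rintro F (rfl | rfl | rfl)
  · exact key (h.differentiable_EL htT) (continuous_fderiv_slab h.contDiffOn_EL htT) hL hgL
      (h.EL_infty t htT) fun hθ hQ0 hQ i => h.abs_integral_EL_le htT hθ hQ0 hQ i
  · exact key (h.differentiable_ET t htT)
      (h.continuousOn_fderiv_ET.comp_continuous (f := fun y => (t, y)) (by fun_prop)
        fun y => ⟨htT, mem_univ _⟩) hT hgT (h.ET_infty t htT)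
      fun hθ _ hQ i => h.abs_integral_ET_le ha hS hfS hto hθ hQ i
  · exact key (h.differentiable_B htT) (continuous_fderiv_slab h.contDiffOn_B htT) hB hgB
      (h.B_infty t htT) fun hθ hQ0 hQ i => h.abs_integral_B_le htT' hθ hQ0 hQ i

lemma IsClassicalSolution.fieldDecay (h : IsClassicalSolution T f EL ET B) (hR₀ : 0 < R₀)
    (hα : 0 ≤ α) (hα6 : α ≤ 1 / 6) (hαP : 36 * α ≤ monoConst (3 * (P₀ + 1)))
    (hI : InitialData R₀ P₀ (f 0)) (ha : a < T) (hfs : FreeStreaming α a EL ET B)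
    (hC : KernelBound C) {t : ℝ} (ht : t ∈ Icc 1 a) :
    ∀ F ∈ ({EL, ET, B} : Set (ℝ → E3 → E3)), FieldDecay (48 * fieldConst R₀ P₀ C / |kernelMass|)
      (144 * gradConst R₀ P₀ C / |kernelMass|) F t := by
  intro F hF
  have htT := ht.2.trans_lt ha
  have key : ∀ s, 1 / 2 ≤ s → s < t → _ := fun s hs hst =>
    h.fieldDecay_of_lt hR₀ hα hα6 hαP hI ha hfs hC hs (hst.trans_le ht.2) F hF
  rcases hF with rfl | rfl | rfl
  · exact .of_forall_lt h.contDiffOn_EL.continuousOn (continuousOn_fderiv_slab h.contDiffOn_EL)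
      ht.1 htT key
  · exact .of_forall_lt h.continuousOn_ET h.continuousOn_fderiv_ET ht.1 htT key
  · exact .of_forall_lt h.contDiffOn_B.continuousOn (continuousOn_fderiv_slab h.contDiffOn_B)
      ht.1 htT key

end Solution

/-! ### Suprema and the choice of constants. -/

lemma supNorm_add_le {V : Type} [NormedAddCommGroup V] {F G H : E3 → V} {c d : ℝ} (hc : 0 ≤ c)
    (hF : ∀ x, ‖F x‖ ≤ c) (hG : ∀ x, ‖G x‖ ≤ c) (hH : ∀ x, ‖H x‖ ≤ c) (hd : 3 * c ≤ d) :
    supNorm F + supNorm G + supNorm H ≤ ENNReal.ofReal d := by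
  have key : ∀ {J : E3 → V}, (∀ x, ‖J x‖ ≤ c) → supNorm J ≤ ENNReal.ofReal c := fun hJ =>
    iSup_le fun x => by rw [← ofReal_norm]; exact ENNReal.ofReal_le_ofReal (hJ x)
  calc _ ≤ ENNReal.ofReal c + ENNReal.ofReal c + ENNReal.ofReal c :=
        add_le_add (add_le_add (key hF) (key hG)) (key hH)
    _ = ENNReal.ofReal (3 * c) := by
        rw [← ENNReal.ofReal_add hc hc, ← ENNReal.ofReal_add (add_nonneg hc hc) hc]
        congr 1; ring
    _ ≤ _ := ENNReal.ofReal_le_ofReal hd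

end VlasovDarwin

end

theorem proposition2 (R₀ P₀ : ℝ) (hR₀ : 0 < R₀) (hP₀ : 0 < P₀) :
    ∃ α C₂ : ℝ, 0 < α ∧ 0 < C₂ ∧
      ∀ (T : ℝ) (f : ℝ → VlasovDarwin.E3 → VlasovDarwin.E3 → ℝ)
        (EL ET B : ℝ → VlasovDarwin.E3 → VlasovDarwin.E3),
        VlasovDarwin.IsClassicalSolution T f EL ET B →
        VlasovDarwin.InitialData R₀ P₀ (f 0) →
        ∀ a : ℝ, a < T → VlasovDarwin.FreeStreaming α a EL ET B →
          ∀ t ∈ Set.Icc 1 a,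
            VlasovDarwin.fieldNorm EL ET B t ≤ ENNReal.ofReal (C₂ * t ^ (-(9 / 5) : ℝ)) ∧
            VlasovDarwin.gradFieldNorm EL ET B t ≤
              ENNReal.ofReal (C₂ * t ^ (-(8 / 3) : ℝ)) := by
  obtain ⟨C, hC⟩ := VlasovDarwin.exists_kernelBound
  have hm := VlasovDarwin.monoConst_pos (3 * (P₀ + 1))
  -- The first bound closes the bootstrap estimates for characteristics. The second keeps the
  -- deviation from free streaming below half of the monotonicity of `v` on the ball of radius `3
  -- (P₀ + 1)`.
  set α : ℝ := min (1 / 6) (VlasovDarwin.monoConst (3 * (P₀ + 1)) / 36) with hα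
  have hα0 : 0 < α := lt_min (by norm_num) (by positivity)
  have hα6 : α ≤ 1 / 6 := min_le_left _ _
  have hαP : 36 * α ≤ VlasovDarwin.monoConst (3 * (P₀ + 1)) := by
    have := min_le_right (1 / 6) (VlasovDarwin.monoConst (3 * (P₀ + 1)) / 36)
    rw [← hα] at this
    linarith
  set c := 48 * VlasovDarwin.fieldConst R₀ P₀ C / |VlasovDarwin.kernelMass| with hc
  set c' := 144 * VlasovDarwin.gradConst R₀ P₀ C / |VlasovDarwin.kernelMass| with hc'
  have hc0 : 0 ≤ c := div_nonneg
    (mul_nonneg (by norm_num) (VlasovDarwin.fieldConst_nonneg hR₀ hC.nonneg)) (abs_nonneg _)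
  have hc0' : 0 ≤ c' := div_nonneg
    (mul_nonneg (by norm_num) (VlasovDarwin.gradConst_nonneg hR₀ hC.nonneg)) (abs_nonneg _)
  -- The factors `3` count the three fields, and the summand `1` makes the constant positive.
  refine ⟨α, 3 * c + 3 * c' + 1, hα0, by positivity,
    fun T f EL ET B h hI a ha hfs t ht => ?_⟩
  have ht0 : 0 ≤ t := zero_le_one.trans ht.1
  have hdec := h.fieldDecay hR₀ hα0.le hα6 hαP hI ha hfs hC ht
  have hL := hdec EL (by simp)
  have hT := hdec ET (by simp)
  have hB := hdec B (by simp)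
  have h9 : 0 ≤ t ^ (-(9 / 5) : ℝ) := Real.rpow_nonneg ht0 _
  have h8 : 0 ≤ t ^ (-(8 / 3) : ℝ) := Real.rpow_nonneg ht0 _
  constructor
  · refine VlasovDarwin.supNorm_add_le (mul_nonneg hc0 h9) (fun x => (hT x).1)
      (fun x => (hL x).1) (fun x => (hB x).1) ?_
    rw [← mul_assoc]
    exact mul_le_mul_of_nonneg_right (by linarith) h9
  · refine VlasovDarwin.supNorm_add_le (mul_nonneg hc0' h8) (fun x => (hT x).2)
      (fun x => (hL x).2) (fun x => (hB x).2) ?_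
    rw [← mul_assoc]
    exact mul_le_mul_of_nonneg_right (by linarith) h8
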